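/- **Setting.** Let $\mathfrak p$ be a finite-dimensional real vector space and let $\gamma=(\gamma_i)_i$ be a finite family of tensors on $\mathfrak p$ of types $(r_i,s_i)$ ($r_i$ times covariant, $s_i$ times contravariant). $GL(\mathfrak p)$ acts on such tensors by $h\cdot\gamma=(h^{-1})^*\gamma$, and $\theta(A)\gamma=\frac{d}{dt}|_0\,e^{tA}\cdot\gamma$. Let $G_\gamma$ be the stabilizer of $\gamma$, $\mathfrak g_\gamma=\{A\in\mathfrak{gl}(\mathfrak p):\theta(A)\gamma=0\}$, and fix an $\mathrm{Ad}(G_\gamma)$-invariant subspace $\mathfrak q_\gamma$ with $\mathfrak{gl}(\mathfrak p)=\mathfrak g_\gamma\oplus\mathfrak q_\gamma$; put $\mathfrak q_{h\cdot\gamma}=h\mathfrak q_\gamma h^{-1}$. A *diffeomorphism-invariant geometric flow* $\partial_t\gamma=q(\gamma)$ is given by a diffeomorphism-invariant class of tensor fields $\delta$ on manifolds $M$ of dimension $\dim\mathfrak p$ that at each point correspond to $\gamma$ under some linear isomorphism $\mathfrak p\to T_xM$ (geometric structures), and an assignment to each such $\delta$ of a tensor field $q(\delta)$ on $M$ with $q(\delta)_x\in\theta(\mathfrak{gl}(T_xM))\delta_x$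 for all $x$ (this is the space of all tensors of the same type if the $GL$-orbit of $\delta_x$ is open in that vector space) such that $q(\varphi^*\delta)=\varphi^*q(\delta)$ for all diffeomorphisms $\varphi:M\to N$ and all structures $\delta$ of the class on $N$. Let $\mathfrak g=\mathfrak k\oplus\mathfrak p$ be a fixed finite-dimensional real vector space. For a Lie bracket $\mu$ on $\mathfrak g$ with $\mu(\mathfrak k,\mathfrak k)\subset\mathfrak k$ and $\mu(\mathfrak k,\mathfrak p)\subset\mathfrak p$, let $G_\mu$ be the simply connected Lie group with Lie algebra $(\mathfrak g,\mu)$ and $K_\mu$ its connected Lie subgroup with Lie algebra $\mathfrak k$. Let $\mathcal H(\gamma)$ be the set of such $\mu$ for which $K_\mu$ is closed in $G_\mu$, $\{Z\in\mathfrak k:\mu(Z,\mathfrak p)=0\}=0$, $\theta(\mathrm{ad}_\mu Z|_{\mathfrak p})\gamma=0$ for all $Z\in\mathfrak k$, and the $G_\mu$-invariant structure on $G_\mu/K_\mu$ with value $\gamma$ at the origin $o$ (where $T_o(G_\mu/K_\mu)\equiv\mathfrak p$), also denoted by $\gamma$, belongs to the class of the flow. For $\mu\in\mathcal H(\gamma)$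 let $Q_\mu\in\mathfrak q_\gamma$ be the unique operator with $\theta(Q_\mu)\gamma=q(G_\mu/K_\mu,\gamma)$ (value at $o$). Assume that $\mu\mapsto Q_\mu$ is locally Lipschitz on $\mathcal H(\gamma)$. Write $\delta_\mu(A)=\mu(A\cdot,\cdot)+\mu(\cdot,A\cdot)-A\mu(\cdot,\cdot)$ and, for $h\in GL(\mathfrak p)$, $\tilde h=\mathrm{diag}(I,h)\in GL(\mathfrak g)$; $GL(\mathfrak g)$ acts on brackets by $(H\cdot\mu)(X,Y)=H\mu(H^{-1}X,H^{-1}Y)$. Let $G/K$ be a homogeneous space with $G$ simply connected and $K$ closed and connected, with Lie algebra $\mathfrak g=\mathfrak k\oplus\mathfrak p$ of $G$ and Lie bracket $[\cdot,\cdot]\in\mathcal H(\gamma)$, where $\mathfrak k$ is the Lie algebra of $K$. Let $J\subset\mathbb R$ be an open interval containing $0$. A *$G$-invariant solution on $J$* is a family $\gamma(t)$, $t\in J$, of $G$-invariant structures of the class on $G/K$, continuously differentiable in $t$, with $\frac{\partial}{\partial t}\gamma(t)=q(\gamma(t))$ and with $\gamma(0)=\gamma$ at $o$. A *bracket flow solution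 on $J$* is a differentiable curve $\mu(t)\in\mathcal H(\gamma)$, $t\in J$, with $$\frac{d\mu}{dt}=\delta_{\mu(t)}\bigl(\mathrm{diag}(0,Q_{\mu(t)})\bigr),\qquad \mu(0)=[\cdot,\cdot].$$ Identify invariant structures on $G/K$ with their values at $o$, as tensors on $\mathfrak p$. For a $G$-invariant solution let $Q(t)\in\mathfrak q_{\gamma(t)}$ be the operator with $\theta(Q(t))\gamma(t)=q(G/K,\gamma(t))$. Consider, for $h(t)\in GL(\mathfrak p)$, $t\in J$, the equations $$\text{(i)}\quad \frac{dh}{dt}=-h(t)Q(t),\ \ h(0)=I;\qquad\qquad \text{(ii)}\quad \frac{dh}{dt}=-Q_{\mu(t)}h(t),\ \ h(0)=I.$$ **Theorem.** 1. If $\gamma(t)$ is a $G$-invariant solution on $J$, then (i) has a solution $h(t)$ on all of $J$, and for each such solution $\mu(t)=\tilde h(t)\cdot[\cdot,\cdot]$ is a bracket flow solution on $J$. 2. If $\mu(t)$ is a bracket flow solution on $J$, then (ii) has a solution $h(t)$ on all of $J$, and for each such solution $\gamma(t)=h(t)^*\gamma$ is a $G$-invariant solution on $J$. 3. Let $\gamma(t)$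 be any $G$-invariant solution and $\mu(t)$ any bracket flow solution on $J$. Then (i) has a solution on $J$; a curve $h(t)$ solves (i) on $J$ if and only if it solves (ii) on $J$; and for such $h$ and all $t\in J$, $$\gamma(t)=h(t)^*\gamma=h(t)^{-1}\cdot\gamma,\qquad \mu(t)=\tilde h(t)\cdot[\cdot,\cdot],$$ and there is an equivariant diffeomorphism $\varphi(t):G/K\to G_{\mu(t)}/K_{\mu(t)}$ with $\gamma(t)=\varphi(t)^*\gamma$ and $d\varphi(t)|_o=h(t)$, namely one induced by an isomorphism of Lie groups $G\to G_{\mu(t)}$ that maps $K$ onto $K_{\mu(t)}$ and has derivative $\tilde h(t)$ at the identity. -/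

import Mathlib

open scoped Manifold ContDiff Topology

universe u

noncomputable section

namespace BracketFlow

/-! ### Tensors on a real vector space

A geometric structure is a finite family `(γ i)` of tensors, the `i`-th one being `r i` times
covariant and `s i` times contravariant. -/

/-- The families of tensors of type `(r i, s i)`, `i : ι`, on the vector space `W`. -/
abbrev Tensors {ι : Type} (r s : ι → ℕ) (W : Type*) [AddCommGroup W] [Module ℝ W] : Type _ :=
  (i : ι) → MultilinearMap ℝ (fun _ : Fin (r i) => W)
    (MultilinearMap ℝ (fun _ : Fin (s i) => Module.Dual ℝ W) ℝ)

section Tensor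

variable {ι : Type} {r s : ι → ℕ}

/-- The pullback `L^* γ` of tensors by an invertible linear map `L`:
`(L^* γ)(w, α) = γ(L w, α ∘ L⁻¹)`. -/
def pull {W W' : Type*} [AddCommGroup W] [Module ℝ W] [TopologicalSpace W]
    [AddCommGroup W'] [Module ℝ W'] [TopologicalSpace W']
    (L : W →L[ℝ] W') (γ : Tensors r s W') : Tensors r s W := fun i =>
  (MultilinearMap.compLinearMapₗ
      (fun _ : Fin (s i) => Module.Dual.transpose (R := ℝ) L.inverse.toLinearMap)).compMultilinearMap
    ((γ i).compLinearMap (fun _ => L.toLinearMap))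

theorem pull_apply {W W' : Type*} [AddCommGroup W] [Module ℝ W] [TopologicalSpace W]
    [AddCommGroup W'] [Module ℝ W'] [TopologicalSpace W']
    (L : W →L[ℝ] W') (γ : Tensors r s W') (i : ι) (w : Fin (r i) → W)
    (α : Fin (s i) → Module.Dual ℝ W) :
    pull L γ i w α = γ i (fun k => L (w k)) (fun k => (α k).comp L.inverse.toLinearMap) := rfl

/-- The left action `h · γ = (h⁻¹)^* γ` of `GL(W)` on tensors. -/
def act {W : Type*} [AddCommGroup W] [Module ℝ W] [TopologicalSpace W]
    (h : W ≃L[ℝ] W) (γ : Tensors r s W) : Tensors r s W :=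
  pull (h.symm : W →L[ℝ] W) γ

/-- The representation `θ(A)γ = d/dt|₀ e^{tA} · γ` of `gl(W)` on tensors, that is,
`(θ(A)γ)(w, α) = - ∑ k, γ(…, A w_k, …; α) + ∑ k, γ(w; …, α_k ∘ A, …)`. -/
def theta {W : Type*} [AddCommGroup W] [Module ℝ W]
    (A : W →ₗ[ℝ] W) (γ : Tensors r s W) : Tensors r s W := fun i =>
  - ∑ k : Fin (r i), (γ i).compLinearMap (Function.update (fun _ => LinearMap.id) k A)
  + ∑ k : Fin (s i), (MultilinearMap.compLinearMapₗ
      (Function.update (fun _ => LinearMap.id) k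
        (Module.Dual.transpose (R := ℝ) A))).compMultilinearMap (γ i)

theorem theta_apply {W : Type*} [AddCommGroup W] [Module ℝ W]
    (A : W →ₗ[ℝ] W) (γ : Tensors r s W) (i : ι) (w : Fin (r i) → W)
    (α : Fin (s i) → Module.Dual ℝ W) :
    theta A γ i w α = - ∑ k, γ i (Function.update w k (A (w k))) α
      + ∑ k, γ i w (Function.update α k ((α k).comp A)) := by
  have h1 : ∀ k : Fin (r i),
      (fun j => (Function.update (fun _ => LinearMap.id) k A : Fin (r i) → W →ₗ[ℝ] W) j (w j))
        = Function.update w k (A (w k)) := by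
    intro k
    funext j
    by_cases hj : j = k
    · subst hj
      simp
    · simp [Function.update_of_ne hj]
  have h2 : ∀ k : Fin (s i),
      (fun j => (Function.update (fun _ => LinearMap.id) k (Module.Dual.transpose (R := ℝ) A) :
        Fin (s i) → Module.Dual ℝ W →ₗ[ℝ] Module.Dual ℝ W) j (α j))
        = Function.update α k ((α k).comp A) := by
    intro k
    funext j
    by_cases hj : j = k
    · subst hj
      simp [Module.Dual.transpose_apply]
    · simp [Function.update_of_ne hj]
  simp only [theta, add_apply, neg_apply, sum_apply,
    MultilinearMap.compLinearMap_apply, h1]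
  congr 1
  refine Finset.sum_congr rfl fun k _ => ?_
  rw [← h2 k]
  rfl

/-- The stabilizer algebra `g_γ = {A : θ(A)γ = 0}` as a set. -/
def stabAlgebra {W : Type*} [AddCommGroup W] [Module ℝ W] [TopologicalSpace W]
    (γ : Tensors r s W) : Set (W →L[ℝ] W) := {A | theta A.toLinearMap γ = 0}

/-- `q_γ` is an `Ad(G_γ)`-invariant complement of `g_γ` in `gl(W)`: every endomorphism is
uniquely the sum of an element of `g_γ` and an element of `q_γ`, and `h q_γ h⁻¹ ⊆ q_γ` for all
`h` in the stabilizer `G_γ` of `γ`. -/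
structure IsInvariantComplement {W : Type*} [NormedAddCommGroup W] [NormedSpace ℝ W]
    (γ : Tensors r s W) (qγ : Submodule ℝ (W →L[ℝ] W)) : Prop where
  existsUnique_add : ∀ A : W →L[ℝ] W,
    ∃! B : (W →L[ℝ] W) × (W →L[ℝ] W), B.1 ∈ stabAlgebra γ ∧ B.2 ∈ qγ ∧ A = B.1 + B.2
  conj_mem : ∀ h : W ≃L[ℝ] W, act h γ = γ → ∀ A ∈ qγ,
    (h : W →L[ℝ] W) ∘L A ∘L (h.symm : W →L[ℝ] W) ∈ qγ

/-- The subspace `q_δ = h q_γ h⁻¹` for a tensor `δ = h · γ` in the orbit `GL(W) · γ`. -/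
def complementAt {W : Type*} [NormedAddCommGroup W] [NormedSpace ℝ W]
    (γ : Tensors r s W) (qγ : Submodule ℝ (W →L[ℝ] W)) (δ : Tensors r s W) :
    Set (W →L[ℝ] W) :=
  {Q | ∃ h : W ≃L[ℝ] W, δ = act h γ ∧ (h.symm : W →L[ℝ] W) ∘L Q ∘L (h : W →L[ℝ] W) ∈ qγ}

end Tensor

/-! ### Tensor fields and geometric flows -/

section Flow

variable {ι : Type} {𝔭 : Type*} [NormedAddCommGroup 𝔭] [NormedSpace ℝ 𝔭]

/-- Families of tensor fields of the given types on the manifold `M` (modelled on `𝔭`). -/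
abbrev TensorField (r s : ι → ℕ) (𝔭 : Type*) [NormedAddCommGroup 𝔭] [NormedSpace ℝ 𝔭]
    (M : Type*) [TopologicalSpace M] [ChartedSpace 𝔭 M] : Type _ :=
  (x : M) → Tensors r s (TangentSpace 𝓘(ℝ, 𝔭) x)

/-- The pullback `φ^* δ` of tensor fields. -/
def TensorField.pullback {r s : ι → ℕ} {M N : Type*} [TopologicalSpace M] [ChartedSpace 𝔭 M]
    [TopologicalSpace N] [ChartedSpace 𝔭 N] (φ : M → N) (δ : TensorField r s 𝔭 N) :
    TensorField r s 𝔭 M :=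
  fun x => pull (mfderiv 𝓘(ℝ, 𝔭) 𝓘(ℝ, 𝔭) φ x) (δ (φ x))

/-- A diffeomorphism-invariant geometric flow `∂γ/∂t = q(γ)` for geometric structures of the type
of `γ` (a tensor on the model space `𝔭`).

`dom M` is the class of geometric structures on `M` under consideration; it is invariant under
diffeomorphisms, and its members are nondegenerate, i.e. at each point they correspond to `γ`
in a suitable basis of the tangent space.  `q` assigns to each structure `δ` of the class a tensor
field `q(δ)` of the same type, i.e. `q(δ)` takes its values in the spaces `θ(gl(T_x M)) δ_x`
tangent to the orbits `GL(T_x M) · δ_x` of nondegenerate tensors (if these orbits are open in a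
vector space `T` of tensors, then this tangent space is `T`).  The values of `q` outside of the
class are irrelevant. -/
structure GeometricFlow {r s : ι → ℕ} (γ : Tensors r s 𝔭) where
  dom : ∀ (M : Type u) [TopologicalSpace M] [ChartedSpace 𝔭 M] [IsManifold 𝓘(ℝ, 𝔭) ∞ M],
    Set (TensorField r s 𝔭 M)
  q : ∀ (M : Type u) [TopologicalSpace M] [ChartedSpace 𝔭 M] [IsManifold 𝓘(ℝ, 𝔭) ∞ M],
    TensorField r s 𝔭 M → TensorField r s 𝔭 M
  nondegenerate : ∀ (M : Type u) [TopologicalSpace M] [ChartedSpace 𝔭 M]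
    [IsManifold 𝓘(ℝ, 𝔭) ∞ M], ∀ δ ∈ dom M, ∀ x : M,
      ∃ L : 𝔭 ≃L[ℝ] TangentSpace 𝓘(ℝ, 𝔭) x,
        pull (L : 𝔭 →L[ℝ] TangentSpace 𝓘(ℝ, 𝔭) x) (δ x) = γ
  same_type : ∀ (M : Type u) [TopologicalSpace M] [ChartedSpace 𝔭 M]
    [IsManifold 𝓘(ℝ, 𝔭) ∞ M], ∀ δ ∈ dom M, ∀ x : M,
      ∃ A : TangentSpace 𝓘(ℝ, 𝔭) x →ₗ[ℝ] TangentSpace 𝓘(ℝ, 𝔭) x, q M δ x = theta A (δ x)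
  pullback_mem : ∀ (M N : Type u) [TopologicalSpace M] [ChartedSpace 𝔭 M]
    [IsManifold 𝓘(ℝ, 𝔭) ∞ M] [TopologicalSpace N] [ChartedSpace 𝔭 N]
    [IsManifold 𝓘(ℝ, 𝔭) ∞ N] (φ : M ≃ₘ^∞⟮𝓘(ℝ, 𝔭), 𝓘(ℝ, 𝔭)⟯ N), ∀ δ ∈ dom N,
      TensorField.pullback φ δ ∈ dom M
  q_pullback : ∀ (M N : Type u) [TopologicalSpace M] [ChartedSpace 𝔭 M]
    [IsManifold 𝓘(ℝ, 𝔭) ∞ M] [TopologicalSpace N] [ChartedSpace 𝔭 N]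
    [IsManifold 𝓘(ℝ, 𝔭) ∞ N] (φ : M ≃ₘ^∞⟮𝓘(ℝ, 𝔭), 𝓘(ℝ, 𝔭)⟯ N), ∀ δ ∈ dom N,
      q M (TensorField.pullback φ δ) = TensorField.pullback φ (q N δ)

end Flow

/-! ### Brackets on `𝔤 = 𝔨 ⊕ 𝔭` -/

section Bracket

variable (𝔨 𝔭 : Type*) [NormedAddCommGroup 𝔨] [NormedSpace ℝ 𝔨]
  [NormedAddCommGroup 𝔭] [NormedSpace ℝ 𝔭]

/-- Bilinear products on `𝔤 = 𝔨 ⊕ 𝔭`. -/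
abbrev Br : Type _ := (𝔨 × 𝔭) →L[ℝ] (𝔨 × 𝔭) →L[ℝ] (𝔨 × 𝔭)

variable {𝔨 𝔭}

/-- The action `(H · μ)(X, Y) = H μ(H⁻¹ X, H⁻¹ Y)` of `GL(𝔤)` on brackets. -/
def Br.act (H : (𝔨 × 𝔭) ≃L[ℝ] (𝔨 × 𝔭)) (μ : Br 𝔨 𝔭) : Br 𝔨 𝔭 :=
  (ContinuousLinearMap.compL ℝ (𝔨 × 𝔭) (𝔨 × 𝔭) (𝔨 × 𝔭) (H : (𝔨 × 𝔭) →L[ℝ] (𝔨 × 𝔭))) ∘L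
    μ.bilinearComp (H.symm : (𝔨 × 𝔭) →L[ℝ] (𝔨 × 𝔭)) (H.symm : (𝔨 × 𝔭) →L[ℝ] (𝔨 × 𝔭))

theorem Br.act_apply (H : (𝔨 × 𝔭) ≃L[ℝ] (𝔨 × 𝔭)) (μ : Br 𝔨 𝔭) (X Y : 𝔨 × 𝔭) :
    Br.act H μ X Y = H (μ (H.symm X) (H.symm Y)) := rfl

/-- `δ_μ(A) = μ(A·, ·) + μ(·, A·) - A μ(·, ·)`. -/
def Br.delta (μ : Br 𝔨 𝔭) (A : (𝔨 × 𝔭) →L[ℝ] (𝔨 × 𝔭)) : Br 𝔨 𝔭 :=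
  μ.bilinearComp A (ContinuousLinearMap.id ℝ _) + μ.bilinearComp (ContinuousLinearMap.id ℝ _) A
    - (ContinuousLinearMap.compL ℝ (𝔨 × 𝔭) (𝔨 × 𝔭) (𝔨 × 𝔭) A) ∘L μ

theorem Br.delta_apply (μ : Br 𝔨 𝔭) (A : (𝔨 × 𝔭) →L[ℝ] (𝔨 × 𝔭)) (X Y : 𝔨 × 𝔭) :
    Br.delta μ A X Y = μ (A X) Y + μ X (A Y) - A (μ X Y) := rfl

/-- `ad_μ Z |_𝔭 : 𝔭 → 𝔭` for `Z ∈ 𝔨` (the `𝔭`-component of `μ(Z, ·)`). -/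
def Br.adp (μ : Br 𝔨 𝔭) (Z : 𝔨) : 𝔭 →L[ℝ] 𝔭 :=
  ContinuousLinearMap.snd ℝ 𝔨 𝔭 ∘L μ (Z, 0) ∘L ContinuousLinearMap.inr ℝ 𝔨 𝔭

variable (𝔨) in
/-- `h̃ = diag(I, h)`. -/
def tilde (h : 𝔭 ≃L[ℝ] 𝔭) : (𝔨 × 𝔭) ≃L[ℝ] (𝔨 × 𝔭) :=
  (ContinuousLinearEquiv.refl ℝ 𝔨).prodCongr h

variable (𝔨) in
/-- `diag(0, Q)`. -/
def diagZero (Q : 𝔭 →L[ℝ] 𝔭) : (𝔨 × 𝔭) →L[ℝ] (𝔨 × 𝔭) :=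
  (0 : 𝔨 →L[ℝ] 𝔨).prodMap Q

/-- A simply connected homogeneous space `G_μ/K_μ` presented by the bracket `μ` on `𝔤 = 𝔨 ⊕ 𝔭`:
`G` is a simply connected Lie group whose Lie algebra is identified with `(𝔤, μ)` by `lieIso`, and
`K` is a closed connected subgroup of `G` with Lie algebra `𝔨`.  The quotient `G/K` carries its
smooth structure, which is the unique one for which the projection `G → G/K` is a smooth
submersion; the Lie algebra of `K` is the kernel of the derivative of the projection at `1`. -/
structure HomogeneousSpace (μ : Br 𝔨 𝔭) where
  G : Type u
  [group : Group G]
  [top : TopologicalSpace G]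
  [charted : ChartedSpace (𝔨 × 𝔭) G]
  [lieGroup : LieGroup 𝓘(ℝ, 𝔨 × 𝔭) ∞ G]
  [simplyConnected : SimplyConnectedSpace G]
  K : Subgroup G
  isClosed_K : IsClosed (K : Set G)
  isConnected_K : IsConnected (K : Set G)
  [chartedQuotient : ChartedSpace 𝔭 (G ⧸ K)]
  [manifoldQuotient : IsManifold 𝓘(ℝ, 𝔭) ∞ (G ⧸ K)]
  contMDiff_mk : ContMDiff 𝓘(ℝ, 𝔨 × 𝔭) 𝓘(ℝ, 𝔭) ∞ (QuotientGroup.mk : G → G ⧸ K)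
  surjective_mfderiv_mk : ∀ g : G, Function.Surjective
    (mfderiv 𝓘(ℝ, 𝔨 × 𝔭) 𝓘(ℝ, 𝔭) (QuotientGroup.mk : G → G ⧸ K) g)
  lieIso : (𝔨 × 𝔭) ≃L[ℝ] GroupLieAlgebra 𝓘(ℝ, 𝔨 × 𝔭) G
  lieIso_bracket : ∀ X Y : 𝔨 × 𝔭, lieIso (μ X Y) = ⁅lieIso X, lieIso Y⁆
  lie_K : ∀ X : 𝔨 × 𝔭,
    mfderiv 𝓘(ℝ, 𝔨 × 𝔭) 𝓘(ℝ, 𝔭) (QuotientGroup.mk : G → G ⧸ K) 1 (lieIso X) = 0 ↔ X.2 = 0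

attribute [instance] HomogeneousSpace.group HomogeneousSpace.top HomogeneousSpace.charted
  HomogeneousSpace.lieGroup HomogeneousSpace.simplyConnected HomogeneousSpace.chartedQuotient
  HomogeneousSpace.manifoldQuotient

namespace HomogeneousSpace

variable {μ : Br 𝔨 𝔭} (R : HomogeneousSpace.{u} μ)

/-- The manifold `G_μ/K_μ`. -/
abbrev space : Type u := R.G ⧸ R.K

/-- The projection `G_μ → G_μ/K_μ`. -/
abbrev proj (g : R.G) : R.space := QuotientGroup.mk g

/-- The origin `o = eK`. -/
abbrev origin : R.space := R.proj 1

/-- The identification `𝔭 ≡ T_o(G_μ/K_μ)`. -/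
def tangentIso : 𝔭 →L[ℝ] TangentSpace 𝓘(ℝ, 𝔭) R.origin :=
  (mfderiv 𝓘(ℝ, 𝔨 × 𝔭) 𝓘(ℝ, 𝔭) R.proj 1) ∘L
    (R.lieIso : (𝔨 × 𝔭) →L[ℝ] GroupLieAlgebra 𝓘(ℝ, 𝔨 × 𝔭) R.G) ∘L
    ContinuousLinearMap.inr ℝ 𝔨 𝔭

variable {ι : Type} {r s : ι → ℕ}

/-- The value at the origin of a tensor field, as a tensor on `𝔭`. -/
def atOrigin (δ : TensorField r s 𝔭 R.space) : Tensors r s 𝔭 :=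
  pull R.tangentIso (δ R.origin)

/-- `G_μ`-invariance of a tensor field on `G_μ/K_μ`. -/
def IsInvariant (δ : TensorField r s 𝔭 R.space) : Prop :=
  ∀ g : R.G, TensorField.pullback (fun x : R.space => g • x) δ = δ

/-- `δ` is the `G_μ`-invariant structure `γ_μ` on `G_μ/K_μ` determined by the tensor `γ` on
`𝔭`. -/
def IsInvariantExtension (γ : Tensors r s 𝔭) (δ : TensorField r s 𝔭 R.space) : Prop :=
  R.IsInvariant δ ∧ R.atOrigin δ = γ

end HomogeneousSpace

namespace GeometricFlow

variable {ι : Type} {r s : ι → ℕ} {γ : Tensors r s 𝔭}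

/-- The set `H(γ)` of the brackets `μ` on `𝔤 = 𝔨 ⊕ 𝔭` that present a simply connected,
almost-effective, reductive homogeneous space `G_μ/K_μ` on which `γ` determines a
`G_μ`-invariant geometric structure (of the class on which the flow is considered). -/
structure Admissible (F : GeometricFlow.{u} γ) (μ : Br 𝔨 𝔭) : Prop where
  skew : ∀ X Y, μ X Y = - μ Y X
  jacobi : ∀ X Y Z, μ X (μ Y Z) + μ Y (μ Z X) + μ Z (μ X Y) = 0
  mem_k : ∀ Z Z' : 𝔨, (μ (Z, 0) (Z', 0)).2 = 0
  mem_p : ∀ (Z : 𝔨) (X : 𝔭), (μ (Z, 0) (0, X)).1 = 0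
  closed : Nonempty (HomogeneousSpace.{u} μ)
  effective : ∀ Z : 𝔨, (∀ X : 𝔭, μ (Z, 0) (0, X) = 0) → Z = 0
  invariant : ∀ Z : 𝔨, theta (μ.adp Z).toLinearMap γ = 0
  mem_dom : ∀ R : HomogeneousSpace.{u} μ,
    ∃ δ ∈ F.dom R.space, R.IsInvariantExtension γ δ

/-- `Q = Q_μ` is the operator in `q_γ` with `θ(Q_μ)γ = q(G_μ/K_μ, γ)`. -/
def IsBracketOperator (F : GeometricFlow.{u} γ) (qγ : Submodule ℝ (𝔭 →L[ℝ] 𝔭))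
    (μ : Br 𝔨 𝔭) (Q : 𝔭 →L[ℝ] 𝔭) : Prop :=
  Q ∈ qγ ∧ ∀ R : HomogeneousSpace.{u} μ, ∀ δ : TensorField r s 𝔭 R.space,
    R.IsInvariantExtension γ δ → theta Q.toLinearMap γ = R.atOrigin (F.q R.space δ)

/-- The dependence `μ ↦ Q_μ` on `μ ∈ H(γ)` is locally Lipschitz. -/
def LocallyLipschitz (F : GeometricFlow.{u} γ) (𝔨 : Type*) [NormedAddCommGroup 𝔨]
    [NormedSpace ℝ 𝔨] (qγ : Submodule ℝ (𝔭 →L[ℝ] 𝔭)) : Prop :=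
  ∀ μ₀ : Br 𝔨 𝔭, F.Admissible μ₀ → ∃ C : ℝ, ∃ U ∈ 𝓝 μ₀, ∀ μ₁ ∈ U, ∀ μ₂ ∈ U,
    F.Admissible μ₁ → F.Admissible μ₂ → ∀ Q₁ Q₂ : 𝔭 →L[ℝ] 𝔭,
      F.IsBracketOperator qγ μ₁ Q₁ → F.IsBracketOperator qγ μ₂ Q₂ → ‖Q₁ - Q₂‖ ≤ C * ‖μ₁ - μ₂‖

/-- `μ(t)`, `t ∈ J`, is a solution of the bracket flow
`dμ/dt = δ_μ(diag(0, Q_μ))`, `μ(0) = μ₀`, in `H(γ)`. -/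
def IsBracketFlow (F : GeometricFlow.{u} γ) (qγ : Submodule ℝ (𝔭 →L[ℝ] 𝔭)) (μ₀ : Br 𝔨 𝔭)
    (J : Set ℝ) (μ : ℝ → Br 𝔨 𝔭) : Prop :=
  μ 0 = μ₀ ∧ ∀ t ∈ J, F.Admissible (μ t) ∧ ∃ Q : 𝔭 →L[ℝ] 𝔭,
    F.IsBracketOperator qγ (μ t) Q ∧ HasDerivAt μ ((μ t).delta (diagZero 𝔨 Q)) t

/-- `γ(t)`, `t ∈ J`, is a (continuously differentiable) `G`-invariant solution on `G/K` of the
geometric flow `∂γ(t)/∂t = q(γ(t))`, whose initial value `γ(0)` is determined by the tensor `γ`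
on `𝔭`. -/
structure IsInvariantSolution (F : GeometricFlow.{u} γ) {μ₀ : Br 𝔨 𝔭}
    (P : HomogeneousSpace.{u} μ₀) (J : Set ℝ) (Γ : ℝ → TensorField r s 𝔭 P.space) : Prop where
  initial : P.atOrigin (Γ 0) = γ
  mem_dom : ∀ t ∈ J, Γ t ∈ F.dom P.space
  invariant : ∀ t ∈ J, P.IsInvariant (Γ t)
  hasDerivAt : ∀ t ∈ J, ∀ (x : P.space) (i : ι) (w : Fin (r i) → TangentSpace 𝓘(ℝ, 𝔭) x)
    (α : Fin (s i) → Module.Dual ℝ (TangentSpace 𝓘(ℝ, 𝔭) x)),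
      HasDerivAt (fun τ => Γ τ x i w α) (F.q P.space (Γ t) x i w α) t
  continuousOn : ∀ (x : P.space) (i : ι) (w : Fin (r i) → TangentSpace 𝓘(ℝ, 𝔭) x)
    (α : Fin (s i) → Module.Dual ℝ (TangentSpace 𝓘(ℝ, 𝔭) x)),
      ContinuousOn (fun τ => F.q P.space (Γ τ) x i w α) J

/-- `dh/dt = - h(t) Q(t)`, `h(0) = I`, where `Q(t) ∈ q_{γ(t)}` and
`θ(Q(t))γ(t) = q(G/K, γ(t))`. -/
def SolvesI (F : GeometricFlow.{u} γ) (qγ : Submodule ℝ (𝔭 →L[ℝ] 𝔭)) {μ₀ : Br 𝔨 𝔭}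
    (P : HomogeneousSpace.{u} μ₀) (J : Set ℝ) (Γ : ℝ → TensorField r s 𝔭 P.space)
    (h : ℝ → 𝔭 ≃L[ℝ] 𝔭) : Prop :=
  h 0 = ContinuousLinearEquiv.refl ℝ 𝔭 ∧ ∀ t ∈ J, ∃ Q : 𝔭 →L[ℝ] 𝔭,
    Q ∈ complementAt γ qγ (P.atOrigin (Γ t)) ∧
    theta Q.toLinearMap (P.atOrigin (Γ t)) = P.atOrigin (F.q P.space (Γ t)) ∧
    HasDerivAt (fun τ => (h τ : 𝔭 →L[ℝ] 𝔭)) (- ((h t : 𝔭 →L[ℝ] 𝔭) ∘L Q)) t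

/-- `dh/dt = - Q_{μ(t)} h(t)`, `h(0) = I`. -/
def SolvesII (F : GeometricFlow.{u} γ) (qγ : Submodule ℝ (𝔭 →L[ℝ] 𝔭))
    (J : Set ℝ) (μ : ℝ → Br 𝔨 𝔭) (h : ℝ → 𝔭 ≃L[ℝ] 𝔭) : Prop :=
  h 0 = ContinuousLinearEquiv.refl ℝ 𝔭 ∧ ∀ t ∈ J, ∃ Q : 𝔭 →L[ℝ] 𝔭,
    F.IsBracketOperator qγ (μ t) Q ∧
    HasDerivAt (fun τ => (h τ : 𝔭 →L[ℝ] 𝔭)) (- (Q ∘L (h t : 𝔭 →L[ℝ] 𝔭))) t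

end GeometricFlow

/-- `φ : G/K → G_μ/K_μ` is the equivariant diffeomorphism `φ(gK) = ψ(g)K_μ` determined by an
isomorphism of Lie groups `ψ : G → G_μ` with `ψ(K) = K_μ` and derivative `h̃ = diag(I, h)` at the
identity; moreover, its derivative at the origin is `h`. -/
def IsEquivariantDiffeo {μ₀ μ : Br 𝔨 𝔭} (P : HomogeneousSpace.{u} μ₀)
    (R : HomogeneousSpace.{u} μ) (h : 𝔭 ≃L[ℝ] 𝔭)
    (φ : P.space ≃ₘ^∞⟮𝓘(ℝ, 𝔭), 𝓘(ℝ, 𝔭)⟯ R.space) : Prop :=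
  (∃ ψ : P.G ≃* R.G,
    ContMDiff 𝓘(ℝ, 𝔨 × 𝔭) 𝓘(ℝ, 𝔨 × 𝔭) ∞ ψ ∧
    ContMDiff 𝓘(ℝ, 𝔨 × 𝔭) 𝓘(ℝ, 𝔨 × 𝔭) ∞ ψ.symm ∧
    (∀ X : 𝔨 × 𝔭, tangentMap 𝓘(ℝ, 𝔨 × 𝔭) 𝓘(ℝ, 𝔨 × 𝔭) ψ ⟨1, P.lieIso X⟩
      = ⟨1, R.lieIso (tilde 𝔨 h X)⟩) ∧
    P.K.map ψ.toMonoidHom = R.K ∧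
    (∀ g : P.G, φ (P.proj g) = R.proj (ψ g)) ∧
    (∀ (g : P.G) (x : P.space), φ (g • x) = ψ g • φ x)) ∧
  ∀ X : 𝔭, tangentMap 𝓘(ℝ, 𝔭) 𝓘(ℝ, 𝔭) φ ⟨P.origin, P.tangentIso X⟩
    = ⟨R.origin, R.tangentIso (h X)⟩

end Bracket

end BracketFlow

end

/-!
The proof rests on two facts about a curve `h(t)` in `GL(𝔭)`.

The first is infinitesimal. If `h' = -hQ` and `γ' = θ(Q)γ`, then `h(t) · γ(t)` has zero derivative,
so `γ(t) = h(t)^* γ(0)` (`pull_symm_eq_of_hasDerivAt`); and if `h' = -Qh`, then the derivative of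
`μ(t) = h̃(t) · μ(0)` is `δ_{μ(t)}(diag(0, Q))`, and conversely every curve `μ` that satisfies this
equation is `h̃(t) · μ(0)` (`hasDerivAt_act`, `act_tilde_eq_of_hasDerivAt`).

The second is global. If `μ₂ = h̃ · μ₁`, then `h̃` is an isomorphism of Lie algebras, which
integrates to an isomorphism of the simply connected groups that maps `K` onto `K`; it induces an
equivariant diffeomorphism of the homogeneous spaces with derivative `h` at the origin
(`HomogeneousSpace.exists_isEquivariantDiffeo`). The pullback by this diffeomorphism preserves the
class of the flow and commutes with `q`, and it turns a tensor `δ` at the origin into `h^* δ`. Hence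
`γ` is the value at the origin of an invariant structure on `G_μ/K_μ`, `μ = h̃ · [·,·]`, as soon as
`h^* γ` is one on `G/K`, and the operators are related by `Q_μ = h Q h⁻¹`
(`GeometricFlow.isBracketOperator_act_iff`). Under this relation the equations `h' = -hQ` and
`h' = -Q_μ h` are the same, and the two facts together turn solutions of either flow into solutions
of the other one.

Three points need more work.

* Integration of the isomorphism `h̃` is Lie's second theorem (`exists_monoidHom_mder`). A
  homomorphism with derivative `f` satisfies a total differential equation in the charts at the
  identity; compatibility of `f` with the brackets is its integrability condition
  (`relField_integrable`), so it has local solutions by Frobenius' theorem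
  (`exists_total_differential`). By uniqueness a solution is a local homomorphism, which extends to
  the simply connected group by means of a covering space (`exists_monoidHom_eventuallyEq`).

* Solvability of `h' = -hQ(t)` on all of `J` requires that `Q(t)` is continuous. As all `γ(t)` lie
  in one orbit of `GL(𝔭)`, the maps `A ↦ θ(A)γ(t)` have constant rank, so there is locally a
  continuous choice of `A(t)` with `θ(A(t))γ(t) = γ'(t)`. The solution of `k' = -kA` writes `γ(t)`
  as `k(t)^* γ(t₀)` with differentiable `k`, and `Q(t)` is the projection of `A(t)` conjugated by
  `k(t)` (`IsInvariantComplement.exists_continuousOn_operator`).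

* To see that the third part applies to any pair of solutions, the bracket flow has to have unique
  solutions; this is the only use, apart from the continuity of `Q_{μ(t)}`, of the local Lipschitz
  condition (`GeometricFlow.IsBracketFlow.eqOn`).

That `h̃ · [·,·]` satisfies the condition `θ(ad Z)γ = 0` follows from the invariance of the structure
on `G/K`, by differentiating the isotropy representation
(`HomogeneousSpace.thetaHom_adp_eq_zero`).
-/

namespace BracketFlow

open Set Metric Filter

/-! ### Linear differential equations -/

section LinearODE

variable {V : Type*} [NormedAddCommGroup V] [NormedSpace ℝ V]

/-- The Picard–Lindelöf theorem, with the information that the solution stays in the ball on which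
the vector field is controlled. -/
theorem exists_solution_mem_closedBall [CompleteSpace V] {f : ℝ → V → V} {tmin tmax : ℝ}
    {t₀ : Icc tmin tmax} {x₀ : V} {a L K : NNReal} (hf : IsPicardLindelof f t₀ x₀ a 0 L K) :
    ∃ α : ℝ → V, α t₀ = x₀ ∧ ∀ t ∈ Icc tmin tmax,
      HasDerivWithinAt α (f t (α t)) (Icc tmin tmax) t ∧ α t ∈ closedBall x₀ a := by
  have hx : x₀ ∈ closedBall x₀ ((0 : NNReal) : ℝ) := mem_closedBall_self le_rfl
  obtain ⟨α, hα⟩ := ODE.FunSpace.exists_isFixedPt_next hf hx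
  refine ⟨α.compProj, by rw [ODE.FunSpace.compProj_val, ← hα, ODE.FunSpace.next_apply₀],
    fun t ht => ⟨?_, α.compProj_mem_closedBall hf.mul_max_le⟩⟩
  apply ODE.hasDerivWithinAt_picard_Icc t₀.2 hf.continuousOn_uncurry
    α.continuous_compProj.continuousOn (fun _ ht' => α.compProj_mem_closedBall hf.mul_max_le)
    x₀ ht |>.congr_of_mem _ ht
  intro t' ht'
  nth_rw 1 [← hα]
  rw [ODE.FunSpace.compProj_of_mem ht', ODE.FunSpace.next_apply]

/-- A linear differential equation with continuous coefficients on a compact interval is solvable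
on the whole interval.  The coefficients are cut off outside of a large ball, which a solution
cannot leave by Grönwall's inequality. -/
theorem exists_linear_solution_Icc [FiniteDimensional ℝ V] (L : ℝ → V →L[ℝ] V) {a b : ℝ}
    (hab : a ≤ b) (hL : ContinuousOn L (Icc a b)) (x₀ : V) :
    ∃ α : ℝ → V, α a = x₀ ∧
      ∀ t ∈ Icc a b, HasDerivWithinAt α (L t (α t)) (Icc a b) t := by
  have : CompleteSpace V := FiniteDimensional.complete ℝ V
  obtain ⟨M, hM⟩ := isCompact_Icc.exists_bound_of_continuousOn hL
  have hM0 : 0 ≤ M := (norm_nonneg _).trans (hM a (left_mem_Icc.2 hab))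
  -- `N` exceeds Grönwall's bound for the solutions, and `ρ x = x` for `‖x‖ ≤ N`, so solutions of
  -- the cut-off equation solve the given one
  set N : ℝ := ‖x₀‖ * Real.exp (M * (b - a)) + 1 with hN
  have hNpos : 0 < N := by positivity
  let χ : ContDiffBump (0 : V) := ⟨N, N + 1, hNpos, by linarith⟩
  let ρ : V → V := fun x => χ x • x
  have hρs : ContDiff ℝ ∞ ρ := χ.contDiff.smul contDiff_id
  have hρc : HasCompactSupport ρ := χ.hasCompactSupport.smul_right
  obtain ⟨C, hC⟩ := hρs.lipschitzWith_of_hasCompactSupport hρc (by simp)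
  obtain ⟨B, hB⟩ := hρc.exists_bound_of_continuous hρs.continuous
  have hB0 : 0 ≤ B := (norm_nonneg _).trans (hB 0)
  have hρle : ∀ x, ‖ρ x‖ ≤ ‖x‖ := by
    intro x
    rw [norm_smul, Real.norm_of_nonneg χ.nonneg]
    exact mul_le_of_le_one_left (norm_nonneg _) χ.le_one
  have hpl : IsPicardLindelof (fun t x => L t (ρ x)) (tmin := a) (tmax := b)
      ⟨a, left_mem_Icc.2 hab⟩ x₀ (Real.toNNReal (M * B * (b - a))) 0
      (Real.toNNReal (M * B)) (Real.toNNReal M * C) := by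
    refine ⟨?_, ?_, ?_, ?_⟩
    · intro t ht
      refine (LipschitzWith.comp ?_ hC).lipschitzOnWith
      refine (L t).lipschitz.weaken ?_
      rw [← NNReal.coe_le_coe, Real.coe_toNNReal _ hM0]
      exact hM t ht
    · intro x _
      exact hL.clm_apply continuousOn_const
    · intro t ht x _
      rw [Real.coe_toNNReal _ (by positivity)]
      exact (L t).le_of_opNorm_le_of_le (hM t ht) (hB x)
    · have h1 : 0 ≤ b - a := by linarith
      rw [Real.coe_toNNReal _ (by positivity), Real.coe_toNNReal _ (by positivity)]
      simp [h1]
  obtain ⟨α, hα0, hα⟩ := exists_solution_mem_closedBall hpl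
  refine ⟨α, hα0, fun t ht => ?_⟩
  have hbound : ∀ t ∈ Icc a b, ‖α t‖ ≤ gronwallBound ‖x₀‖ M 0 (t - a) := by
    refine norm_le_gronwallBound_of_norm_deriv_right_le
      (f' := fun t => L t (ρ (α t))) (fun t ht => (hα t ht).1.continuousWithinAt) ?_
      (by rw [show α a = x₀ from hα0]) ?_
    · intro t ht
      exact ((hα t (Ico_subset_Icc_self ht)).1).mono_of_mem_nhdsWithin
        (Icc_mem_nhdsGE_of_mem ht)
    · intro t ht
      rw [add_zero]
      exact (L t).le_of_opNorm_le_of_le (hM t (Ico_subset_Icc_self ht)) (hρle _)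
  have h2 : ‖α t‖ ≤ N := by
    refine (hbound t ht).trans ?_
    rw [gronwallBound_ε0, hN]
    have : Real.exp (M * (t - a)) ≤ Real.exp (M * (b - a)) := by
      gcongr
      exact ht.2
    have := mul_le_mul_of_nonneg_left this (norm_nonneg x₀)
    linarith
  have h3 : ρ (α t) = α t := by
    have : χ (α t) = 1 := χ.one_of_mem_closedBall (by simpa using h2)
    simp [ρ, this]
  have h4 := (hα t ht).1
  simp only [h3] at h4
  exact h4

/-- The derivative of a curve of inverses. -/
theorem hasDerivAt_symm [CompleteSpace V] {h : ℝ → V ≃L[ℝ] V} {h' : V →L[ℝ] V} {t : ℝ}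
    (hh : HasDerivAt (fun τ => (h τ : V →L[ℝ] V)) h' t) :
    HasDerivAt (fun τ => ((h τ).symm : V →L[ℝ] V))
      (-(((h t).symm : V →L[ℝ] V) ∘L h' ∘L ((h t).symm : V →L[ℝ] V))) t := by
  let e : (V →L[ℝ] V)ˣ := (ContinuousLinearEquiv.unitsEquiv ℝ V).symm (h t)
  have h0 : HasFDerivAt (𝕜 := ℝ) Ring.inverse
      (-ContinuousLinearMap.mulLeftRight ℝ (V →L[ℝ] V) ↑e⁻¹ ↑e⁻¹) ((fun τ => (h τ : V →L[ℝ] V)) t) :=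
    hasFDerivAt_ringInverse e
  have h1 := h0.comp_hasDerivAt t hh
  have h2 : (Ring.inverse ∘ fun τ => (h τ : V →L[ℝ] V)) = fun τ => ((h τ).symm : V →L[ℝ] V) := by
    funext τ
    exact Ring.inverse_unit ((ContinuousLinearEquiv.unitsEquiv ℝ V).symm (h τ))
  rw [h2] at h1
  exact h1

theorem eq_of_hasDerivAt_zero {W : Type*} [NormedAddCommGroup W] [NormedSpace ℝ W] {J : Set ℝ}
    (hJ : IsOpen J) (hJ' : J.OrdConnected) {c : ℝ → W} (hc : ∀ t ∈ J, HasDerivAt c 0 t)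
    {s t : ℝ} (hs : s ∈ J) (ht : t ∈ J) : c s = c t :=
  hJ.is_const_of_deriv_eq_zero hJ'.isPreconnected
    (fun x hx => (hc x hx).differentiableAt.differentiableWithinAt)
    (fun x hx => (hc x hx).deriv) hs ht

theorem hasDerivAt_clm_comp {U V W : Type*} [NormedAddCommGroup U] [NormedSpace ℝ U]
    [NormedAddCommGroup V] [NormedSpace ℝ V] [NormedAddCommGroup W] [NormedSpace ℝ W]
    {a : ℝ → V →L[ℝ] W} {b : ℝ → U →L[ℝ] V} {a' : V →L[ℝ] W} {b' : U →L[ℝ] V} {t : ℝ}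
    (ha : HasDerivAt a a' t) (hb : HasDerivAt b b' t) :
    HasDerivAt (fun τ => a τ ∘L b τ) (a' ∘L b t + a t ∘L b') t := ha.clm_comp hb

/-- Solutions of `h' = -h Q` in `GL(V)` are unique. -/
theorem eq_of_deriv_eq_neg_comp [CompleteSpace V] {J : Set ℝ}
    (hJ : IsOpen J) (hJ' : J.OrdConnected) {Q : ℝ → V →L[ℝ] V} {h k : ℝ → V ≃L[ℝ] V}
    (hh : ∀ t ∈ J, HasDerivAt (fun τ => (h τ : V →L[ℝ] V)) (-((h t : V →L[ℝ] V) ∘L Q t)) t)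
    (hk : ∀ t ∈ J, HasDerivAt (fun τ => (k τ : V →L[ℝ] V)) (-((k t : V →L[ℝ] V) ∘L Q t)) t)
    {s t : ℝ} (hs : s ∈ J) (ht : t ∈ J) (hst : h s = k s) : h t = k t := by
  have h1 : ∀ t ∈ J, HasDerivAt (fun τ => (h τ : V →L[ℝ] V) ∘L ((k τ).symm : V →L[ℝ] V)) 0 t := by
    intro t ht
    refine (hasDerivAt_clm_comp (hh t ht) (hasDerivAt_symm (hk t ht))).congr_deriv ?_
    ext x
    simp
  have h2 := eq_of_hasDerivAt_zero hJ hJ' h1 hs ht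
  ext x
  have h3 := congrArg (fun f : V →L[ℝ] V => f (k t x)) h2
  simp only [hst] at h3
  simpa using h3.symm

/-- The equation `g' = -gQ` on a compact interval has a solution in `GL(V)`: the solution `k` of
`k' = Qk` is the inverse of `g`. -/
theorem exists_linear_solution_GL_Ioo [FiniteDimensional ℝ V] (Q : ℝ → V →L[ℝ] V)
    {a b : ℝ} (h0 : (0 : ℝ) ∈ Ioo a b) (hQ : ContinuousOn Q (Icc a b)) :
    ∃ h : ℝ → V ≃L[ℝ] V, h 0 = ContinuousLinearEquiv.refl ℝ V ∧
      ∀ t ∈ Ioo a b, HasDerivAt (fun τ => (h τ : V →L[ℝ] V)) (-((h t : V →L[ℝ] V) ∘L Q t)) t := by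
  have : CompleteSpace V := FiniteDimensional.complete ℝ V
  have hab : a ≤ b := (h0.1.trans h0.2).le
  let R : ℝ → (V →L[ℝ] V) →L[ℝ] (V →L[ℝ] V) := fun t =>
    -((ContinuousLinearMap.compL ℝ V V V).flip (Q t))
  let R' : ℝ → (V →L[ℝ] V) →L[ℝ] (V →L[ℝ] V) := fun t => ContinuousLinearMap.compL ℝ V V V (Q t)
  obtain ⟨g, hg0, hg⟩ := exists_linear_solution_Icc R hab
    (((ContinuousLinearMap.compL ℝ V V V).flip.continuous.comp_continuousOn hQ).neg)
    (ContinuousLinearMap.id ℝ V)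
  obtain ⟨k, hk0, hk⟩ := exists_linear_solution_Icc R' hab
    ((ContinuousLinearMap.compL ℝ V V V).continuous.comp_continuousOn hQ)
    (ContinuousLinearMap.id ℝ V)
  have hgk : ∀ t ∈ Icc a b, g t ∘L k t = ContinuousLinearMap.id ℝ V := by
    have hd : ∀ t ∈ Icc a b, HasDerivWithinAt (fun τ => g τ ∘L k τ) 0 (Icc a b) t := by
      intro t ht
      refine ((hg t ht).clm_comp (hk t ht)).congr_deriv ?_
      ext x
      simp [R, R']
    intro t ht
    have h1 := constant_of_has_deriv_right_zero (f := fun τ => g τ ∘L k τ) (a := a) (b := b)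
      (fun t ht => (hd t ht).continuousWithinAt)
      (fun t ht => (hd t (Ico_subset_Icc_self ht)).mono_of_mem_nhdsWithin
        (Icc_mem_nhdsGE_of_mem ht)) t ht
    simpa [hg0, hk0] using h1
  -- in finite dimension a right inverse is a left inverse
  have hkg : ∀ t ∈ Icc a b, k t ∘L g t = ContinuousLinearMap.id ℝ V := by
    intro t ht
    have h1 : (g t).toLinearMap ∘ₗ (k t).toLinearMap = LinearMap.id := by
      have := congrArg ContinuousLinearMap.toLinearMap (hgk t ht)
      exact this
    have h2 := (LinearMap.comp_eq_id_comm ℝ V).1 h1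
    ext x
    exact congrArg (fun f : V →ₗ[ℝ] V => f x) h2
  classical
  let e : ℝ → V ≃L[ℝ] V := fun t =>
    if ht : t ∈ Icc a b then
      ContinuousLinearEquiv.equivOfInverse (g t) (k t)
        (fun x => congrArg (fun f : V →L[ℝ] V => f x) (hkg t ht))
        (fun x => congrArg (fun f : V →L[ℝ] V => f x) (hgk t ht))
    else ContinuousLinearEquiv.refl ℝ V
  have he : ∀ t ∈ Icc a b, (e t : V →L[ℝ] V) = g t := by
    intro t ht
    simp only [e, dif_pos ht]
    rfl
  refine ⟨fun t => (e t).trans (e 0).symm, by ext x; simp, fun t ht => ?_⟩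
  have h1 : HasDerivAt g (R t (g t)) t :=
    (hg t (Ioo_subset_Icc_self ht)).hasDerivAt (Icc_mem_nhds ht.1 ht.2)
  have h2 : (fun τ => (((e τ).trans (e 0).symm : V ≃L[ℝ] V) : V →L[ℝ] V)) =ᶠ[𝓝 t]
      fun τ => ((e 0).symm : V →L[ℝ] V) ∘L g τ := by
    filter_upwards [Ioo_mem_nhds ht.1 ht.2] with τ hτ
    rw [← he τ (Ioo_subset_Icc_self hτ)]
    rfl
  refine HasDerivAt.congr_of_eventuallyEq ?_ h2
  refine (((ContinuousLinearMap.compL ℝ V V V ((e 0).symm : V →L[ℝ] V)).hasFDerivAt).comp_hasDerivAt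
    t h1).congr_deriv ?_
  rw [← he t (Ioo_subset_Icc_self ht)]
  ext x
  simp [R]

/-- The equation `h' = -h Q`, `h(0) = I`, with `Q` continuous on an open interval `J`, has a solution
in `GL(V)` on all of `J`. -/
theorem exists_linear_solution_GL [FiniteDimensional ℝ V] {J : Set ℝ}
    (hJ : IsOpen J) (hJ' : J.OrdConnected) (h0 : (0 : ℝ) ∈ J) (Q : ℝ → V →L[ℝ] V)
    (hQ : ContinuousOn Q J) :
    ∃ h : ℝ → V ≃L[ℝ] V, h 0 = ContinuousLinearEquiv.refl ℝ V ∧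
      ∀ t ∈ J, HasDerivAt (fun τ => (h τ : V →L[ℝ] V)) (-((h t : V →L[ℝ] V) ∘L Q t)) t := by
  have : CompleteSpace V := FiniteDimensional.complete ℝ V
  have hex : ∀ t ∈ J, ∃ a b : ℝ, 0 ∈ Ioo a b ∧ t ∈ Ioo a b ∧ Icc a b ⊆ J := by
    have hstep : ∀ s ∈ J, ∃ ε > 0, s - ε ∈ J ∧ s + ε ∈ J := by
      intro s hs
      obtain ⟨ε, hε, hε'⟩ := Metric.isOpen_iff.1 hJ s hs
      refine ⟨ε / 2, by positivity, hε' ?_, hε' ?_⟩ <;>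
        simp [abs_of_pos hε, half_lt_self hε]
    intro t ht
    rcases le_total 0 t with h | h
    · obtain ⟨ε, hε, h1, -⟩ := hstep 0 h0
      obtain ⟨ε', hε', -, h2⟩ := hstep t ht
      exact ⟨_, _, ⟨by linarith, by linarith⟩, ⟨by linarith, by linarith⟩, hJ'.out h1 h2⟩
    · obtain ⟨ε, hε, -, h1⟩ := hstep 0 h0
      obtain ⟨ε', hε', h2, -⟩ := hstep t ht
      exact ⟨_, _, ⟨by linarith, by linarith⟩, ⟨by linarith, by linarith⟩, hJ'.out h2 h1⟩
  choose! a b hab ht hsub using hex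
  have hsol := fun t (htJ : t ∈ J) =>
    exists_linear_solution_GL_Ioo Q (hab t htJ) (hQ.mono (hsub t htJ))
  choose! k hk0 hk using hsol
  -- by uniqueness the solutions `k t` on the intervals `(a t, b t)` fit together
  refine ⟨fun t => k t t, hk0 0 h0, fun t htJ => ?_⟩
  refine (hk t htJ t (ht t htJ)).congr_of_eventuallyEq ?_
  filter_upwards [Ioo_mem_nhds (ht t htJ).1 (ht t htJ).2] with τ hτ
  have hτJ : τ ∈ J := hsub t htJ (Ioo_subset_Icc_self hτ)
  have h1 := eq_of_deriv_eq_neg_comp (J := Ioo (a τ) (b τ) ∩ Ioo (a t) (b t))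
    (isOpen_Ioo.inter isOpen_Ioo) (ordConnected_Ioo.inter ordConnected_Ioo)
    (Q := Q) (h := k τ) (k := k t)
    (fun s hs => hk τ hτJ s hs.1) (fun s hs => hk t htJ s hs.2)
    (s := 0) (t := τ) ⟨hab τ hτJ, hab t htJ⟩ ⟨ht τ hτJ, hτ⟩ ((hk0 τ hτJ).trans (hk0 t htJ).symm)
  simp only [h1]

end LinearODE

/-! ### Total differential equations -/

section TotalDifferential

variable {E E' : Type*} [NormedAddCommGroup E] [NormedSpace ℝ E]
  [NormedAddCommGroup E'] [NormedSpace ℝ E']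

/-- First-order Taylor estimate for a function with Lipschitz derivative on a convex set. -/
theorem norm_taylor_le {F : Type*} [NormedAddCommGroup F] [NormedSpace ℝ F] {f : E → F} {B : Set E}
    (hB : Convex ℝ B) (hf : ∀ p ∈ B, HasFDerivAt f (fderiv ℝ f p) p) {K : NNReal}
    (hK : LipschitzOnWith K (fderiv ℝ f) B) {p q : E} (hp : p ∈ B) (hq : p + q ∈ B) :
    ‖f (p + q) - f p - fderiv ℝ f p q‖ ≤ K * ‖q‖ * ‖q‖ := by
  have h := (hB.inter (convex_closedBall p ‖q‖)).norm_image_sub_le_of_norm_hasFDerivWithin_le'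
    (f := f) (f' := fderiv ℝ f) (φ := fderiv ℝ f p) (C := K * ‖q‖) (x := p) (y := p + q)
    (fun x hx => (hf x hx.1).hasFDerivWithinAt) ?_
    ⟨hp, mem_closedBall_self (norm_nonneg _)⟩ ⟨hq, by simp⟩
  · simpa using h
  · intro x hx
    refine (hK.norm_sub_le hx.1 hp).trans ?_
    gcongr
    simpa [dist_eq_norm] using hx.2

/-- **Frobenius' theorem** for a total differential equation `du = A(x, u)`, `u(x₀) = y₀`, whose
integrability condition holds near `(x₀, y₀)`.  The solution is constructed along the rays starting
at `x₀`; if `w_ξ(s)` denotes the solution along the ray `x₀ + s ξ`, then integrability says that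
`w_ξ(s) + A(x₀ + s ξ, w_ξ(s)) (s η)` satisfies the equation of `w_{ξ + η}` up to an error
`O(‖η‖²)`, and Grönwall's inequality gives the derivative of `u(x₀ + ξ) = w_ξ(1)`. -/
theorem exists_total_differential [FiniteDimensional ℝ E] [FiniteDimensional ℝ E']
    {A : E × E' → E →L[ℝ] E'} {x₀ : E} {y₀ : E'} (hA : ContDiffAt ℝ 2 A (x₀, y₀))
    (hint : ∀ᶠ p in 𝓝 (x₀, y₀), ∀ a b : E,
      fderiv ℝ A p (a, A p a) b = fderiv ℝ A p (b, A p b) a) :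
    ∃ u : E → E', u x₀ = y₀ ∧ ∀ᶠ x in 𝓝 x₀, HasFDerivAt u (A (x, u x)) x := by
  have : CompleteSpace E' := FiniteDimensional.complete ℝ E'
  -- a convex neighbourhood on which everything is under control
  have hA1 : ContDiffAt ℝ 1 (fderiv ℝ A) (x₀, y₀) := hA.fderiv_right (by norm_num)
  obtain ⟨K₁, t₁, ht₁, hK₁⟩ := (hA.of_le (by norm_num : (1 : ℕ∞ω) ≤ 2)).exists_lipschitzOnWith
  obtain ⟨K₂, t₂, ht₂, hK₂⟩ := hA1.exists_lipschitzOnWith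
  have hev : ∀ᶠ p in 𝓝 (x₀, y₀), HasFDerivAt A (fderiv ℝ A p) p :=
    (hA.eventually (by simp)).mono fun p hp => (hp.differentiableAt (by norm_num)).hasFDerivAt
  have hb1 : ∀ᶠ p in 𝓝 (x₀, y₀), ‖A p‖ < ‖A (x₀, y₀)‖ + 1 :=
    hA.continuousAt.norm.eventually_lt continuousAt_const (by simp)
  have hb2 : ∀ᶠ p in 𝓝 (x₀, y₀), ‖fderiv ℝ A p‖ < ‖fderiv ℝ A (x₀, y₀)‖ + 1 :=
    (ContinuousAt.norm (E := E × E' →L[ℝ] E →L[ℝ] E') hA1.continuousAt).eventually_lt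
      continuousAt_const (lt_add_one _)
  obtain ⟨ε, hε, hball⟩ := Metric.eventually_nhds_iff_ball.1
    ((((hint.and hev).and (hb1.and hb2)).and (Filter.eventually_mem_set.2 ht₁)).and
      (Filter.eventually_mem_set.2 ht₂))
  set M : ℝ := ‖A (x₀, y₀)‖ + 1 with hM
  set M₁ : ℝ := ‖fderiv ℝ A (x₀, y₀)‖ + 1 with hM₁
  set B : Set (E × E') := ball (x₀, y₀) ε with hB
  have hMpos : 0 < M := by positivity
  have hM₁pos : 0 < M₁ := by positivity
  have hBconv : Convex ℝ B := convex_ball _ _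
  have hmemB : ∀ x y, ‖x - x₀‖ < ε → ‖y - y₀‖ < ε → (x, y) ∈ B := by
    intro x y hx hy
    rw [hB, mem_ball, Prod.dist_eq, max_lt_iff, dist_eq_norm, dist_eq_norm]
    exact ⟨hx, hy⟩
  replace hK₁ : LipschitzOnWith K₁ A B := hK₁.mono fun p hp => (hball p hp).1.2
  replace hK₂ : LipschitzOnWith K₂ (fderiv ℝ A) B := hK₂.mono fun p hp => (hball p hp).2
  have hAM : ∀ p ∈ B, ‖A p‖ ≤ M := fun p hp => (hball p hp).1.1.2.1.le
  have hAM₁ : ∀ p ∈ B, ‖fderiv ℝ A p‖ ≤ M₁ := fun p hp => (hball p hp).1.1.2.2.le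
  have hAd : ∀ p ∈ B, HasFDerivAt A (fderiv ℝ A p) p := fun p hp => (hball p hp).1.1.1.2
  have hAi : ∀ p ∈ B, ∀ a b : E, fderiv ℝ A p (a, A p a) b = fderiv ℝ A p (b, A p b) a :=
    fun p hp => (hball p hp).1.1.1.1
  -- the radius of the domain of the solution
  -- for `‖ξ‖ < ρ` the rays stay within distance `ε / 2` of `x₀`, and the solutions along them, which
  -- have speed at most `M * ρ`, within distance `ε / 2` of `y₀`
  obtain ⟨ρ, hρ, hρε, hρM⟩ : ∃ ρ > 0, ρ < ε / 2 ∧ M * ρ < ε / 4 := by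
    refine ⟨min (ε / 4) (ε / (8 * M)), by positivity,
      (min_le_left _ _).trans_lt (by linarith), ?_⟩
    calc M * min (ε / 4) (ε / (8 * M)) ≤ M * (ε / (8 * M)) := by
          gcongr
          exact min_le_right _ _
      _ = ε / 8 := by field_simp
      _ < ε / 4 := by linarith
  -- the field along rays
  let v : E → ℝ → E' → E' := fun ξ t y => A (x₀ + t • ξ, y) ξ
  have hray : ∀ ξ : E, ‖ξ‖ < ρ → ∀ t ∈ Icc (0 : ℝ) 1, ‖(x₀ + t • ξ) - x₀‖ < ε / 2 := by
    intro ξ hξ t ht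
    rw [add_sub_cancel_left, norm_smul, Real.norm_of_nonneg ht.1]
    calc t * ‖ξ‖ ≤ 1 * ‖ξ‖ := by gcongr; exact ht.2
      _ < ε / 2 := by linarith
  have hvlip : ∀ ξ : E, ‖ξ‖ < ρ → ∀ t ∈ Icc (0 : ℝ) 1,
      LipschitzOnWith (K₁ * Real.toNNReal ρ + 1) (v ξ t) (ball y₀ ε) := by
    intro ξ hξ t ht
    refine LipschitzOnWith.of_dist_le_mul fun y hy y' hy' => ?_
    have h1 : (x₀ + t • ξ, y) ∈ B := hmemB _ _ ((hray ξ hξ t ht).trans (by linarith))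
      (by simpa [dist_eq_norm] using hy)
    have h2 : (x₀ + t • ξ, y') ∈ B := hmemB _ _ ((hray ξ hξ t ht).trans (by linarith))
      (by simpa [dist_eq_norm] using hy')
    have h3 := hK₁.norm_sub_le h1 h2
    rw [dist_eq_norm, dist_eq_norm]
    calc ‖v ξ t y - v ξ t y'‖ = ‖(A (x₀ + t • ξ, y) - A (x₀ + t • ξ, y')) ξ‖ := by simp [v]
      _ ≤ (K₁ * ‖y - y'‖) * ρ := by
          refine ContinuousLinearMap.le_of_opNorm_le_of_le _ (h3.trans ?_) hξ.le
          simp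
      _ ≤ _ := by
          push_cast
          rw [Real.coe_toNNReal _ hρ.le]
          nlinarith [norm_nonneg (y - y')]
  have hsol : ∀ ξ : E, ‖ξ‖ < ρ → ∃ w : ℝ → E', w 0 = y₀ ∧ ∀ t ∈ Icc (0 : ℝ) 1,
      HasDerivWithinAt w (v ξ t (w t)) (Icc 0 1) t ∧ w t ∈ closedBall y₀ (ε / 2) := by
    intro ξ hξ
    have hsub : closedBall y₀ (ε / 2) ⊆ ball y₀ ε := closedBall_subset_ball (by linarith)
    have hco : ((Real.toNNReal (ε / 2) : NNReal) : ℝ) = ε / 2 := Real.coe_toNNReal _ (by positivity)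
    have hpl : IsPicardLindelof (v ξ) (tmin := 0) (tmax := 1) ⟨0, left_mem_Icc.2 zero_le_one⟩ y₀
        (Real.toNNReal (ε / 2)) 0 (Real.toNNReal (M * ρ)) (K₁ * Real.toNNReal ρ + 1) := by
      refine ⟨?_, ?_, ?_, ?_⟩
      · intro t ht
        rw [hco]
        exact (hvlip ξ hξ t ht).mono hsub
      · intro y hy
        rw [hco] at hy
        have hc : ContinuousOn A B := hK₁.continuousOn
        refine ContinuousOn.clm_apply (hc.comp (by fun_prop) fun t ht => ?_) continuousOn_const
        exact hmemB _ _ ((hray ξ hξ t ht).trans (by linarith))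
          (by simpa [dist_eq_norm] using hsub hy)
      · intro t ht y hy
        rw [hco] at hy
        rw [Real.coe_toNNReal _ (by positivity)]
        exact ContinuousLinearMap.le_of_opNorm_le_of_le _ (hAM _ (hmemB _ _
          ((hray ξ hξ t ht).trans (by linarith)) (by simpa [dist_eq_norm] using hsub hy))) hξ.le
      · rw [hco, Real.coe_toNNReal _ (by positivity)]
        simp
        linarith
    obtain ⟨w, hw0, hw⟩ := exists_solution_mem_closedBall hpl
    rw [hco] at hw
    exact ⟨w, hw0, hw⟩
  choose! w hw0 hw using hsol
  set K : NNReal := K₁ * Real.toNNReal ρ + 1 with hKdef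
  have hKpos : (0 : ℝ) < K := by
    rw [hKdef]
    positivity
  set C : ℝ := K₂ * (1 + M) * (1 + M) * ρ + M₁ * (1 + M) with hC
  set C' : ℝ := C / K * (Real.exp K - 1) with hC'
  -- comparison of the solutions along neighbouring rays
  have hcomp : ∀ ξ η : E, ‖ξ‖ < ρ → ‖ξ + η‖ < ρ → M * ‖η‖ < ε / 4 →
      ‖w (ξ + η) 1 - w ξ 1 - A (x₀ + ξ, w ξ 1) η‖ ≤ C' * ‖η‖ ^ 2 := by
    intro ξ η hξ hξη hη
    -- `z` is the first-order approximation of `w (ξ + η)`, and `hbound` says that it satisfies the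
    -- equation of `w (ξ + η)` up to an error of second order
    let z : ℝ → E' := fun t => w ξ t + t • A (x₀ + t • ξ, w ξ t) η
    let P : ℝ → E × E' := fun t => (x₀ + t • ξ, w ξ t)
    have hPB : ∀ t ∈ Icc (0 : ℝ) 1, P t ∈ B := by
      intro t ht
      refine hmemB _ _ ((hray ξ hξ t ht).trans (by linarith)) ?_
      have := (hw ξ hξ t ht).2
      rw [mem_closedBall, dist_eq_norm] at this
      linarith
    let z' : ℝ → E' := fun t => A (P t) ξ +
      (t • fderiv ℝ A (P t) (ξ, A (P t) ξ) η + (1 : ℝ) • A (P t) η)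
    have hz : ∀ t ∈ Icc (0 : ℝ) 1, HasDerivWithinAt z (z' t) (Icc 0 1) t := by
      intro t ht
      have h1 : HasDerivWithinAt P (ξ, A (P t) ξ) (Icc 0 1) t := by
        refine HasDerivWithinAt.prodMk ?_ (hw ξ hξ t ht).1
        have : HasDerivAt (fun s : ℝ => x₀ + s • ξ) ((1 : ℝ) • ξ) t :=
          ((hasDerivAt_id t).smul_const ξ).const_add x₀
        simpa using this.hasDerivWithinAt
      have h2 : HasDerivWithinAt (fun s => A (P s)) (fderiv ℝ A (P t) (ξ, A (P t) ξ)) (Icc 0 1) t :=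
        (hAd _ (hPB t ht)).comp_hasDerivWithinAt t h1
      have h3 : HasDerivWithinAt (fun s => A (P s) η) (fderiv ℝ A (P t) (ξ, A (P t) ξ) η)
          (Icc 0 1) t := by
        simpa using h2.clm_apply (hasDerivWithinAt_const t _ η)
      exact (hw ξ hξ t ht).1.add ((hasDerivWithinAt_id t _).smul h3)
    have hzmem : ∀ t ∈ Icc (0 : ℝ) 1, z t ∈ ball y₀ ε := by
      intro t ht
      have h1 := (hw ξ hξ t ht).2
      rw [mem_closedBall, dist_eq_norm] at h1
      rw [mem_ball, dist_eq_norm]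
      have h2 : ‖t • A (P t) η‖ ≤ 1 * (M * ‖η‖) := by
        rw [norm_smul, Real.norm_of_nonneg ht.1]
        have := (A (P t)).le_of_opNorm_le (hAM _ (hPB t ht)) η
        have := ht.2
        have := ht.1
        gcongr
      calc ‖z t - y₀‖ = ‖(w ξ t - y₀) + t • A (P t) η‖ := by
            simp only [z, P]
            congr 1
            abel
        _ ≤ ‖w ξ t - y₀‖ + ‖t • A (P t) η‖ := norm_add_le _ _
        _ < ε := by linarith
    have hbound : ∀ t ∈ Icc (0 : ℝ) 1, dist (z' t) (v (ξ + η) t (z t)) ≤ C * ‖η‖ ^ 2 := by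
      intro t ht
      have ht0 := ht.1
      have ht1 := ht.2
      let q : E × E' := (t • η, t • A (P t) η)
      have hq : ‖q‖ ≤ (1 + M) * ‖η‖ := by
        have h1 := (A (P t)).le_of_opNorm_le (hAM _ (hPB t ht)) η
        refine max_le ?_ ?_
        · simp only [q]
          rw [norm_smul, Real.norm_of_nonneg ht0]
          nlinarith [norm_nonneg η, mul_nonneg hMpos.le (norm_nonneg η)]
        · simp only [q]
          rw [norm_smul, Real.norm_of_nonneg ht0]
          nlinarith [norm_nonneg η, norm_nonneg (A (P t) η)]
      have hPq : P t + q = (x₀ + t • (ξ + η), z t) := by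
        simp only [P, q, z, Prod.mk_add_mk, smul_add, add_assoc]
      have hPqB : P t + q ∈ B := by
        rw [hPq]
        exact hmemB _ _ ((hray _ hξη t ht).trans (by linarith))
          (by simpa [dist_eq_norm] using hzmem t ht)
      have htay := norm_taylor_le hBconv hAd hK₂ (hPB t ht) hPqB
      -- integrability exchanges the directions `ξ` and `η`
      have hi : t • fderiv ℝ A (P t) (ξ, A (P t) ξ) η = fderiv ℝ A (P t) q ξ := by
        have hq' : q = t • (η, A (P t) η) := rfl
        rw [hAi _ (hPB t ht) ξ η, hq', map_smul]
        rfl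
      have heq : v (ξ + η) t (z t) - z' t =
          (A (P t + q) - A (P t) - fderiv ℝ A (P t) q) (ξ + η) + fderiv ℝ A (P t) q η := by
        simp only [v, z', hi, ← hPq, one_smul]
        simp only [sub_apply, map_add]
        abel
      rw [dist_comm, dist_eq_norm, heq]
      have h1 : ‖(A (P t + q) - A (P t) - fderiv ℝ A (P t) q) (ξ + η)‖
          ≤ (K₂ * ((1 + M) * ‖η‖) * ((1 + M) * ‖η‖)) * ρ := by
        refine ContinuousLinearMap.le_of_opNorm_le_of_le _ (htay.trans ?_) hξη.le
        gcongr
      have h2 : ‖fderiv ℝ A (P t) q η‖ ≤ (M₁ * ((1 + M) * ‖η‖)) * ‖η‖ :=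
        ContinuousLinearMap.le_of_opNorm_le _
          (ContinuousLinearMap.le_of_opNorm_le_of_le _ (hAM₁ _ (hPB t ht)) hq) η
      refine (norm_add_le _ _).trans ((add_le_add h1 h2).trans (le_of_eq ?_))
      rw [hC]
      ring
    have hIci : ∀ {f : ℝ → E'} {f' : E'} {t : ℝ}, t ∈ Ico (0 : ℝ) 1 →
        HasDerivWithinAt f f' (Icc 0 1) t → HasDerivWithinAt f f' (Ici t) t := fun ht h =>
      h.mono_of_mem_nhdsWithin (Icc_mem_nhdsGE_of_mem ht)
    have hsub : closedBall y₀ (ε / 2) ⊆ ball y₀ ε := closedBall_subset_ball (by linarith)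
    have hfin := dist_le_of_approx_trajectories_ODE_of_mem (v := v (ξ + η)) (s := fun _ => ball y₀ ε)
      (K := K) (f := z) (f' := z') (g := w (ξ + η)) (g' := fun t => v (ξ + η) t (w (ξ + η) t))
      (a := 0) (b := 1) (εf := C * ‖η‖ ^ 2) (εg := 0) (δ := 0)
      (fun t ht => hvlip _ hξη t (Ico_subset_Icc_self ht))
      (fun t ht => (hz t ht).continuousWithinAt)
      (fun t ht => hIci ht (hz t (Ico_subset_Icc_self ht)))
      (fun t ht => hbound t (Ico_subset_Icc_self ht))
      (fun t ht => hzmem t (Ico_subset_Icc_self ht))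
      (fun t ht => (hw _ hξη t ht).1.continuousWithinAt)
      (fun t ht => hIci ht (hw _ hξη t (Ico_subset_Icc_self ht)).1)
      (fun t ht => by simp)
      (fun t ht => hsub (hw _ hξη t (Ico_subset_Icc_self ht)).2)
      (by simp [z, hw0 _ hξ, hw0 _ hξη]) 1 (right_mem_Icc.2 zero_le_one)
    rw [gronwallBound_of_K_ne_0 hKpos.ne', dist_comm, dist_eq_norm] at hfin
    have e1 : w (ξ + η) 1 - w ξ 1 - A (x₀ + ξ, w ξ 1) η = w (ξ + η) 1 - z 1 := by
      simp only [z, one_smul]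
      abel
    rw [e1]
    refine hfin.trans (le_of_eq ?_)
    simp only [hC', add_zero, sub_zero, mul_one, zero_mul, zero_add]
    ring
  refine ⟨fun x => w (x - x₀) 1, ?_, ?_⟩
  · have h0 : ‖(0 : E)‖ < ρ := by simpa using hρ
    have h1 := constant_of_has_deriv_right_zero (f := w 0) (a := 0) (b := 1)
      (fun t ht => (hw 0 h0 t ht).1.continuousWithinAt)
      (fun t ht => by
        have := (hw 0 h0 t (Ico_subset_Icc_self ht)).1.mono_of_mem_nhdsWithin
          (Icc_mem_nhdsGE_of_mem ht)
        simpa [v] using this) 1 (right_mem_Icc.2 zero_le_one)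
    simp [h1, hw0 0 h0]
  · filter_upwards [ball_mem_nhds x₀ hρ] with x hx
    have hx' : ‖x - x₀‖ < ρ := by simpa [dist_eq_norm] using hx
    rw [hasFDerivAt_iff_isLittleO_nhds_zero]
    have hO : (fun η : E => w (x + η - x₀) 1 - w (x - x₀) 1 - A (x, w (x - x₀) 1) η)
        =O[𝓝 0] fun η => ‖η‖ ^ 2 := by
      refine Asymptotics.IsBigO.of_bound C' ?_
      have h1 : ∀ᶠ η : E in 𝓝 0, ‖(x - x₀) + η‖ < ρ := by
        refine (continuous_const.add continuous_id).norm.continuousAt.eventually_lt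
          continuousAt_const ?_
        simpa using hx'
      have h2 : ∀ᶠ η : E in 𝓝 0, M * ‖η‖ < ε / 4 := by
        refine (continuous_const.mul continuous_norm).continuousAt.eventually_lt
          continuousAt_const ?_
        simpa using hε
      filter_upwards [h1, h2] with η h1 h2
      have h3 := hcomp (x - x₀) η hx' h1 h2
      rw [show x + η - x₀ = x - x₀ + η by abel]
      simpa using h3
    refine hO.trans_isLittleO ?_
    exact Asymptotics.isLittleO_norm_pow_id one_lt_two

/-- Two solutions of a total differential equation with the same value at a point agree near it. -/
theorem total_differential_unique
    {A : E × E' → E →L[ℝ] E'} {x₀ : E} {y₀ : E'} (hA : ContDiffAt ℝ 1 A (x₀, y₀))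
    {u₁ u₂ : E → E'} (h₁ : u₁ x₀ = y₀) (h₂ : u₂ x₀ = y₀)
    (hu₁ : ∀ᶠ x in 𝓝 x₀, HasFDerivAt u₁ (A (x, u₁ x)) x)
    (hu₂ : ∀ᶠ x in 𝓝 x₀, HasFDerivAt u₂ (A (x, u₂ x)) x) : ∀ᶠ x in 𝓝 x₀, u₁ x = u₂ x := by
  obtain ⟨K, t, ht, hK⟩ := hA.exists_lipschitzOnWith
  obtain ⟨ε, hε, hεt⟩ := Metric.mem_nhds_iff.1 ht
  have hc : ∀ u : E → E', u x₀ = y₀ → (∀ᶠ x in 𝓝 x₀, HasFDerivAt u (A (x, u x)) x) →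
      ∀ᶠ x in 𝓝 x₀, u x ∈ ball y₀ ε := by
    intro u hu0 hu
    refine hu.self_of_nhds.continuousAt.eventually_mem ?_
    rw [hu0]
    exact ball_mem_nhds _ hε
  obtain ⟨ρ, hρ, hball⟩ := Metric.eventually_nhds_iff_ball.1
    (((hu₁.and hu₂).and ((hc u₁ h₁ hu₁).and (hc u₂ h₂ hu₂))).and (ball_mem_nhds x₀ hε))
  filter_upwards [ball_mem_nhds x₀ hρ] with x hx
  have hmem : ∀ t ∈ Icc (0 : ℝ) 1, x₀ + t • (x - x₀) ∈ ball x₀ ρ := by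
    intro t ht
    have hx' : ‖x - x₀‖ < ρ := by simpa [dist_eq_norm] using hx
    rw [mem_ball, dist_eq_norm, add_sub_cancel_left, norm_smul, Real.norm_of_nonneg ht.1]
    exact (mul_le_of_le_one_left (norm_nonneg _) ht.2).trans_lt hx'
  have hd : ∀ u : E → E', (∀ x ∈ ball x₀ ρ, HasFDerivAt u (A (x, u x)) x) →
      ∀ t ∈ Icc (0 : ℝ) 1, HasDerivAt (fun t : ℝ => u (x₀ + t • (x - x₀)))
        (A (x₀ + t • (x - x₀), u (x₀ + t • (x - x₀))) (x - x₀)) t := by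
    intro u hu t ht
    have h1 : HasDerivAt (fun s : ℝ => x₀ + s • (x - x₀)) (x - x₀) t := by
      simpa using ((hasDerivAt_id t).smul_const (x - x₀)).const_add x₀
    exact (hu _ (hmem t ht)).comp_hasDerivAt t h1
  have hd1 := hd u₁ fun x hx => (hball x hx).1.1.1
  have hd2 := hd u₂ fun x hx => (hball x hx).1.1.2
  have := ODE_solution_unique_of_mem_Icc_right
    (v := fun t y => A (x₀ + t • (x - x₀), y) (x - x₀)) (s := fun _ => ball y₀ ε)
    (K := K * ‖x - x₀‖₊) (f := fun t : ℝ => u₁ (x₀ + t • (x - x₀)))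
    (g := fun t : ℝ => u₂ (x₀ + t • (x - x₀))) (a := 0) (b := 1) ?_
    (fun t ht => (hd1 t ht).continuousAt.continuousWithinAt)
    (fun t ht => (hd1 t (Ico_subset_Icc_self ht)).hasDerivWithinAt)
    (fun t ht => (hball _ (hmem t (Ico_subset_Icc_self ht))).1.2.1)
    (fun t ht => (hd2 t ht).continuousAt.continuousWithinAt)
    (fun t ht => (hd2 t (Ico_subset_Icc_self ht)).hasDerivWithinAt)
    (fun t ht => (hball _ (hmem t (Ico_subset_Icc_self ht))).1.2.2)
    (by simp [h₁, h₂]) (right_mem_Icc.2 zero_le_one)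
  · simpa using this
  · intro t ht
    refine LipschitzOnWith.of_dist_le_mul fun y hy y' hy' => ?_
    have hm := (hball _ (hmem t (Ico_subset_Icc_self ht))).2
    have hin : ∀ y ∈ ball y₀ ε, (x₀ + t • (x - x₀), y) ∈ ball (x₀, y₀) ε := by
      intro y hy
      rw [mem_ball, Prod.dist_eq, max_lt_iff]
      exact ⟨hm, hy⟩
    have h3 := hK.norm_sub_le (hεt (hin y hy)) (hεt (hin y' hy'))
    rw [dist_eq_norm, dist_eq_norm]
    have h4 := ContinuousLinearMap.le_of_opNorm_le _ h3 (x - x₀)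
    rw [sub_apply] at h4
    refine h4.trans (le_of_eq ?_)
    simp only [Prod.mk_sub_mk, sub_self, Prod.norm_mk, norm_zero, norm_nonneg, sup_of_le_right,
      NNReal.coe_mul, coe_nnnorm]
    ring

/-- Solutions of a smooth total differential equation are smooth. -/
theorem contDiffAt_of_total_differential {A : E × E' → E →L[ℝ] E'} {x₀ : E} {u : E → E'}
    (hA : ∀ᶠ p in 𝓝 (x₀, u x₀), ContDiffAt ℝ ∞ A p)
    (hu : ∀ᶠ x in 𝓝 x₀, HasFDerivAt u (A (x, u x)) x) : ContDiffAt ℝ ∞ u x₀ := by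
  have hc : ContinuousAt (fun x => (x, u x)) x₀ :=
    continuousAt_id.prodMk hu.self_of_nhds.continuousAt
  obtain ⟨O, hO, hOo, hxO⟩ := _root_.eventually_nhds_iff.1 (hu.and (hc.eventually hA))
  have hn : ∀ n : ℕ, ContDiffOn ℝ n u O := by
    intro n
    induction n with
    | zero =>
      exact contDiffOn_zero.2 fun x hx => (hO x hx).1.continuousAt.continuousWithinAt
    | succ n ih =>
      rw [Nat.cast_add, Nat.cast_one, contDiffOn_succ_iff_fderiv_of_isOpen hOo]
      refine ⟨fun x hx => (hO x hx).1.differentiableAt.differentiableWithinAt, by simp, ?_⟩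
      refine ContDiffOn.congr (f := fun x => A (x, u x)) ?_ fun x hx => (hO x hx).1.fderiv
      intro x hx
      exact ((hO x hx).2.of_le (by exact_mod_cast le_top)).comp_contDiffWithinAt x
        (contDiffWithinAt_id.prodMk (ih x hx))
  exact (contDiffOn_infty.2 hn).contDiffAt (hOo.mem_nhds hxO)

end TotalDifferential

/-! ### Extension of local homomorphisms -/

section Extension

variable {G H : Type*} [Group G] [TopologicalSpace G] [IsTopologicalGroup G] [Group H]

theorem eventually_inv_mul {p : G → Prop} (hp : ∀ᶠ y in 𝓝 (1 : G), p y) (x : G) :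
    ∀ᶠ x' in 𝓝 x, p (x⁻¹ * x') := by
  have h : Tendsto (fun x' => x⁻¹ * x') (𝓝 x) (𝓝 (x⁻¹ * x)) :=
    (continuous_const_mul x⁻¹).continuousAt
  rw [inv_mul_cancel] at h
  exact h.eventually hp

theorem eventually_mul_left {p : G → Prop} {x : G} (hp : ∀ᶠ y in 𝓝 x, p y) :
    ∀ᶠ y in 𝓝 (1 : G), p (x * y) := by
  have h : Tendsto (fun y => x * y) (𝓝 1) (𝓝 (x * 1)) :=
    (continuous_const_mul x).continuousAt
  rw [mul_one] at h
  exact h.eventually hp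

/-- The bundle over `G` whose flat sections are the maps that are locally of the form
`x ↦ c ψ(a⁻¹ x)`, for a local homomorphism `ψ`; its fibre is the discrete set `H`. -/
def leafBundle [TopologicalSpace H] [DiscreteTopology H] (ψ : G → H) (V : Set G) (hV : IsOpen V)
    (h1 : (1 : G) ∈ V) (hψ : ∀ x ∈ V, ∀ᶠ y in 𝓝 (1 : G), ψ (x * y) = ψ x * ψ y) :
    FiberBundleCore G G H where
  baseSet i := {x | i⁻¹ * x ∈ V}
  isOpen_baseSet i := hV.preimage (continuous_const_mul i⁻¹)
  indexAt x := x
  mem_baseSet_at x := by simpa using h1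
  coordChange i j x h := h * ψ (i⁻¹ * x) * (ψ (j⁻¹ * x))⁻¹
  coordChange_self i x _ h := by simp
  continuousOn_coordChange i j := by
    rintro ⟨x, h⟩ ⟨⟨hi, hj⟩, -⟩
    refine ContinuousAt.continuousWithinAt ?_
    have e : (fun p : G × H => p.2 * ψ (i⁻¹ * p.1) * (ψ (j⁻¹ * p.1))⁻¹) =ᶠ[𝓝 (x, h)]
        fun p => p.2 * ψ (i⁻¹ * x) * (ψ (j⁻¹ * x))⁻¹ := by
      have h1 := (eventually_inv_mul (hψ _ hi) x).and (eventually_inv_mul (hψ _ hj) x)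
      rw [nhds_prod_eq]
      filter_upwards [h1.prod_inl (𝓝 h)] with p hp
      have e1 : ∀ k : G, k⁻¹ * p.1 = k⁻¹ * x * (x⁻¹ * p.1) := fun k => by group
      rw [e1 i, e1 j, hp.1, hp.2]
      group
    refine ContinuousAt.congr ?_ e.symm
    exact (continuous_of_discreteTopology (f := fun h : H => h * ψ (i⁻¹ * x) *
      (ψ (j⁻¹ * x))⁻¹)).continuousAt.comp continuousAt_snd
  coordChange_comp i j k x _ h := by group

/-- A local homomorphism on a simply connected group extends to a homomorphism: lift the identity
to the covering space of the flat sections of `leafBundle`. -/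
theorem exists_monoidHom_eventuallyEq [SimplyConnectedSpace G] [LocallyPathConnectedSpace G]
    {ψ : G → H} (hψ : ∀ᶠ x in 𝓝 (1 : G), ∀ᶠ y in 𝓝 (1 : G), ψ (x * y) = ψ x * ψ y) :
    ∃ Ψ : G →* H, ∀ᶠ y in 𝓝 (1 : G), Ψ y = ψ y := by
  -- with the discrete topology on the fibre `H` the bundle is a covering of `G`
  let _ : TopologicalSpace H := ⊥
  have : DiscreteTopology H := ⟨rfl⟩
  obtain ⟨V, hVψ, hV, h1⟩ := eventually_nhds_iff.1 hψ
  have hψ1 : ψ 1 = 1 := by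
    have := (hVψ 1 h1).self_of_nhds
    simpa using this
  let Z := leafBundle ψ V hV h1 hVψ
  have hcov : IsCoveringMap (Bundle.TotalSpace.proj : Bundle.TotalSpace H Z.Fiber → G) :=
    FiberBundle.isCoveringMap
  obtain ⟨S, ⟨hS1, hS⟩, -⟩ := hcov.existsUnique_continuousMap_lifts (ContinuousMap.id G) 1
    (⟨1, (1 : H)⟩ : Bundle.TotalSpace H Z.Fiber) rfl
  have hSp : ∀ x, (S x).proj = x := fun x => congrFun hS x
  let val : Bundle.TotalSpace H Z.Fiber → H := fun p => p.snd
  let Φ : G → H := fun x => val (S x)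
  have hΦ1 : Φ 1 = 1 := by
    change val (S 1) = 1
    rw [hS1]
  -- the section is locally flat
  have hloc : ∀ x : G, ∀ᶠ y in 𝓝 (1 : G), Φ (x * y) = Φ x * ψ y := by
    intro x
    have hx : x ∈ (Z.localTriv x).baseSet := Z.mem_baseSet_at x
    have hc : ContinuousAt (fun x' => (Z.localTriv x (S x')).2) x := by
      refine continuousAt_snd.comp (ContinuousAt.comp ?_ S.continuous.continuousAt)
      refine (Z.localTriv x).continuousOn.continuousAt ((Z.localTriv x).open_source.mem_nhds ?_)
      rw [(Z.localTriv x).mem_source]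
      change (S x).proj ∈ _
      rw [hSp]
      exact hx
    have hv : ∀ x', (Z.localTriv x (S x')).2 = Φ x' * (ψ (x⁻¹ * x'))⁻¹ := by
      intro x'
      change Φ x' * ψ ((S x').proj⁻¹ * (S x').proj) * (ψ (x⁻¹ * (S x').proj))⁻¹ = _
      rw [inv_mul_cancel, hψ1, mul_one, hSp]
    simp only [hv] at hc
    have hev := hc.eventually (IsOpen.mem_nhds (isOpen_discrete {Φ x * (ψ (x⁻¹ * x))⁻¹}) rfl)
    filter_upwards [eventually_mul_left hev] with y hy
    have hy' : Φ (x * y) * (ψ (x⁻¹ * (x * y)))⁻¹ = Φ x * (ψ (x⁻¹ * x))⁻¹ := hy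
    rw [inv_mul_cancel_left, inv_mul_cancel, hψ1, inv_one, mul_one] at hy'
    rw [← hy', inv_mul_cancel_right]
  have hmul : ∀ a b, Φ (a * b) = Φ a * Φ b := by
    intro a b
    -- `b ↦ Φ (a * b) * (Φ b)⁻¹` is locally constant, hence equal to its value `Φ a` at `1`
    have hlc : IsLocallyConstant fun b => Φ (a * b) * (Φ b)⁻¹ := by
      rw [IsLocallyConstant.iff_eventually_eq]
      intro b
      filter_upwards [eventually_inv_mul ((hloc (a * b)).and (hloc b)) b] with b' hb'
      have e1 : Φ (a * b') = Φ (a * b) * ψ (b⁻¹ * b') := by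
        rw [← hb'.1]
        congr 1
        group
      have e2 : Φ b' = Φ b * ψ (b⁻¹ * b') := by
        rw [← hb'.2]
        congr 1
        group
      rw [e1, e2]
      group
    have := hlc.apply_eq_of_isPreconnected isPreconnected_univ (mem_univ b) (mem_univ 1)
    simp only [mul_one, hΦ1, inv_one] at this
    rw [← this, inv_mul_cancel_right]
  refine ⟨{ toFun := Φ, map_one' := hΦ1, map_mul' := hmul }, ?_⟩
  filter_upwards [hloc 1] with y hy
  simpa [hΦ1] using hy

/-- A subgroup of a connected group that is a neighbourhood of `1` is everything. -/
theorem subgroup_eq_top_of_eventually_mem [ConnectedSpace G] (S : Subgroup G)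
    (hS : ∀ᶠ x in 𝓝 (1 : G), x ∈ S) : S = ⊤ := by
  have ho : IsOpen (S : Set G) := S.isOpen_of_mem_nhds hS
  have hc : IsClopen (S : Set G) := ⟨S.isClosed_of_isOpen ho, ho⟩
  have := hc.eq_univ ⟨1, S.one_mem⟩
  exact SetLike.coe_injective this

end Extension

/-! ### Derivatives of maps between manifolds modelled on vector spaces -/

section Derivative

variable {E E' E'' : Type*} [NormedAddCommGroup E] [NormedSpace ℝ E]
  [NormedAddCommGroup E'] [NormedSpace ℝ E'] [NormedAddCommGroup E''] [NormedSpace ℝ E'']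
  {M N O : Type*} [TopologicalSpace M] [ChartedSpace E M] [TopologicalSpace N] [ChartedSpace E' N]
  [TopologicalSpace O] [ChartedSpace E'' O]

/-- `D` is the derivative of `f` at `x`, where tangent spaces are replaced by the model spaces that
they are equal to by definition. -/
def MDer (f : M → N) (x : M) (D : E →L[ℝ] E') : Prop :=
  HasMFDerivAt 𝓘(ℝ, E) 𝓘(ℝ, E') f x D

variable (E E') in
/-- The derivative of `f` at `x` as a linear map between the model spaces. -/
noncomputable def md (f : M → N) (x : M) : E →L[ℝ] E' := mfderiv 𝓘(ℝ, E) 𝓘(ℝ, E') f x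

theorem MDer.comp {f : M → N} {g : N → O} {x : M} {D : E →L[ℝ] E'} {D' : E' →L[ℝ] E''}
    (hg : MDer (M := N) (N := O) g (f x) D') (hf : MDer (M := M) (N := N) f x D) :
    MDer (M := M) (N := O) (g ∘ f) x (D' ∘L D) :=
  HasMFDerivAt.comp x hg hf

theorem MDer.md_eq {f : M → N} {x : M} {D : E →L[ℝ] E'} (h : MDer f x D) : md E E' f x = D :=
  h.mfderiv

theorem MDer.unique {f : M → N} {x : M} {D D' : E →L[ℝ] E'} (h : MDer f x D) (h' : MDer f x D') :
    D = D' := h.md_eq.symm.trans h'.md_eq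

theorem MDer.mdifferentiableAt {f : M → N} {x : M} {D : E →L[ℝ] E'} (h : MDer f x D) :
    MDifferentiableAt 𝓘(ℝ, E) 𝓘(ℝ, E') f x := HasMFDerivAt.mdifferentiableAt h

theorem mder_md {f : M → N} {x : M} (h : MDifferentiableAt 𝓘(ℝ, E) 𝓘(ℝ, E') f x) :
    MDer f x (md E E' f x) := h.hasMFDerivAt

theorem mder_of_contMDiffAt {f : M → N} {x : M} {n : ℕ∞ω}
    (h : ContMDiffAt 𝓘(ℝ, E) 𝓘(ℝ, E') n f x) (hn : n ≠ 0) :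
    MDer f x (md E E' f x) := mder_md (h.mdifferentiableAt hn)

theorem mder_iff {f : E → E'} {x : E} {D : E →L[ℝ] E'} : MDer f x D ↔ HasFDerivAt f D x :=
  hasMFDerivAt_iff_hasFDerivAt

theorem MDer.congr {f f' : M → N} {x : M} {D : E →L[ℝ] E'} (h : MDer f x D) (hf : f' =ᶠ[𝓝 x] f) :
    MDer f' x D := HasMFDerivAt.congr_of_eventuallyEq h hf

theorem mder_id (x : M) : MDer (fun y : M => y) x (ContinuousLinearMap.id ℝ E) := hasMFDerivAt_id x

theorem mder_const (x : M) (y : N) : MDer (fun _ : M => y) x (0 : E →L[ℝ] E') :=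
  hasMFDerivAt_const y x

variable [IsManifold 𝓘(ℝ, E) ∞ M]

theorem isManifold_one : IsManifold 𝓘(ℝ, E) 1 M :=
  IsManifold.of_le (n := ∞) (by exact_mod_cast le_top)

variable (E) in
theorem mder_chart_self (x : M) :
    MDer (extChartAt 𝓘(ℝ, E) x) x (ContinuousLinearMap.id ℝ E) := by
  have := isManifold_one (E := E) (M := M)
  have h := (mdifferentiableAt_extChartAt (I := 𝓘(ℝ, E)) (mem_chart_source E x)).hasMFDerivAt
  rw [mfderiv_extChartAt_self] at h
  exact h

theorem contMDiffAt_chart {x y : M} (hy : y ∈ (extChartAt 𝓘(ℝ, E) x).source) :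
    ContMDiffAt 𝓘(ℝ, E) 𝓘(ℝ, E) ∞ (extChartAt 𝓘(ℝ, E) x) y :=
  contMDiffAt_extChartAt' (by simpa using hy)

theorem contMDiffAt_chart_symm {x : M} {y : E} (hy : y ∈ (extChartAt 𝓘(ℝ, E) x).target) :
    ContMDiffAt 𝓘(ℝ, E) 𝓘(ℝ, E) ∞ (extChartAt 𝓘(ℝ, E) x).symm y :=
  (contMDiffOn_extChartAt_symm x).contMDiffAt ((isOpen_extChartAt_target x).mem_nhds hy)

theorem mder_chart {x y : M} (hy : y ∈ (extChartAt 𝓘(ℝ, E) x).source) :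
    MDer (extChartAt 𝓘(ℝ, E) x) y (md E E (extChartAt 𝓘(ℝ, E) x) y) :=
  mder_of_contMDiffAt (contMDiffAt_chart hy) (by simp)

theorem mder_chart_symm {x : M} {y : E} (hy : y ∈ (extChartAt 𝓘(ℝ, E) x).target) :
    MDer (extChartAt 𝓘(ℝ, E) x).symm y (md E E (extChartAt 𝓘(ℝ, E) x).symm y) :=
  mder_of_contMDiffAt (contMDiffAt_chart_symm hy) (by simp)

theorem md_chart_comp_md_symm {x : M} {y : E} (hy : y ∈ (extChartAt 𝓘(ℝ, E) x).target) :
    md E E (extChartAt 𝓘(ℝ, E) x) ((extChartAt 𝓘(ℝ, E) x).symm y) ∘L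
      md E E (extChartAt 𝓘(ℝ, E) x).symm y = ContinuousLinearMap.id ℝ E := by
  have h1 := (mder_chart ((extChartAt 𝓘(ℝ, E) x).map_target hy)).comp (mder_chart_symm hy)
  refine h1.unique ((mder_id y).congr ?_)
  filter_upwards [(isOpen_extChartAt_target x).mem_nhds hy] with z hz
  exact (extChartAt 𝓘(ℝ, E) x).right_inv hz

theorem md_symm_comp_md_chart {x : M} {y : E} (hy : y ∈ (extChartAt 𝓘(ℝ, E) x).target) :
    md E E (extChartAt 𝓘(ℝ, E) x).symm y ∘L
      md E E (extChartAt 𝓘(ℝ, E) x) ((extChartAt 𝓘(ℝ, E) x).symm y) =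
        ContinuousLinearMap.id ℝ E := by
  have hs := (extChartAt 𝓘(ℝ, E) x).map_target hy
  have h0 := mder_chart_symm hy
  rw [← (extChartAt 𝓘(ℝ, E) x).right_inv hy] at h0
  have h1 := h0.comp (mder_chart hs)
  rw [(extChartAt 𝓘(ℝ, E) x).right_inv hy] at h1
  refine h1.unique ((mder_id _).congr ?_)
  filter_upwards [(isOpen_extChartAt_source x).mem_nhds hs] with z hz
  exact (extChartAt 𝓘(ℝ, E) x).left_inv hz

variable (E) in
theorem mder_chart_symm_self (x : M) :
    MDer (extChartAt 𝓘(ℝ, E) x).symm (extChartAt 𝓘(ℝ, E) x x) (ContinuousLinearMap.id ℝ E) := by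
  have h := md_symm_comp_md_chart (E := E) (mem_extChartAt_target (I := 𝓘(ℝ, E)) x)
  rw [extChartAt_to_inv, (mder_chart_self E x).md_eq, ContinuousLinearMap.comp_id] at h
  have h2 := mder_chart_symm (E := E) (mem_extChartAt_target (I := 𝓘(ℝ, E)) x)
  rwa [h] at h2

end Derivative

/-! ### Left-invariant frames -/

section Frame

variable {E : Type*} [NormedAddCommGroup E] [NormedSpace ℝ E]
  {G : Type*} [Group G] [TopologicalSpace G] [ChartedSpace E G] [LieGroup 𝓘(ℝ, E) ∞ G]

theorem isTopologicalGroup_of_lieGroup (E G : Type*) [NormedAddCommGroup E] [NormedSpace ℝ E]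
    [Group G] [TopologicalSpace G] [ChartedSpace E G] [LieGroup 𝓘(ℝ, E) ∞ G] :
    IsTopologicalGroup G :=
  topologicalGroup_of_lieGroup 𝓘(ℝ, E) ∞

theorem contMDiff_leftMul (g : G) : ContMDiff 𝓘(ℝ, E) 𝓘(ℝ, E) ∞ (fun x : G => g * x) :=
  contMDiff_mul_left

/-- The derivative at `1` of the left translation by `g`. -/
noncomputable def leftD (E : Type*) [NormedAddCommGroup E] [NormedSpace ℝ E] {G : Type*} [Group G]
    [TopologicalSpace G] [ChartedSpace E G] (g : G) : E →L[ℝ] E :=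
  md E E (fun x : G => g * x) 1

theorem mder_leftMul (g x : G) :
    MDer (fun x : G => g * x) x (md E E (fun x : G => g * x) x) :=
  mder_of_contMDiffAt (contMDiff_leftMul g).contMDiffAt (by simp)

theorem leftD_mul (a g : G) : leftD E (a * g) = md E E (fun x : G => a * x) g ∘L leftD E g := by
  have h0 := mder_leftMul (E := E) a (g * 1)
  have h1 := h0.comp (f := fun x => g * x) (mder_leftMul (E := E) g 1)
  have h2 : ((fun x : G => a * x) ∘ fun x => g * x) = fun x => a * g * x := by
    funext x
    simp [mul_assoc]
  rw [h2, mul_one] at h1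
  exact h1.md_eq

theorem leftD_one : leftD E (1 : G) = ContinuousLinearMap.id ℝ E := by
  have h : (fun x : G => 1 * x) = fun x => x := by
    funext x
    simp
  rw [leftD, h]
  exact (mder_id (1 : G)).md_eq

theorem leftD_comp_inv (g : G) :
    leftD E g ∘L md E E (fun x : G => g⁻¹ * x) g = ContinuousLinearMap.id ℝ E := by
  have h0 := mder_leftMul (E := E) g 1
  rw [← inv_mul_cancel g] at h0
  have h1 := h0.comp (f := fun x => g⁻¹ * x) (mder_leftMul (E := E) g⁻¹ g)
  rw [inv_mul_cancel] at h1
  refine h1.unique ((mder_id g).congr ?_)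
  exact Eventually.of_forall fun x => by simp

theorem inv_comp_leftD (g : G) :
    md E E (fun x : G => g⁻¹ * x) g ∘L leftD E g = ContinuousLinearMap.id ℝ E := by
  rw [← leftD_mul, inv_mul_cancel, leftD_one]

/-- `F` maps left-invariant vector fields to left-invariant vector fields at `g`, by means of the
linear map `f` between the Lie algebras. -/
def IsRelated {E' : Type*} [NormedAddCommGroup E'] [NormedSpace ℝ E'] {H : Type*} [Group H]
    [TopologicalSpace H] [ChartedSpace E' H] (f : E →L[ℝ] E') (F : G → H) (g : G) : Prop :=
  ∃ D : E →L[ℝ] E', MDer F g D ∧ D ∘L leftD E g = leftD E' (F g) ∘L f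

variable {E' : Type*} [NormedAddCommGroup E'] [NormedSpace ℝ E']
  {H : Type*} [Group H] [TopologicalSpace H] [ChartedSpace E' H] [LieGroup 𝓘(ℝ, E') ∞ H]

theorem IsRelated.translate {f : E →L[ℝ] E'} {F : G → H} {g : G} (a : H) (b : G)
    (h : IsRelated f F (b * g)) : IsRelated f (fun x => a * F (b * x)) g := by
  obtain ⟨D, hD, hf⟩ := h
  have h1 := hD.comp (f := fun x => b * x) (mder_leftMul (E := E) b g)
  refine ⟨_, (mder_leftMul (E := E') a (F (b * g))).comp (f := fun x => F (b * x)) h1, ?_⟩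
  rw [ContinuousLinearMap.comp_assoc, ContinuousLinearMap.comp_assoc, ← leftD_mul, hf, leftD_mul,
    ContinuousLinearMap.comp_assoc]

/-- A differentiable homomorphism maps left-invariant fields to left-invariant fields. -/
theorem isRelated_of_monoidHom {f : E →L[ℝ] E'} {F : G →* H} (hF : MDer F 1 f) (g : G) :
    IsRelated f F g := by
  have h1 : IsRelated f F (g⁻¹ * g) := by
    rw [inv_mul_cancel]
    refine ⟨f, hF, ?_⟩
    rw [map_one, leftD_one, leftD_one]
    rfl
  have h2 := h1.translate (F g) g⁻¹
  have h3 : (fun x => F g * F (g⁻¹ * x)) = F := by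
    funext x
    rw [← map_mul, mul_inv_cancel_left]
  rwa [h3] at h2

/-- The product of `G` in the chart at `1`. -/
noncomputable def mulChart (E : Type*) [NormedAddCommGroup E] [NormedSpace ℝ E] (G : Type*)
    [Group G] [TopologicalSpace G] [ChartedSpace E G] (p : E × E) : E :=
  extChartAt 𝓘(ℝ, E) (1 : G)
    ((extChartAt 𝓘(ℝ, E) (1 : G)).symm p.1 * (extChartAt 𝓘(ℝ, E) (1 : G)).symm p.2)

/-- The left-invariant fields in the chart at `1`: `frame x v` is the value at `x` of the field with
value `v` at the identity. -/
noncomputable def frame (E : Type*) [NormedAddCommGroup E] [NormedSpace ℝ E] (G : Type*)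
    [Group G] [TopologicalSpace G] [ChartedSpace E G] (x : E) : E →L[ℝ] E :=
  fderiv ℝ (fun y => mulChart E G (x, y)) (extChartAt 𝓘(ℝ, E) (1 : G) 1)

theorem contDiffAt_mulChart {x y : E} (hx : x ∈ (extChartAt 𝓘(ℝ, E) (1 : G)).target)
    (hy : y ∈ (extChartAt 𝓘(ℝ, E) (1 : G)).target)
    (hxy : (extChartAt 𝓘(ℝ, E) (1 : G)).symm x * (extChartAt 𝓘(ℝ, E) (1 : G)).symm y ∈
      (extChartAt 𝓘(ℝ, E) (1 : G)).source) :
    ContDiffAt ℝ ∞ (mulChart E G) (x, y) := by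
  rw [← contMDiffAt_iff_contDiffAt]
  have h1 : ContMDiffAt 𝓘(ℝ, E × E) 𝓘(ℝ, E) ∞
      (fun p : E × E => (extChartAt 𝓘(ℝ, E) (1 : G)).symm p.1) (x, y) :=
    (contMDiffAt_chart_symm hx).comp (x, y) contDiff_fst.contMDiff.contMDiffAt
  have h2 : ContMDiffAt 𝓘(ℝ, E × E) 𝓘(ℝ, E) ∞
      (fun p : E × E => (extChartAt 𝓘(ℝ, E) (1 : G)).symm p.2) (x, y) :=
    (contMDiffAt_chart_symm hy).comp (x, y) contDiff_snd.contMDiff.contMDiffAt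
  exact (contMDiffAt_chart hxy).comp (x, y) (h1.mul h2)

theorem frame_eq {x : E} (hx : x ∈ (extChartAt 𝓘(ℝ, E) (1 : G)).target) :
    frame E G x = md E E (extChartAt 𝓘(ℝ, E) (1 : G)) ((extChartAt 𝓘(ℝ, E) (1 : G)).symm x) ∘L
      leftD E ((extChartAt 𝓘(ℝ, E) (1 : G)).symm x) := by
  set g := (extChartAt 𝓘(ℝ, E) (1 : G)).symm x with hg
  have hgs : g ∈ (extChartAt 𝓘(ℝ, E) (1 : G)).source := (extChartAt 𝓘(ℝ, E) (1 : G)).map_target hx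
  have h1 : MDer (fun x : G => g * x) (1 : G) (leftD E g) := mder_leftMul g 1
  have h0 := mder_chart hgs
  rw [← mul_one g] at h0
  have h2 := h0.comp (f := fun x => g * x) h1
  have h3 : (extChartAt 𝓘(ℝ, E) (1 : G)).symm (extChartAt 𝓘(ℝ, E) (1 : G) 1) = 1 :=
    extChartAt_to_inv (1 : G)
  rw [← h3] at h2
  have h4 := h2.comp (mder_chart_symm_self E (1 : G))
  rw [ContinuousLinearMap.comp_id, h3, mul_one] at h4
  exact (mder_iff.1 h4).fderiv

theorem contDiffAt_frame {x : E} (hx : x ∈ (extChartAt 𝓘(ℝ, E) (1 : G)).target) :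
    ContDiffAt ℝ ∞ (frame E G) x := by
  have h1 : ContDiffAt ℝ ∞ (mulChart E G) (x, extChartAt 𝓘(ℝ, E) (1 : G) 1) := by
    refine contDiffAt_mulChart hx (mem_extChartAt_target 1) ?_
    rw [extChartAt_to_inv, mul_one]
    exact (extChartAt 𝓘(ℝ, E) (1 : G)).map_target hx
  exact ContDiffAt.fderiv (f := fun x y => mulChart E G (x, y)) h1 contDiffAt_const
    (by simp)

theorem symm_comp_frame {x : E} (hx : x ∈ (extChartAt 𝓘(ℝ, E) (1 : G)).target) :
    md E E (extChartAt 𝓘(ℝ, E) (1 : G)).symm x ∘L frame E G x =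
      leftD E ((extChartAt 𝓘(ℝ, E) (1 : G)).symm x) := by
  rw [frame_eq hx, ← ContinuousLinearMap.comp_assoc, md_symm_comp_md_chart hx,
    ContinuousLinearMap.id_comp]

theorem isInvertible_frame {x : E} (hx : x ∈ (extChartAt 𝓘(ℝ, E) (1 : G)).target) :
    (frame E G x).IsInvertible := by
  set g := (extChartAt 𝓘(ℝ, E) (1 : G)).symm x with hg
  refine ContinuousLinearMap.IsInvertible.of_inverse
    (g := md E E (fun x : G => g⁻¹ * x) g ∘L md E E (extChartAt 𝓘(ℝ, E) (1 : G)).symm x) ?_ ?_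
  · rw [frame_eq hx, ContinuousLinearMap.comp_assoc, ← hg,
      ← ContinuousLinearMap.comp_assoc (leftD E g), leftD_comp_inv, ContinuousLinearMap.id_comp]
    exact md_chart_comp_md_symm hx
  · rw [ContinuousLinearMap.comp_assoc, symm_comp_frame hx]
    exact inv_comp_leftD g

theorem inverse_frame_comp {x : E} (hx : x ∈ (extChartAt 𝓘(ℝ, E) (1 : G)).target) :
    (frame E G x).inverse ∘L frame E G x = ContinuousLinearMap.id ℝ E := by
  obtain ⟨e, he⟩ := isInvertible_frame (G := G) hx
  rw [← he, ContinuousLinearMap.inverse_equiv]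
  ext v
  simp

theorem frame_comp_inverse {x : E} (hx : x ∈ (extChartAt 𝓘(ℝ, E) (1 : G)).target) :
    frame E G x ∘L (frame E G x).inverse = ContinuousLinearMap.id ℝ E := by
  obtain ⟨e, he⟩ := isInvertible_frame (G := G) hx
  rw [← he, ContinuousLinearMap.inverse_equiv]
  ext v
  simp

/-- The right hand side of the total differential equation satisfied by a map, read in the charts at
`1`, that relates left-invariant fields by means of `f`. -/
noncomputable def relField (G H : Type*) [Group G] [TopologicalSpace G] [ChartedSpace E G]
    [Group H] [TopologicalSpace H] [ChartedSpace E' H] (f : E →L[ℝ] E') (p : E × E') :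
    E →L[ℝ] E' :=
  frame E' H p.2 ∘L f ∘L (frame E G p.1).inverse

/-- A map that relates left-invariant fields solves, in the charts at `1`, the total differential
equation given by `relField`. -/
theorem IsRelated.hasFDerivAt {f : E →L[ℝ] E'} {F : G → H} {x : E}
    (hx : x ∈ (extChartAt 𝓘(ℝ, E) (1 : G)).target)
    (hF : F ((extChartAt 𝓘(ℝ, E) (1 : G)).symm x) ∈ (extChartAt 𝓘(ℝ, E') (1 : H)).source)
    (h : IsRelated f F ((extChartAt 𝓘(ℝ, E) (1 : G)).symm x)) :
    HasFDerivAt (fun x => extChartAt 𝓘(ℝ, E') (1 : H) (F ((extChartAt 𝓘(ℝ, E) (1 : G)).symm x)))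
      (relField G H f (x, extChartAt 𝓘(ℝ, E') (1 : H) (F ((extChartAt 𝓘(ℝ, E) (1 : G)).symm x))))
      x := by
  obtain ⟨D, hD, hf⟩ := h
  set g := (extChartAt 𝓘(ℝ, E) (1 : G)).symm x with hg
  set y := extChartAt 𝓘(ℝ, E') (1 : H) (F g) with hy
  have hyt : y ∈ (extChartAt 𝓘(ℝ, E') (1 : H)).target :=
    (extChartAt 𝓘(ℝ, E') (1 : H)).map_source hF
  have hyF : (extChartAt 𝓘(ℝ, E') (1 : H)).symm y = F g :=
    (extChartAt 𝓘(ℝ, E') (1 : H)).left_inv hF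
  have h1 := ((mder_chart hF).comp hD).comp (mder_chart_symm hx)
  have h2 := mder_iff.1 h1
  refine h2.congr_fderiv ?_
  have h3 : (md E' E' (extChartAt 𝓘(ℝ, E') (1 : H)) (F g) ∘L D ∘L
      md E E (extChartAt 𝓘(ℝ, E) (1 : G)).symm x) ∘L frame E G x = frame E' H y ∘L f := by
    rw [frame_eq hyt, hyF, ContinuousLinearMap.comp_assoc, ContinuousLinearMap.comp_assoc,
      ContinuousLinearMap.comp_assoc, symm_comp_frame hx, ← hf]
  calc _ = (md E' E' (extChartAt 𝓘(ℝ, E') (1 : H)) (F g) ∘L D ∘L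
      md E E (extChartAt 𝓘(ℝ, E) (1 : G)).symm x) ∘L (frame E G x ∘L (frame E G x).inverse) := by
        rw [frame_comp_inverse hx]
        rfl
    _ = _ := by
        rw [← ContinuousLinearMap.comp_assoc, h3]
        rfl

/-- Conversely, solutions of the total differential equation given by `relField` define maps that
relate left-invariant fields. -/
theorem isRelated_of_hasFDerivAt {f : E →L[ℝ] E'} {u : E → E'} {x : E}
    (hx : x ∈ (extChartAt 𝓘(ℝ, E) (1 : G)).target)
    (hux : u x ∈ (extChartAt 𝓘(ℝ, E') (1 : H)).target)
    (h : HasFDerivAt u (relField G H f (x, u x)) x) :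
    IsRelated f (fun g => (extChartAt 𝓘(ℝ, E') (1 : H)).symm (u (extChartAt 𝓘(ℝ, E) (1 : G) g)))
      ((extChartAt 𝓘(ℝ, E) (1 : G)).symm x) := by
  have hr := (extChartAt 𝓘(ℝ, E) (1 : G)).right_inv hx
  have h1 := (mder_chart_symm hux).comp (mder_iff.2 h)
  rw [← hr] at h1
  have h2 := h1.comp (mder_chart ((extChartAt 𝓘(ℝ, E) (1 : G)).map_target hx))
  refine ⟨_, h2, ?_⟩
  simp only [hr]
  rw [ContinuousLinearMap.comp_assoc, ContinuousLinearMap.comp_assoc, ← frame_eq hx, relField,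
    ContinuousLinearMap.comp_assoc, ContinuousLinearMap.comp_assoc, inverse_frame_comp hx,
    ContinuousLinearMap.comp_id, ← ContinuousLinearMap.comp_assoc, symm_comp_frame hux]

theorem contDiffAt_relField [CompleteSpace E] {f : E →L[ℝ] E'} {p : E × E'}
    (hx : p.1 ∈ (extChartAt 𝓘(ℝ, E) (1 : G)).target)
    (hy : p.2 ∈ (extChartAt 𝓘(ℝ, E') (1 : H)).target) : ContDiffAt ℝ ∞ (relField G H f) p := by
  have h1 : ContDiffAt ℝ ∞ (fun p : E × E' => (frame E G p.1).inverse) p :=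
    ContDiffAt.comp (g := ContinuousLinearMap.inverse) (f := fun p : E × E' => frame E G p.1) p
      (isInvertible_frame (G := G) hx).contDiffAt_map_inverse
      ((contDiffAt_frame (G := G) hx).comp p contDiffAt_fst)
  have h2 : ContDiffAt ℝ ∞ (fun p : E × E' => frame E' H p.2) p :=
    (contDiffAt_frame (G := H) hy).comp p contDiffAt_snd
  exact h2.clm_comp (contDiffAt_const.clm_comp h1)

end Frame

/-! ### The Lie bracket in the chart at the identity -/

section Bracket

variable {E : Type*} [NormedAddCommGroup E] [NormedSpace ℝ E]
  {G : Type*} [Group G] [TopologicalSpace G] [ChartedSpace E G] [LieGroup 𝓘(ℝ, E) ∞ G]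

/-- The bracket of the Lie algebra of `G`, on the model space. -/
noncomputable def brk (E G : Type*) [NormedAddCommGroup E] [NormedSpace ℝ E]
    [Group G] [TopologicalSpace G] [ChartedSpace E G] (v w : E) : E :=
  letI v' : GroupLieAlgebra 𝓘(ℝ, E) G := v
  letI w' : GroupLieAlgebra 𝓘(ℝ, E) G := w
  letI b : GroupLieAlgebra 𝓘(ℝ, E) G := ⁅v', w'⁆
  b

theorem mpullback_mulInvariantVectorField_chart {x : E}
    (hx : x ∈ (extChartAt 𝓘(ℝ, E) (1 : G)).target) (v : GroupLieAlgebra 𝓘(ℝ, E) G) :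
    VectorField.mpullback 𝓘(ℝ, E) 𝓘(ℝ, E) (extChartAt 𝓘(ℝ, E) (1 : G)).symm
      (mulInvariantVectorField v) x = frame E G x v := by
  have h1 : (md E E (extChartAt 𝓘(ℝ, E) (1 : G)).symm x).inverse =
      md E E (extChartAt 𝓘(ℝ, E) (1 : G)) ((extChartAt 𝓘(ℝ, E) (1 : G)).symm x) :=
    ContinuousLinearMap.inverse_eq (md_symm_comp_md_chart hx) (md_chart_comp_md_symm hx)
  have h2 : VectorField.mpullback 𝓘(ℝ, E) 𝓘(ℝ, E) (extChartAt 𝓘(ℝ, E) (1 : G)).symm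
      (mulInvariantVectorField v) x =
      (md E E (extChartAt 𝓘(ℝ, E) (1 : G)).symm x).inverse
        (leftD E ((extChartAt 𝓘(ℝ, E) (1 : G)).symm x) v) := rfl
  rw [h2, h1, frame_eq hx]
  rfl

/-- The bracket of left-invariant vector fields, written in the chart at `1`. -/
theorem fderiv_frame_sub [CompleteSpace E] {x : E}
    (hx : x ∈ (extChartAt 𝓘(ℝ, E) (1 : G)).target) (v w : E) :
    fderiv ℝ (frame E G) x (frame E G x v) w - fderiv ℝ (frame E G) x (frame E G x w) v =
      frame E G x (brk E G v w) := by
  have : LieGroup 𝓘(ℝ, E) (minSmoothness ℝ 3) G := by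
    rw [minSmoothness_of_isRCLikeNormedField]
    exact LieGroup.of_le (n := ∞) (WithTop.coe_le_coe.2 le_top)
  have hd : DifferentiableAt ℝ (frame E G) x :=
    (contDiffAt_frame hx).differentiableAt (by simp)
  have hf : ∀ v : E, HasFDerivAt (fun y => frame E G y v) ((fderiv ℝ (frame E G) x).flip v) x :=
    fun v => by simpa using hd.hasFDerivAt.clm_apply (hasFDerivAt_const v x)
  let v' : GroupLieAlgebra 𝓘(ℝ, E) G := v
  let w' : GroupLieAlgebra 𝓘(ℝ, E) G := w
  have hp : ∀ v : GroupLieAlgebra 𝓘(ℝ, E) G,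
      VectorField.mpullback 𝓘(ℝ, E) 𝓘(ℝ, E) (extChartAt 𝓘(ℝ, E) (1 : G)).symm
        (mulInvariantVectorField v) =ᶠ[𝓝 x] fun y => frame E G y v := fun v => by
    filter_upwards [(isOpen_extChartAt_target (I := 𝓘(ℝ, E)) (1 : G)).mem_nhds hx] with y hy
    exact mpullback_mulInvariantVectorField_chart hy v
  have h1 := VectorField.mpullback_mlieBracket (n := ∞) (I := 𝓘(ℝ, E)) (I' := 𝓘(ℝ, E))
    (f := (extChartAt 𝓘(ℝ, E) (1 : G)).symm) (x₀ := x)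
    (mdifferentiableAt_mulInvariantVectorField v') (mdifferentiableAt_mulInvariantVectorField w')
    (contMDiffAt_chart_symm hx)
    (by rw [minSmoothness_of_isRCLikeNormedField]; exact WithTop.coe_le_coe.2 le_top)
  rw [← mulInvariantVector_mlieBracket, mpullback_mulInvariantVectorField_chart hx,
    (hp v').mlieBracket_vectorField_eq (hp w')] at h1
  refine Eq.trans ?_ h1.symm
  have h2 : ∀ V W : (y : E) → TangentSpace 𝓘(ℝ, E) y, VectorField.mlieBracket 𝓘(ℝ, E) V W =
      VectorField.lieBracket ℝ V W := fun V W => by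
    rw [← VectorField.mlieBracketWithin_univ, VectorField.mlieBracketWithin_eq_lieBracketWithin]
    exact VectorField.lieBracketWithin_univ (𝕜 := ℝ) (V := V) (W := W)
  refine Eq.trans ?_ (congrFun (h2 _ _) x).symm
  unfold VectorField.lieBracket
  have e1 := (hf v').fderiv
  have e2 := (hf w').fderiv
  simp only [e1, e2]
  rfl

end Bracket

/-! ### Homomorphisms of Lie groups and of Lie algebras -/

section LieTwo

variable {E : Type*} [NormedAddCommGroup E] [NormedSpace ℝ E]
  {G : Type*} [Group G] [TopologicalSpace G] [ChartedSpace E G] [LieGroup 𝓘(ℝ, E) ∞ G]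
  {E' : Type*} [NormedAddCommGroup E'] [NormedSpace ℝ E']
  {H : Type*} [Group H] [TopologicalSpace H] [ChartedSpace E' H] [LieGroup 𝓘(ℝ, E') ∞ H]

/-- Compatibility of `f` with the brackets is the integrability condition for the total
differential equation given by `relField`. -/
theorem relField_integrable [CompleteSpace E] [CompleteSpace E'] {f : E →L[ℝ] E'}
    (hf : ∀ v w, f (brk E G v w) = brk E' H (f v) (f w)) {p : E × E'}
    (hx : p.1 ∈ (extChartAt 𝓘(ℝ, E) (1 : G)).target)
    (hy : p.2 ∈ (extChartAt 𝓘(ℝ, E') (1 : H)).target) (a b : E) :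
    fderiv ℝ (relField G H f) p (a, relField G H f p a) b =
      fderiv ℝ (relField G H f) p (b, relField G H f p b) a := by
  have hA : HasFDerivAt (relField G H f) (fderiv ℝ (relField G H f) p) p :=
    ((contDiffAt_relField (G := G) (H := H) hx hy).differentiableAt (by simp)).hasFDerivAt
  have hG : HasFDerivAt (frame E G) (fderiv ℝ (frame E G) p.1) p.1 :=
    ((contDiffAt_frame hx).differentiableAt (by simp)).hasFDerivAt
  have hH : HasFDerivAt (frame E' H) (fderiv ℝ (frame E' H) p.2) p.2 :=
    ((contDiffAt_frame hy).differentiableAt (by simp)).hasFDerivAt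
  -- differentiate the identity `relField p ∘ frame G p.1 = frame H p.2 ∘ f`
  have hev : (fun p : E × E' => relField G H f p ∘L frame E G p.1) =ᶠ[𝓝 p]
      fun p => frame E' H p.2 ∘L f := by
    have h1 : ∀ᶠ q : E × E' in 𝓝 p, q.1 ∈ (extChartAt 𝓘(ℝ, E) (1 : G)).target :=
      continuous_fst.continuousAt.eventually_mem ((isOpen_extChartAt_target _).mem_nhds hx)
    filter_upwards [h1] with q hq
    rw [relField, ContinuousLinearMap.comp_assoc, ContinuousLinearMap.comp_assoc,
      inverse_frame_comp hq, ContinuousLinearMap.comp_id]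
  have hG' := hG.comp p (hasFDerivAt_fst (p := p))
  have hH' := hH.comp p (hasFDerivAt_snd (p := p))
  have key := (hA.clm_comp hG').unique
    ((hH'.clm_comp (hasFDerivAt_const f p)).congr_of_eventuallyEq hev)
  have key2 : ∀ v w : E,
      fderiv ℝ (relField G H f) p (frame E G p.1 v, relField G H f p (frame E G p.1 v))
        (frame E G p.1 w) = fderiv ℝ (frame E' H) p.2 (frame E' H p.2 (f v)) (f w) -
          relField G H f p (fderiv ℝ (frame E G) p.1 (frame E G p.1 v) w) := by
    intro v w
    have h := DFunLike.congr_fun (DFunLike.congr_fun key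
      (frame E G p.1 v, relField G H f p (frame E G p.1 v))) w
    have h2 : relField G H f p (frame E G p.1 v) = frame E' H p.2 (f v) :=
      DFunLike.congr_fun hev.self_of_nhds v
    simp at h
    rw [eq_sub_iff_add_eq, add_comm, h, h2]
  obtain ⟨v, rfl⟩ : ∃ v, frame E G p.1 v = a :=
    ⟨_, DFunLike.congr_fun (frame_comp_inverse hx) a⟩
  obtain ⟨w, rfl⟩ : ∃ w, frame E G p.1 w = b :=
    ⟨_, DFunLike.congr_fun (frame_comp_inverse hx) b⟩
  rw [key2, key2, ← sub_eq_zero]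
  have e1 := fderiv_frame_sub hx v w
  have e2 := fderiv_frame_sub hy (f v) (f w)
  have e3 : relField G H f p (frame E G p.1 (brk E G v w)) = frame E' H p.2 (f (brk E G v w)) :=
    DFunLike.congr_fun hev.self_of_nhds _
  rw [← e1, hf, ← e2, map_sub] at e3
  rw [sub_sub_sub_comm, ← e3, sub_self]

/-- A homomorphism of Lie algebras integrates to a map defined near the identity that relates the
left-invariant fields. -/
theorem exists_isRelated [FiniteDimensional ℝ E] [FiniteDimensional ℝ E'] {f : E →L[ℝ] E'}
    (hf : ∀ v w, f (brk E G v w) = brk E' H (f v) (f w)) :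
    ∃ ψ : G → H, ψ 1 = 1 ∧ ∀ᶠ g in 𝓝 (1 : G), IsRelated f ψ g ∧
      ContMDiffAt 𝓘(ℝ, E) 𝓘(ℝ, E') ∞ ψ g := by
  have : CompleteSpace E := FiniteDimensional.complete ℝ E
  have : CompleteSpace E' := FiniteDimensional.complete ℝ E'
  set x₀ := extChartAt 𝓘(ℝ, E) (1 : G) 1 with hx₀
  set y₀ := extChartAt 𝓘(ℝ, E') (1 : H) 1 with hy₀
  have hxt : x₀ ∈ (extChartAt 𝓘(ℝ, E) (1 : G)).target := mem_extChartAt_target _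
  have hyt : y₀ ∈ (extChartAt 𝓘(ℝ, E') (1 : H)).target := mem_extChartAt_target _
  have hev : ∀ᶠ p : E × E' in 𝓝 (x₀, y₀), p.1 ∈ (extChartAt 𝓘(ℝ, E) (1 : G)).target ∧
      p.2 ∈ (extChartAt 𝓘(ℝ, E') (1 : H)).target :=
    (continuous_fst.continuousAt.eventually_mem ((isOpen_extChartAt_target _).mem_nhds hxt)).and
      (continuous_snd.continuousAt.eventually_mem ((isOpen_extChartAt_target _).mem_nhds hyt))
  obtain ⟨u, hu0, hu⟩ := exists_total_differential (A := relField G H f) (x₀ := x₀) (y₀ := y₀)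
    ((contDiffAt_relField (G := G) (H := H) hxt hyt).of_le (WithTop.coe_le_coe.2 le_top))
    (hev.mono fun p hp a b => relField_integrable hf hp.1 hp.2 a b)
  have hu2 : ∀ᶠ x in 𝓝 x₀, x ∈ (extChartAt 𝓘(ℝ, E) (1 : G)).target ∧
      u x ∈ (extChartAt 𝓘(ℝ, E') (1 : H)).target := by
    have hc : ContinuousAt u x₀ := hu.self_of_nhds.continuousAt
    have h1 : ∀ᶠ x in 𝓝 x₀, x ∈ (extChartAt 𝓘(ℝ, E) (1 : G)).target :=
      (isOpen_extChartAt_target _).mem_nhds hxt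
    refine h1.and (hc.eventually_mem ?_)
    rw [hu0]
    exact (isOpen_extChartAt_target _).mem_nhds hyt
  have hu3 := (hu.and hu2).eventually_nhds
  refine ⟨fun g => (extChartAt 𝓘(ℝ, E') (1 : H)).symm (u (extChartAt 𝓘(ℝ, E) (1 : G) g)), ?_, ?_⟩
  · simp only [← hx₀, hu0]
    exact extChartAt_to_inv (1 : H)
  · have hc : ContinuousAt (extChartAt 𝓘(ℝ, E) (1 : G)) 1 := continuousAt_extChartAt _
    filter_upwards [hc.eventually hu3, (isOpen_extChartAt_source (I := 𝓘(ℝ, E)) (1 : G)).mem_nhds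
      (mem_extChartAt_source _)] with g hg hgs
    have hg0 := hg.self_of_nhds
    have hgi := (extChartAt 𝓘(ℝ, E) (1 : G)).left_inv hgs
    constructor
    · have h := isRelated_of_hasFDerivAt (G := G) (H := H) hg0.2.1 hg0.2.2 hg0.1
      rwa [hgi] at h
    · have hs : ContDiffAt ℝ ∞ u (extChartAt 𝓘(ℝ, E) (1 : G) g) := by
        refine contDiffAt_of_total_differential (A := relField G H f) ?_ (hg.mono fun x hx => hx.1)
        have hev2 : ∀ᶠ p : E × E' in 𝓝 (extChartAt 𝓘(ℝ, E) (1 : G) g,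
            u (extChartAt 𝓘(ℝ, E) (1 : G) g)), p.1 ∈ (extChartAt 𝓘(ℝ, E) (1 : G)).target ∧
            p.2 ∈ (extChartAt 𝓘(ℝ, E') (1 : H)).target :=
          (continuous_fst.continuousAt.eventually_mem
            ((isOpen_extChartAt_target _).mem_nhds hg0.2.1)).and
          (continuous_snd.continuousAt.eventually_mem
            ((isOpen_extChartAt_target _).mem_nhds hg0.2.2))
        exact hev2.mono fun p hp => contDiffAt_relField hp.1 hp.2
      exact (contMDiffAt_chart_symm hg0.2.2).comp g (hs.contMDiffAt.comp g (contMDiffAt_chart hgs))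

/-- Two maps that relate the left-invariant fields in the same way agree near the identity. -/
theorem IsRelated.eventuallyEq [CompleteSpace E] {f : E →L[ℝ] E'}
    {F₁ F₂ : G → H} (h₁ : F₁ 1 = 1) (h₂ : F₂ 1 = 1) (hF₁ : ∀ᶠ g in 𝓝 (1 : G), IsRelated f F₁ g)
    (hF₂ : ∀ᶠ g in 𝓝 (1 : G), IsRelated f F₂ g) : F₁ =ᶠ[𝓝 1] F₂ := by
  set x₀ := extChartAt 𝓘(ℝ, E) (1 : G) 1 with hx₀
  set y₀ := extChartAt 𝓘(ℝ, E') (1 : H) 1 with hy₀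
  have hxt : x₀ ∈ (extChartAt 𝓘(ℝ, E) (1 : G)).target := mem_extChartAt_target _
  have hyt : y₀ ∈ (extChartAt 𝓘(ℝ, E') (1 : H)).target := mem_extChartAt_target _
  have hc : ContinuousAt (extChartAt 𝓘(ℝ, E) (1 : G)).symm x₀ := continuousAt_extChartAt_symm _
  have hx1 : (extChartAt 𝓘(ℝ, E) (1 : G)).symm x₀ = 1 := extChartAt_to_inv _
  have hxm : (extChartAt 𝓘(ℝ, E) (1 : G)).target ∈ 𝓝 x₀ :=
    (isOpen_extChartAt_target _).mem_nhds hxt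
  have key : ∀ F : G → H, F 1 = 1 → (∀ᶠ g in 𝓝 (1 : G), IsRelated f F g) →
      (∀ᶠ g in 𝓝 (1 : G), F g ∈ (extChartAt 𝓘(ℝ, E') (1 : H)).source) ∧
      ∀ᶠ x in 𝓝 x₀, HasFDerivAt
        (fun x => extChartAt 𝓘(ℝ, E') (1 : H) (F ((extChartAt 𝓘(ℝ, E) (1 : G)).symm x)))
        (relField G H f
          (x, extChartAt 𝓘(ℝ, E') (1 : H) (F ((extChartAt 𝓘(ℝ, E) (1 : G)).symm x)))) x := by
    intro F h hF
    have hFc : ContinuousAt F 1 := by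
      obtain ⟨D, hD, -⟩ := hF.self_of_nhds
      exact hD.mdifferentiableAt.continuousAt
    have hs : ∀ᶠ g in 𝓝 (1 : G), F g ∈ (extChartAt 𝓘(ℝ, E') (1 : H)).source := by
      refine hFc.eventually_mem ?_
      rw [h]
      exact (isOpen_extChartAt_source _).mem_nhds (mem_extChartAt_source _)
    refine ⟨hs, ?_⟩
    rw [← hx1] at hs hF
    filter_upwards [hxm, hc.eventually hs, hc.eventually hF] with x h1 h2 h3
    exact h3.hasFDerivAt h1 h2
  obtain ⟨hs1, hd1⟩ := key F₁ h₁ hF₁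
  obtain ⟨hs2, hd2⟩ := key F₂ h₂ hF₂
  have hu := total_differential_unique (A := relField G H f) (x₀ := x₀) (y₀ := y₀)
    ((contDiffAt_relField (G := G) (H := H) hxt hyt).of_le (WithTop.coe_le_coe.2 le_top))
    (by rw [hx1, h₁]) (by rw [hx1, h₂]) hd1 hd2
  have hc2 : ContinuousAt (extChartAt 𝓘(ℝ, E) (1 : G)) 1 := continuousAt_extChartAt _
  filter_upwards [hc2.eventually hu, hs1, hs2,
    (isOpen_extChartAt_source (I := 𝓘(ℝ, E)) (1 : G)).mem_nhds (mem_extChartAt_source _)]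
    with g hg h1 h2 h3
  rw [(extChartAt 𝓘(ℝ, E) (1 : G)).left_inv h3] at hg
  exact (extChartAt 𝓘(ℝ, E') (1 : H)).injOn h1 h2 hg

/-- A homomorphism of Lie groups is determined by its derivative at the identity. -/
theorem monoidHom_ext_of_mder [CompleteSpace E] [ConnectedSpace G] {f : E →L[ℝ] E'} {F₁ F₂ : G →* H}
    (h₁ : MDer F₁ 1 f) (h₂ : MDer F₂ 1 f) : F₁ = F₂ := by
  have := isTopologicalGroup_of_lieGroup E G
  have h := IsRelated.eventuallyEq (map_one F₁) (map_one F₂)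
    (Eventually.of_forall (isRelated_of_monoidHom h₁))
    (Eventually.of_forall (isRelated_of_monoidHom h₂))
  have h2 := subgroup_eq_top_of_eventually_mem (F₁.eqLocus F₂) h
  exact MonoidHom.eq_of_eqOn_top fun x hx => by rw [h2.symm] at hx; exact hx

/-- Lie's second theorem: a homomorphism of Lie algebras integrates to a homomorphism defined on the
simply connected Lie group. -/
theorem exists_monoidHom_mder [FiniteDimensional ℝ E] [FiniteDimensional ℝ E']
    [SimplyConnectedSpace G] {f : E →L[ℝ] E'}
    (hf : ∀ v w, f (brk E G v w) = brk E' H (f v) (f w)) :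
    ∃ Ψ : G →* H, MDer Ψ 1 f ∧ ContMDiff 𝓘(ℝ, E) 𝓘(ℝ, E') ∞ Ψ := by
  have : CompleteSpace E := FiniteDimensional.complete ℝ E
  have := isTopologicalGroup_of_lieGroup E G
  have : LocallyPathConnectedSpace G := ChartedSpace.locallyPathConnectedSpace E G
  obtain ⟨ψ, hψ1, hψ⟩ := exists_isRelated (G := G) (H := H) hf
  have hmul : ∀ᶠ x in 𝓝 (1 : G), ∀ᶠ y in 𝓝 (1 : G), ψ (x * y) = ψ x * ψ y := by
    filter_upwards [hψ.eventually_nhds] with x hx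
    -- `y ↦ (ψ x)⁻¹ * ψ (x * y)` relates the left-invariant fields in the same way as `ψ`
    have h1 : ∀ᶠ y in 𝓝 (1 : G), IsRelated f (fun y => (ψ x)⁻¹ * ψ (x * y)) y :=
      (eventually_mul_left hx).mono fun y hy => hy.1.translate (ψ x)⁻¹ x
    have h2 := IsRelated.eventuallyEq (by simp) hψ1 h1 (hψ.mono fun y hy => hy.1)
    filter_upwards [h2] with y hy
    rw [← hy, mul_inv_cancel_left]
  obtain ⟨Ψ, hΨ⟩ := exists_monoidHom_eventuallyEq hmul
  refine ⟨Ψ, ?_, fun g => ?_⟩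
  · obtain ⟨D, hD, hDf⟩ := hψ.self_of_nhds.1
    rw [hψ1, leftD_one, leftD_one, ContinuousLinearMap.comp_id, ContinuousLinearMap.id_comp] at hDf
    rw [← hDf]
    exact hD.congr hΨ
  -- smoothness at `1` propagates by left translations
  · have h1 : ContMDiffAt 𝓘(ℝ, E) 𝓘(ℝ, E') ∞ Ψ (g⁻¹ * g) := by
      rw [inv_mul_cancel]
      exact hψ.self_of_nhds.2.congr_of_eventuallyEq hΨ
    have h2 := (contMDiff_leftMul (E := E') (Ψ g)).contMDiffAt.comp g
      (h1.comp g (contMDiff_leftMul (E := E) g⁻¹).contMDiffAt)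
    refine h2.congr_of_eventuallyEq (Eventually.of_forall fun x => ?_)
    simp

/-- An isomorphism of the Lie algebras of simply connected Lie groups integrates to an isomorphism
of Lie groups. -/
theorem exists_mulEquiv_mder [FiniteDimensional ℝ E] [FiniteDimensional ℝ E']
    [SimplyConnectedSpace G] [SimplyConnectedSpace H] (f : E ≃L[ℝ] E')
    (hf : ∀ v w, f (brk E G v w) = brk E' H (f v) (f w)) :
    ∃ Ψ : G ≃* H, MDer Ψ 1 (f : E →L[ℝ] E') ∧ MDer Ψ.symm 1 (f.symm : E' →L[ℝ] E) ∧
      ContMDiff 𝓘(ℝ, E) 𝓘(ℝ, E') ∞ Ψ ∧ ContMDiff 𝓘(ℝ, E') 𝓘(ℝ, E) ∞ Ψ.symm := by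
  have : CompleteSpace E := FiniteDimensional.complete ℝ E
  have : CompleteSpace E' := FiniteDimensional.complete ℝ E'
  obtain ⟨Ψ, hΨ, hΨs⟩ := exists_monoidHom_mder (G := G) (H := H) (f := (f : E →L[ℝ] E')) hf
  obtain ⟨Φ, hΦ, hΦs⟩ := exists_monoidHom_mder (G := H) (H := G) (f := (f.symm : E' →L[ℝ] E))
    fun v w => by
      have := hf (f.symm v) (f.symm w)
      simp only [ContinuousLinearEquiv.apply_symm_apply] at this
      simp [← this]
  have h1 : Φ.comp Ψ = MonoidHom.id G := by
    refine monoidHom_ext_of_mder (f := ContinuousLinearMap.id ℝ E) ?_ (mder_id 1)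
    rw [← map_one Ψ] at hΦ
    have h := hΦ.comp hΨ
    rwa [show (f.symm : E' →L[ℝ] E) ∘L (f : E →L[ℝ] E') = ContinuousLinearMap.id ℝ E by
      ext; simp] at h
  have h2 : Ψ.comp Φ = MonoidHom.id H := by
    refine monoidHom_ext_of_mder (f := ContinuousLinearMap.id ℝ E') ?_ (mder_id 1)
    rw [← map_one Φ] at hΨ
    have h := hΨ.comp hΦ
    rwa [show (f : E →L[ℝ] E') ∘L (f.symm : E' →L[ℝ] E) = ContinuousLinearMap.id ℝ E' by
      ext; simp] at h
  exact ⟨MonoidHom.toMulEquiv Ψ Φ h1 h2, hΨ, hΦ, hΨs, hΦs⟩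

end LieTwo

/-! ### Submersions -/

section Submersion

variable {E B : Type*} [NormedAddCommGroup E] [NormedSpace ℝ E] [FiniteDimensional ℝ E]
  [NormedAddCommGroup B] [NormedSpace ℝ B] [FiniteDimensional ℝ B]

/-- The implicit function theorem: near `a`, the points are parametrized by the values of `f` and by
the kernel of its derivative.  The inverse of the parametrization is `x ↦ (f x, p x)`, where `p` is
a projection onto the kernel. -/
theorem exists_submersion_param_vectorSpace {f : E → B} {a : E} {D : E →L[ℝ] B}
    (hf : ContDiffAt ℝ ∞ f a) (hD : HasFDerivAt f D a) (hs : Function.Surjective D) :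
    ∃ (s : B × D.ker → E) (p : E → D.ker), s (f a, 0) = a ∧ ContDiffAt ℝ ∞ s (f a, 0) ∧
      (∃ D' : B × D.ker →L[ℝ] E, HasFDerivAt s D' (f a, 0) ∧ ∀ v : D.ker, D' (0, v) = v) ∧ p a = 0 ∧ Continuous p ∧
      (∀ᶠ q in 𝓝 (f a, 0), f (s q) = q.1) ∧ ∀ᶠ x in 𝓝 a, s (f x, p x) = x := by
  have : CompleteSpace E := FiniteDimensional.complete ℝ E
  have : CompleteSpace B := FiniteDimensional.complete ℝ B
  obtain ⟨P, hP⟩ := D.ker_closedComplemented_of_finiteDimensional_range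
  let φ : ImplicitFunctionData ℝ E B D.ker :=
    { leftFun := f
      leftDeriv := D
      rightFun := fun x => P (x - a)
      rightDeriv := P
      pt := a
      hasStrictFDerivAt_leftFun := hf.hasStrictFDerivAt' hD (by simp)
      hasStrictFDerivAt_rightFun :=
        P.hasStrictFDerivAt.comp a ((hasStrictFDerivAt_id a).sub_const a)
      range_leftDeriv := LinearMap.range_eq_top.2 hs
      range_rightDeriv := LinearMap.range_eq_of_proj hP
      isCompl_ker := LinearMap.isCompl_of_proj hP }
  have hpt : φ.prodFun φ.pt = (f a, 0) := by
    simp [ImplicitFunctionData.prodFun, φ]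
  have hsm : ContDiffAt ℝ ∞ φ.implicitFunction.uncurry (f a, 0) := by
    rw [← hpt]
    refine φ.contDiffAt_implicitFunction hf ?_ (by simp)
    exact (P.contDiff.comp (contDiff_id.sub contDiff_const)).contDiffAt
  have him : ∀ᶠ x in 𝓝 a, φ.implicitFunction.uncurry (f x, P (x - a)) = x :=
    φ.implicitFunction_apply_image
  refine ⟨φ.implicitFunction.uncurry, fun x => P (x - a), ?_, hsm, ?_, by simp, by fun_prop, ?_,
    him⟩
  · have := him.self_of_nhds
    simpa using this
  · have h1 := (hsm.differentiableAt (by simp)).hasFDerivAt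
    refine ⟨_, h1, fun v => ?_⟩
    have h2 : HasFDerivAt (fun x => (f x, P (x - a))) (D.prod P) a :=
      hD.prodMk (P.hasFDerivAt.comp a ((hasFDerivAt_id a).sub_const a))
    have h3 : (fun x => (f x, P (x - a))) a = (f a, 0) := by simp
    rw [← h3] at h1
    have h4 := (h1.comp a h2).unique ((hasFDerivAt_id a).congr_of_eventuallyEq him)
    have h5 := DFunLike.congr_fun h4 (v : E)
    have h6 : D (v : E) = 0 := v.2
    simpa [h6, hP v] using h5
  · have := φ.leftFun_implicitFunction
    rwa [hpt] at this

variable {M N : Type*} [TopologicalSpace M] [ChartedSpace E M] [TopologicalSpace N]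
  [ChartedSpace B N] [IsManifold 𝓘(ℝ, E) ∞ M] [IsManifold 𝓘(ℝ, B) ∞ N]

/-- Near a point, a submersion is parametrized by its values and by the kernel of its
derivative. -/
theorem exists_submersion_param {f : M → N} {x : M} {D : E →L[ℝ] B}
    (hf : ContMDiffAt 𝓘(ℝ, E) 𝓘(ℝ, B) ∞ f x) (hD : MDer f x D) (hs : Function.Surjective D) :
    ∃ (s : B × D.ker → M) (p : M → D.ker), s (extChartAt 𝓘(ℝ, B) (f x) (f x), 0) = x ∧
      ContMDiffAt 𝓘(ℝ, B × D.ker) 𝓘(ℝ, E) ∞ s (extChartAt 𝓘(ℝ, B) (f x) (f x), 0) ∧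
      (∃ D' : B × D.ker →L[ℝ] E, MDer s (extChartAt 𝓘(ℝ, B) (f x) (f x), (0 : D.ker)) D' ∧
        ∀ v : D.ker, D' (0, v) = v) ∧
      p x = 0 ∧ ContinuousAt p x ∧
      (∀ᶠ q in 𝓝 (extChartAt 𝓘(ℝ, B) (f x) (f x), (0 : D.ker)),
        f (s q) = (extChartAt 𝓘(ℝ, B) (f x)).symm q.1) ∧
      ∀ᶠ y in 𝓝 x, s (extChartAt 𝓘(ℝ, B) (f x) (f y), p y) = y := by
  set x' := extChartAt 𝓘(ℝ, E) x x with hx'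
  have hxi : (extChartAt 𝓘(ℝ, E) x).symm x' = x := extChartAt_to_inv x
  set f' : E → B := fun z => extChartAt 𝓘(ℝ, B) (f x) (f ((extChartAt 𝓘(ℝ, E) x).symm z))
    with hf'
  have hfx : f' x' = extChartAt 𝓘(ℝ, B) (f x) (f x) := by simp only [hf', hxi]
  have h1 : ContMDiffAt 𝓘(ℝ, E) 𝓘(ℝ, E) ∞ (extChartAt 𝓘(ℝ, E) x).symm x' :=
    contMDiffAt_chart_symm (mem_extChartAt_target x)
  have hc' : ContDiffAt ℝ ∞ f' x' := by
    rw [← contMDiffAt_iff_contDiffAt]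
    have h3 : ContMDiffAt 𝓘(ℝ, B) 𝓘(ℝ, B) ∞ (extChartAt 𝓘(ℝ, B) (f x)) (f x) :=
      contMDiffAt_chart (mem_extChartAt_source (f x))
    have hf2 := hf
    rw [← hxi] at h3 hf2
    have h2 := hf2.comp x' h1
    rw [hxi] at h3
    refine ContMDiffAt.comp x' (g := extChartAt 𝓘(ℝ, B) (f x)) ?_ h2
    simp only [hxi]
    exact h3
  have hd' : HasFDerivAt f' D x' := by
    have h2 := mder_chart_symm_self E x
    have hD2 := hD
    rw [← hxi] at hD2
    have h3 := hD2.comp h2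
    have h4 := mder_chart_self B (f x)
    have h5 : (f ∘ (extChartAt 𝓘(ℝ, E) x).symm) x' = f x := congrArg f hxi
    rw [← h5] at h4
    have h6 := h4.comp h3
    rw [h5] at h6
    exact mder_iff.1 h6
  obtain ⟨s, p, hs0, hsm, ⟨D', hD', hDv⟩, hp0, hpc, hfs, hsf⟩ :=
    exists_submersion_param_vectorSpace hc' hd' hs
  rw [hfx] at hs0 hsm hD' hfs
  have hsc : ContinuousAt s (extChartAt 𝓘(ℝ, B) (f x) (f x), 0) := hsm.continuousAt
  refine ⟨fun q => (extChartAt 𝓘(ℝ, E) x).symm (s q), fun y => p (extChartAt 𝓘(ℝ, E) x y),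
    ?_, ?_, ⟨D', ?_, hDv⟩, hp0, ?_, ?_, ?_⟩
  · simp only [hs0, hxi]
  · rw [← hs0] at h1
    exact h1.comp _ hsm.contMDiffAt
  · have h2 := mder_chart_symm_self E x
    rw [← hx', ← hs0] at h2
    exact h2.comp (mder_iff.2 hD')
  · exact hpc.continuousAt.comp (continuousAt_extChartAt x)
  · have hcf : ContinuousAt (fun q => f ((extChartAt 𝓘(ℝ, E) x).symm (s q)))
        (extChartAt 𝓘(ℝ, B) (f x) (f x), 0) := by
      have h2 := h1.continuousAt
      have h3 := hf.continuousAt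
      rw [← hxi] at h3
      have h4 := h3.comp h2
      rw [← hs0] at h4
      exact h4.comp hsc
    have hmem : ∀ᶠ q in 𝓝 (extChartAt 𝓘(ℝ, B) (f x) (f x), (0 : D.ker)),
        f ((extChartAt 𝓘(ℝ, E) x).symm (s q)) ∈ (extChartAt 𝓘(ℝ, B) (f x)).source := by
      refine hcf.eventually_mem ?_
      rw [hs0, hxi]
      exact (isOpen_extChartAt_source _).mem_nhds (mem_extChartAt_source _)
    filter_upwards [hfs, hmem] with q hq hq2
    rw [← hq, hf', (extChartAt 𝓘(ℝ, B) (f x)).left_inv hq2]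
  · have hcc : ContinuousAt (extChartAt 𝓘(ℝ, E) x) x := continuousAt_extChartAt x
    filter_upwards [hcc.eventually hsf,
      (isOpen_extChartAt_source (I := 𝓘(ℝ, E)) x).mem_nhds (mem_extChartAt_source x)] with y hy hy2
    have h2 := (extChartAt 𝓘(ℝ, E) x).left_inv hy2
    simp only [hf', h2] at hy
    rw [hy, h2]

/-- A submersion has smooth local sections. -/
theorem exists_local_section {f : M → N} {x : M} {D : E →L[ℝ] B}
    (hf : ContMDiffAt 𝓘(ℝ, E) 𝓘(ℝ, B) ∞ f x) (hD : MDer f x D) (hs : Function.Surjective D) :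
    ∃ σ : N → M, σ (f x) = x ∧ ContMDiffAt 𝓘(ℝ, B) 𝓘(ℝ, E) ∞ σ (f x) ∧
      ∀ᶠ y in 𝓝 (f x), f (σ y) = y := by
  obtain ⟨s, p, hs0, hsm, -, -, -, hfs, -⟩ := exists_submersion_param hf hD hs
  have h1 : ContMDiffAt 𝓘(ℝ, B) 𝓘(ℝ, B × D.ker) ∞
      (fun y => (extChartAt 𝓘(ℝ, B) (f x) y, (0 : D.ker))) (f x) :=
    ((contDiff_id.prodMk contDiff_const).contMDiff.contMDiffAt).comp (f x)
      (contMDiffAt_chart (mem_extChartAt_source (f x)))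
  refine ⟨fun y => s (extChartAt 𝓘(ℝ, B) (f x) y, 0), hs0, ?_, ?_⟩
  · exact ContMDiffAt.comp (f x) (g := s) hsm h1
  · have h2 := h1.continuousAt.eventually hfs
    filter_upwards [h2, (isOpen_extChartAt_source (I := 𝓘(ℝ, B)) (f x)).mem_nhds
      (mem_extChartAt_source (f x))] with y hy hy2
    rw [hy, (extChartAt 𝓘(ℝ, B) (f x)).left_inv hy2]

/-- Smoothness descends along submersions. -/
theorem contMDiffAt_of_comp_submersion {E' O : Type*} [NormedAddCommGroup E'] [NormedSpace ℝ E']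
    [TopologicalSpace O] [ChartedSpace E' O] {f : M → N} {x : M} {D : E →L[ℝ] B}
    (hf : ContMDiffAt 𝓘(ℝ, E) 𝓘(ℝ, B) ∞ f x) (hD : MDer f x D) (hs : Function.Surjective D)
    {φ : N → O} (hφ : ContMDiffAt 𝓘(ℝ, E) 𝓘(ℝ, E') ∞ (fun y => φ (f y)) x) :
    ContMDiffAt 𝓘(ℝ, B) 𝓘(ℝ, E') ∞ φ (f x) := by
  obtain ⟨σ, hσ, hσm, hfσ⟩ := exists_local_section hf hD hs
  rw [← hσ] at hφ
  refine (hφ.comp (f x) hσm).congr_of_eventuallyEq ?_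
  filter_upwards [hfσ] with y hy
  simp [hy]

end Submersion

/-! ### Homogeneous spaces -/

section LocallyConstant

variable {V E : Type*} [NormedAddCommGroup V] [NormedSpace ℝ V]
  [NormedAddCommGroup E] [NormedSpace ℝ E] {N : Type*} [TopologicalSpace N] [ChartedSpace E N]
  [IsManifold 𝓘(ℝ, E) ∞ N]

/-- A map with vanishing derivative near a point is constant near that point. -/
theorem eventually_eq_of_mder_zero {f : V → N} {x : V}
    (hf : ∀ᶠ v in 𝓝 x, MDer f v (0 : V →L[ℝ] E)) : ∀ᶠ v in 𝓝 x, f v = f x := by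
  have hc : ContinuousAt f x := hf.self_of_nhds.mdifferentiableAt.continuousAt
  have hs : ∀ᶠ v in 𝓝 x, f v ∈ (extChartAt 𝓘(ℝ, E) (f x)).source :=
    hc.eventually_mem ((isOpen_extChartAt_source _).mem_nhds (mem_extChartAt_source _))
  obtain ⟨ε, hε, hb⟩ := Metric.eventually_nhds_iff_ball.1 (hf.and hs)
  have hd : ∀ v ∈ ball x ε, HasFDerivWithinAt (fun v => extChartAt 𝓘(ℝ, E) (f x) (f v))
      (0 : V →L[ℝ] E) (ball x ε) v := fun v hv => by
    have h1 := (mder_chart (hb v hv).2).comp (hb v hv).1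
    rw [ContinuousLinearMap.comp_zero] at h1
    exact (mder_iff.1 h1).hasFDerivWithinAt
  filter_upwards [ball_mem_nhds x hε] with v hv
  have h2 := (convex_ball x ε).norm_image_sub_le_of_norm_hasFDerivWithin_le (C := 0) hd
    (fun v _ => by simp) (mem_ball_self hε) hv
  rw [zero_mul, norm_le_zero_iff, sub_eq_zero] at h2
  exact (extChartAt 𝓘(ℝ, E) (f x)).injOn (hb v hv).2 (mem_extChartAt_source _) h2

end LocallyConstant

namespace HomogeneousSpace

variable {𝔨 𝔭 : Type*} [NormedAddCommGroup 𝔨] [NormedSpace ℝ 𝔨]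
  [NormedAddCommGroup 𝔭] [NormedSpace ℝ 𝔭] {μ : Br 𝔨 𝔭} (R : HomogeneousSpace.{u} μ)

/-- The identification of `𝔤` with the Lie algebra, on the model space. -/
noncomputable def iso : (𝔨 × 𝔭) ≃L[ℝ] (𝔨 × 𝔭) := R.lieIso

/-- The derivative of the projection at `g`, between the model spaces. -/
noncomputable def dproj (g : R.G) : (𝔨 × 𝔭) →L[ℝ] 𝔭 := md (𝔨 × 𝔭) 𝔭 R.proj g

/-- The derivative at `x` of the action of `g`, between the model spaces. -/
noncomputable def smulD (g : R.G) (x : R.space) : 𝔭 →L[ℝ] 𝔭 := md 𝔭 𝔭 (fun y : R.space => g • y) x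

/-- The identification of `𝔭` with the tangent space at the origin, on the model space. -/
noncomputable def tiso : 𝔭 →L[ℝ] 𝔭 := R.dproj 1 ∘L (R.iso : (𝔨 × 𝔭) →L[ℝ] (𝔨 × 𝔭)) ∘L
  ContinuousLinearMap.inr ℝ 𝔨 𝔭

theorem iso_bracket (X Y : 𝔨 × 𝔭) : R.iso (μ X Y) = brk (𝔨 × 𝔭) R.G (R.iso X) (R.iso Y) :=
  R.lieIso_bracket X Y

theorem dproj_iso_eq_zero (X : 𝔨 × 𝔭) : R.dproj 1 (R.iso X) = 0 ↔ X.2 = 0 := R.lie_K X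

theorem mder_proj (g : R.G) : MDer R.proj g (R.dproj g) :=
  mder_of_contMDiffAt R.contMDiff_mk.contMDiffAt (by simp)

theorem dproj_surjective (g : R.G) : Function.Surjective (R.dproj g) := R.surjective_mfderiv_mk g

theorem proj_eq_iff (a b : R.G) : R.proj a = R.proj b ↔ a⁻¹ * b ∈ R.K := QuotientGroup.eq

theorem smul_proj (g x : R.G) : g • R.proj x = R.proj (g * x) := rfl

theorem smul_origin_eq {k : R.G} (hk : k ∈ R.K) : k • R.origin = R.origin := by
  rw [origin, smul_proj, proj_eq_iff]
  simpa using hk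

theorem exists_proj_eq (x : R.space) : ∃ g, R.proj g = x := QuotientGroup.mk_surjective x

theorem dproj_iso (X : 𝔨 × 𝔭) : R.dproj 1 (R.iso X) = R.tiso X.2 := by
  have h : R.dproj 1 (R.iso (X.1, 0)) = 0 := (R.dproj_iso_eq_zero _).2 rfl
  have h2 : X = (X.1, 0) + (0, X.2) := by simp
  conv_lhs => rw [h2]
  rw [map_add, map_add, h, zero_add]
  rfl

theorem tiso_injective : Function.Injective R.tiso := by
  refine (injective_iff_map_eq_zero R.tiso).2 fun X hX => ?_
  exact (R.dproj_iso_eq_zero (0, X)).1 hX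

variable [FiniteDimensional ℝ 𝔭]

/-- `tiso` as an invertible map. -/
noncomputable def tisoE : 𝔭 ≃L[ℝ] 𝔭 :=
  (LinearEquiv.ofInjectiveEndo R.tiso.toLinearMap R.tiso_injective).toContinuousLinearEquiv

theorem tisoE_apply (X : 𝔭) : R.tisoE X = R.tiso X := rfl

variable [FiniteDimensional ℝ 𝔨]

theorem contMDiff_of_comp_proj {E' O : Type*} [NormedAddCommGroup E'] [NormedSpace ℝ E']
    [TopologicalSpace O] [ChartedSpace E' O] {φ : R.space → O}
    (hφ : ContMDiff 𝓘(ℝ, 𝔨 × 𝔭) 𝓘(ℝ, E') ∞ (fun g => φ (R.proj g))) :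
    ContMDiff 𝓘(ℝ, 𝔭) 𝓘(ℝ, E') ∞ φ := by
  intro x
  obtain ⟨g, rfl⟩ := R.exists_proj_eq x
  exact contMDiffAt_of_comp_submersion R.contMDiff_mk.contMDiffAt (R.mder_proj g)
    (R.dproj_surjective g) hφ.contMDiffAt

theorem contMDiff_smul (g : R.G) : ContMDiff 𝓘(ℝ, 𝔭) 𝓘(ℝ, 𝔭) ∞ (fun x : R.space => g • x) :=
  R.contMDiff_of_comp_proj (R.contMDiff_mk.comp (contMDiff_leftMul g))

theorem mder_smul (g : R.G) (x : R.space) : MDer (fun y : R.space => g • y) x (R.smulD g x) :=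
  mder_of_contMDiffAt (R.contMDiff_smul g).contMDiffAt (by simp)

theorem smulD_comp_dproj (g x : R.G) :
    R.smulD g (R.proj x) ∘L R.dproj x =
      R.dproj (g * x) ∘L md (𝔨 × 𝔭) (𝔨 × 𝔭) (fun y : R.G => g * y) x :=
  ((R.mder_smul g (R.proj x)).comp (R.mder_proj x)).unique
    ((R.mder_proj (g * x)).comp (f := fun y => g * y) (mder_leftMul g x))

theorem dproj_comp_leftD (g : R.G) :
    R.dproj g ∘L leftD (𝔨 × 𝔭) g = R.smulD g R.origin ∘L R.dproj 1 := by
  rw [smulD_comp_dproj, mul_one]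
  rfl

theorem smulD_inv_comp (g : R.G) (x : R.space) :
    R.smulD g⁻¹ (g • x) ∘L R.smulD g x = ContinuousLinearMap.id ℝ 𝔭 := by
  refine ((R.mder_smul g⁻¹ (g • x)).comp (f := fun y => g • y) (R.mder_smul g x)).unique ?_
  exact (mder_id x).congr (Eventually.of_forall fun y => by simp)

theorem smulD_injective (g : R.G) (x : R.space) : Function.Injective (R.smulD g x) := by
  intro v w h
  have h1 := DFunLike.congr_fun (R.smulD_inv_comp g x)
  have h2 := h1 v
  have h3 := h1 w
  simp only [ContinuousLinearMap.comp_apply, ContinuousLinearMap.id_apply] at h2 h3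
  rw [← h2, h, h3]

/-- `smulD` as an invertible map. -/
noncomputable def smulE (g : R.G) (x : R.space) : 𝔭 ≃L[ℝ] 𝔭 :=
  (LinearEquiv.ofInjectiveEndo (R.smulD g x).toLinearMap
    (R.smulD_injective g x)).toContinuousLinearEquiv

theorem coe_smulE (g : R.G) (x : R.space) : (R.smulE g x : 𝔭 →L[ℝ] 𝔭) = R.smulD g x := rfl

theorem dproj_leftD_eq_zero (g : R.G) (X : 𝔨 × 𝔭) :
    R.dproj g (leftD (𝔨 × 𝔭) g (R.iso X)) = 0 ↔ X.2 = 0 := by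
  have h := DFunLike.congr_fun (R.dproj_comp_leftD g) (R.iso X)
  simp only [ContinuousLinearMap.comp_apply] at h
  rw [h, map_eq_zero_iff _ (R.smulD_injective g _), dproj_iso_eq_zero]

/-- The kernel of the derivative of the projection at `g` is the left translate of `𝔨`. -/
theorem exists_leftD_iso_eq (g : R.G) {v : 𝔨 × 𝔭} (hv : R.dproj g v = 0) :
    ∃ X : 𝔨 × 𝔭, X.2 = 0 ∧ v = leftD (𝔨 × 𝔭) g (R.iso X) := by
  have h1 : leftD (𝔨 × 𝔭) g (md (𝔨 × 𝔭) (𝔨 × 𝔭) (fun x : R.G => g⁻¹ * x) g v) = v :=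
    DFunLike.congr_fun (leftD_comp_inv g) v
  obtain ⟨X, hX⟩ := R.iso.surjective (md (𝔨 × 𝔭) (𝔨 × 𝔭) (fun x : R.G => g⁻¹ * x) g v)
  rw [← hX] at h1
  refine ⟨X, ?_, h1.symm⟩
  rwa [← R.dproj_leftD_eq_zero g, h1]

/-- Local parametrization of the subgroup `K` by its Lie algebra. -/
theorem exists_param_K : ∃ (κ : (R.dproj 1).ker → R.G) (p : R.G → (R.dproj 1).ker), κ 0 = 1 ∧
    MDer κ 0 (R.dproj 1).ker.subtypeL ∧
    (∀ᶠ v in 𝓝 0, MDer κ v (md (R.dproj 1).ker (𝔨 × 𝔭) κ v)) ∧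
    (∀ᶠ v in 𝓝 0, κ v ∈ R.K) ∧ p 1 = 0 ∧ ContinuousAt p 1 ∧
    ∀ᶠ g in 𝓝 1, g ∈ R.K → κ (p g) = g := by
  obtain ⟨s, p, hs0, hsm, ⟨D', hD', hDv⟩, hp0, hpc, hfs, hsf⟩ :=
    exists_submersion_param (f := R.proj) (x := (1 : R.G)) R.contMDiff_mk.contMDiffAt (R.mder_proj 1)
      (R.dproj_surjective 1)
  set c := extChartAt 𝓘(ℝ, 𝔭) R.origin R.origin with hc
  have hl : ContDiff ℝ ∞ (fun v : (R.dproj 1).ker => (c, v)) := contDiff_const.prodMk contDiff_id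
  have hl2 : HasFDerivAt (fun v : (R.dproj 1).ker => (c, v))
    (ContinuousLinearMap.inr ℝ 𝔭 (R.dproj 1).ker) 0 := hasFDerivAt_prodMk_right c 0
  have hmem : ∀ g : R.G, g ∈ R.K ↔ R.proj g = R.origin := fun g => by
    rw [eq_comm, proj_eq_iff, inv_one, one_mul]
  refine ⟨fun v => s (c, v), p, hs0, ?_, ?_, ?_, hp0, hpc, ?_⟩
  · have h := hD'.comp (f := fun v : (R.dproj 1).ker => (c, v)) (mder_iff.2 hl2)
    have h2 : D' ∘L ContinuousLinearMap.inr ℝ 𝔭 (R.dproj 1).ker = (R.dproj 1).ker.subtypeL := by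
      ext1 v
      exact hDv v
    rwa [h2] at h
  · have h1 : ∀ᶠ q in 𝓝 (c, (0 : (R.dproj 1).ker)),
        ContMDiffAt 𝓘(ℝ, 𝔭 × (R.dproj 1).ker) 𝓘(ℝ, 𝔨 × 𝔭) 1 s q := by
      have := isManifold_one (E := 𝔨 × 𝔭) (M := R.G)
      exact (contMDiffAt_iff_contMDiffAt_nhds (by simp)).1 (hsm.of_le (by simp))
    filter_upwards [hl.continuous.continuousAt.eventually h1] with v hv
    have h2 : ContMDiffAt 𝓘(ℝ, (R.dproj 1).ker) 𝓘(ℝ, 𝔨 × 𝔭) 1 (fun v => s (c, v)) v :=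
      ContMDiffAt.comp v (g := s) hv (hl.contMDiff.of_le (by simp)).contMDiffAt
    exact mder_of_contMDiffAt h2 (by simp)
  · filter_upwards [hl.continuous.continuousAt.eventually hfs] with v hv
    rw [hmem]
    exact Eq.trans hv (extChartAt_to_inv R.origin)
  · filter_upwards [hsf] with g hg hk
    rw [hmem] at hk
    refine Eq.trans ?_ hg
    change s (c, p g) = s (extChartAt 𝓘(ℝ, 𝔭) R.origin (R.proj g), p g)
    rw [hk]

end HomogeneousSpace

/-! ### Equivariant diffeomorphisms of homogeneous spaces -/

namespace HomogeneousSpace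

variable {𝔨 𝔭 : Type*} [NormedAddCommGroup 𝔨] [NormedSpace ℝ 𝔨] [FiniteDimensional ℝ 𝔨]
  [NormedAddCommGroup 𝔭] [NormedSpace ℝ 𝔭] [FiniteDimensional ℝ 𝔭] {μ₁ μ₂ : Br 𝔨 𝔭}
  (P : HomogeneousSpace.{u} μ₁) (R : HomogeneousSpace.{u} μ₂)

/-- A homomorphism whose derivative maps `𝔨` to `𝔨` maps `K` to `K`. -/
theorem mapsTo_K {Ψ : P.G →* R.G} {f : (𝔨 × 𝔭) →L[ℝ] (𝔨 × 𝔭)} (hΨ : MDer Ψ 1 f)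
    (hf : ∀ X : 𝔨 × 𝔭, X.2 = 0 → R.dproj 1 (f (P.iso X)) = 0) : ∀ g ∈ P.K, Ψ g ∈ R.K := by
  obtain ⟨κ, p, hκ0, -, hκd, hκK, hp1, hpc, hκp⟩ := P.exists_param_K
  -- tangent vectors of `K` are left translates of `𝔨`, so the composition of the parametrization
  -- `κ` of `K` with `Ψ` and with the projection has zero derivative and is locally constant
  have hzero : ∀ᶠ v in 𝓝 (0 : (P.dproj 1).ker),
      MDer (fun v => R.proj (Ψ (κ v))) v (0 : (P.dproj 1).ker →L[ℝ] 𝔭) := by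
    filter_upwards [hκd, hκK.eventually_nhds] with v hv hvK
    obtain ⟨D, hD, hDf⟩ := isRelated_of_monoidHom hΨ (κ v)
    have h1 := (R.mder_proj (Ψ (κ v))).comp (f := fun v => Ψ (κ v)) (hD.comp hv)
    have h2 : P.dproj (κ v) ∘L md (P.dproj 1).ker (𝔨 × 𝔭) κ v = 0 := by
      refine ((P.mder_proj (κ v)).comp hv).unique ((mder_const v P.origin).congr ?_)
      filter_upwards [hvK] with w hw
      rw [Function.comp_apply, eq_comm, origin, proj_eq_iff]
      simpa using hw
    have h3 : R.dproj (Ψ (κ v)) ∘L D ∘L md (P.dproj 1).ker (𝔨 × 𝔭) κ v = 0 := by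
      ext1 w
      obtain ⟨X, hX, hXv⟩ := P.exists_leftD_iso_eq (κ v) (DFunLike.congr_fun h2 w)
      have h4 := DFunLike.congr_fun hDf (P.iso X)
      simp only [ContinuousLinearMap.comp_apply] at h4 ⊢
      have h6 : md (P.dproj 1).ker (𝔨 × 𝔭) κ v w = leftD (𝔨 × 𝔭) (κ v) (P.iso X) := hXv
      rw [h6, h4]
      obtain ⟨Y, hY⟩ := R.iso.surjective (f (P.iso X))
      have h5 := hf X hX
      rw [← hY, dproj_iso_eq_zero] at h5
      rw [← hY]
      exact (R.dproj_leftD_eq_zero _ Y).2 h5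
    rw [h3] at h1
    exact h1
  have hconst := eventually_eq_of_mder_zero hzero
  have hloc : ∀ᶠ g in 𝓝 (1 : P.G), g ∈ P.K → Ψ g ∈ R.K := by
    rw [← hp1] at hconst
    filter_upwards [hpc.eventually hconst, hκp] with g hg hg2 hgK
    rw [hg2 hgK, hp1, hκ0, map_one, eq_comm, proj_eq_iff] at hg
    simpa using hg
  -- so the elements of `K` that `Ψ` maps to `K` form an open subgroup of the connected group `K`
  have := isTopologicalGroup_of_lieGroup (𝔨 × 𝔭) P.G
  have : ConnectedSpace P.K := isConnected_iff_connectedSpace.1 P.isConnected_K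
  have htop := subgroup_eq_top_of_eventually_mem ((R.K.comap Ψ).subgroupOf P.K) (by
    have hc : Tendsto (fun k : P.K => (k : P.G)) (𝓝 1) (𝓝 1) :=
      continuous_subtype_val.tendsto' _ _ rfl
    filter_upwards [hc.eventually hloc] with k hk
    exact hk k.2)
  intro g hg
  have h : (⟨g, hg⟩ : P.K) ∈ (R.K.comap Ψ).subgroupOf P.K := by rw [htop]; trivial
  exact h

/-- If `h̃` maps the bracket `μ₁` to the bracket `μ₂`, then it integrates to an isomorphism of the
groups, which induces an equivariant diffeomorphism of the homogeneous spaces. -/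
theorem exists_isEquivariantDiffeo (h : 𝔭 ≃L[ℝ] 𝔭) (hμ : μ₂ = Br.act (tilde 𝔨 h) μ₁) :
    ∃ φ : P.space ≃ₘ^∞⟮𝓘(ℝ, 𝔭), 𝓘(ℝ, 𝔭)⟯ R.space, IsEquivariantDiffeo P R h φ := by
  set f : (𝔨 × 𝔭) ≃L[ℝ] (𝔨 × 𝔭) := (P.iso.symm.trans (tilde 𝔨 h)).trans R.iso with hf
  have hfi : ∀ X, f (P.iso X) = R.iso (tilde 𝔨 h X) := fun X => by simp [hf]
  have hfs : ∀ X, f.symm (R.iso X) = P.iso ((tilde 𝔨 h).symm X) := fun X => by simp [hf]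
  have hb : ∀ X Y, tilde 𝔨 h (μ₁ X Y) = μ₂ (tilde 𝔨 h X) (tilde 𝔨 h Y) := fun X Y => by
    rw [hμ, Br.act_apply, ContinuousLinearEquiv.symm_apply_apply,
      ContinuousLinearEquiv.symm_apply_apply]
  have hfb : ∀ v w, f (brk (𝔨 × 𝔭) P.G v w) = brk (𝔨 × 𝔭) R.G (f v) (f w) := by
    intro v w
    obtain ⟨X, rfl⟩ := P.iso.surjective v
    obtain ⟨Y, rfl⟩ := P.iso.surjective w
    rw [← iso_bracket, hfi, hfi, hfi, ← iso_bracket, hb]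
  obtain ⟨Ψ, hΨ, hΨi, hΨs, hΨis⟩ := exists_mulEquiv_mder (G := P.G) (H := R.G) f hfb
  have hK1 : ∀ g ∈ P.K, Ψ g ∈ R.K := P.mapsTo_K R (Ψ := Ψ.toMonoidHom) hΨ fun X hX => by
    have h1 : (tilde 𝔨 h X).2 = h X.2 := rfl
    rw [ContinuousLinearEquiv.coe_coe, hfi, dproj_iso_eq_zero, h1, hX, map_zero]
  have hK2 : ∀ g ∈ R.K, Ψ.symm g ∈ P.K :=
    R.mapsTo_K P (Ψ := Ψ.symm.toMonoidHom) hΨi fun X hX => by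
      have h1 : ((tilde 𝔨 h).symm X).2 = h.symm X.2 := rfl
      rw [ContinuousLinearEquiv.coe_coe, hfs, dproj_iso_eq_zero, h1, hX, map_zero]
  have hwd1 : ∀ g : P.G, R.proj (Ψ (Quotient.out (P.proj g))) = R.proj (Ψ g) := fun g => by
    rw [proj_eq_iff, ← map_inv, ← map_mul]
    refine hK1 _ ((P.proj_eq_iff _ _).1 ?_)
    exact QuotientGroup.out_eq' (P.proj g)
  have hwd2 : ∀ g : R.G, P.proj (Ψ.symm (Quotient.out (R.proj g))) = P.proj (Ψ.symm g) := fun g => by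
    rw [proj_eq_iff, ← map_inv, ← map_mul]
    refine hK2 _ ((R.proj_eq_iff _ _).1 ?_)
    exact QuotientGroup.out_eq' (R.proj g)
  let φ : P.space ≃ₘ^∞⟮𝓘(ℝ, 𝔭), 𝓘(ℝ, 𝔭)⟯ R.space :=
    { toFun := fun x => R.proj (Ψ (Quotient.out x))
      invFun := fun x => P.proj (Ψ.symm (Quotient.out x))
      left_inv := fun x => by
        obtain ⟨g, rfl⟩ := P.exists_proj_eq x
        simp only [hwd1, hwd2, MulEquiv.symm_apply_apply]
      right_inv := fun x => by
        obtain ⟨g, rfl⟩ := R.exists_proj_eq x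
        simp only [hwd2, hwd1, MulEquiv.apply_symm_apply]
      contMDiff_toFun := P.contMDiff_of_comp_proj (by
        refine (R.contMDiff_mk.comp hΨs).congr fun g => ?_
        exact hwd1 g)
      contMDiff_invFun := R.contMDiff_of_comp_proj (by
        refine (P.contMDiff_mk.comp hΨis).congr fun g => ?_
        exact hwd2 g) }
  have hφ : ∀ g, φ (P.proj g) = R.proj (Ψ g) := hwd1
  have hφo : φ P.origin = R.origin := by
    rw [origin, hφ, map_one]
  have hdφ : md 𝔭 𝔭 φ P.origin ∘L P.dproj 1 = R.dproj 1 ∘L (f : (𝔨 × 𝔭) →L[ℝ] (𝔨 × 𝔭)) := by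
    have h1 : MDer φ P.origin (md 𝔭 𝔭 φ P.origin) :=
      mder_of_contMDiffAt φ.contMDiff_toFun.contMDiffAt (by simp)
    have h2 := h1.comp (f := P.proj) (P.mder_proj 1)
    have h3 := R.mder_proj 1
    rw [← map_one Ψ] at h3
    have h4 := h3.comp (f := Ψ) hΨ
    rw [map_one] at h4
    exact h2.unique (h4.congr (Eventually.of_forall hφ))
  have hdφ2 : ∀ X : 𝔭, md 𝔭 𝔭 φ P.origin (P.tiso X) = R.tiso (h X) := fun X => by
    have h1 := DFunLike.congr_fun hdφ (P.iso (0, X))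
    simp only [ContinuousLinearMap.comp_apply, ContinuousLinearEquiv.coe_coe] at h1
    rw [hfi, dproj_iso, dproj_iso] at h1
    exact h1
  have htot : ∀ (x y : R.space) (v w : 𝔭), x = y → v = w →
      (⟨x, v⟩ : TangentBundle 𝓘(ℝ, 𝔭) R.space) = ⟨y, w⟩ := by
    rintro x _ v _ rfl rfl
    rfl
  have htot' : ∀ (x y : R.G) (v w : 𝔨 × 𝔭), x = y → v = w →
      (⟨x, v⟩ : TangentBundle 𝓘(ℝ, 𝔨 × 𝔭) R.G) = ⟨y, w⟩ := by
    rintro x _ v _ rfl rfl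
    rfl
  refine ⟨φ, ⟨Ψ, hΨs, hΨis, fun X => ?_, ?_, hφ, fun g x => ?_⟩, fun X => ?_⟩
  · refine htot' _ _ _ _ (map_one Ψ) ?_
    have h1 : md (𝔨 × 𝔭) (𝔨 × 𝔭) Ψ 1 (P.iso X) = R.iso (tilde 𝔨 h X) := by
      rw [hΨ.md_eq]
      exact hfi X
    exact h1
  · ext g
    constructor
    · rintro ⟨k, hk, rfl⟩
      exact hK1 k hk
    · intro hg
      exact ⟨Ψ.symm g, hK2 g hg, Ψ.apply_symm_apply g⟩
  · obtain ⟨a, rfl⟩ := P.exists_proj_eq x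
    rw [smul_proj, hφ, hφ, smul_proj, map_mul]
  · exact htot _ _ _ _ hφo (hdφ2 X)

end HomogeneousSpace

section Unpack

variable {𝔨 𝔭 : Type*} [NormedAddCommGroup 𝔨] [NormedSpace ℝ 𝔨]
  [NormedAddCommGroup 𝔭] [NormedSpace ℝ 𝔭] {μ₁ μ₂ : Br 𝔨 𝔭}
  {P : HomogeneousSpace.{u} μ₁} {R : HomogeneousSpace.{u} μ₂} {h : 𝔭 ≃L[ℝ] 𝔭}
  {φ : P.space ≃ₘ^∞⟮𝓘(ℝ, 𝔭), 𝓘(ℝ, 𝔭)⟯ R.space}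

theorem IsEquivariantDiffeo.map_origin (hφ : IsEquivariantDiffeo P R h φ) :
    φ P.origin = R.origin := by
  obtain ⟨⟨ψ, -, -, -, -, h1, -⟩, -⟩ := hφ
  rw [HomogeneousSpace.origin, h1, map_one]

theorem IsEquivariantDiffeo.md_comp_tiso (hφ : IsEquivariantDiffeo P R h φ) :
    md 𝔭 𝔭 φ P.origin ∘L P.tiso = R.tiso ∘L (h : 𝔭 →L[ℝ] 𝔭) := by
  ext1 X
  have htot : ∀ (x y : R.space) (v w : 𝔭),
      (⟨x, v⟩ : TangentBundle 𝓘(ℝ, 𝔭) R.space) = ⟨y, w⟩ → v = w := by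
    intro x y v w h
    cases h
    rfl
  exact htot _ _ _ _ (hφ.2 X)

end Unpack

/-! ### The action of `GL` and `gl` on tensors -/

section TensorAlgebra

variable {ι : Type} {r s : ι → ℕ} {W W' W'' : Type*} [NormedAddCommGroup W] [NormedSpace ℝ W]
  [NormedAddCommGroup W'] [NormedSpace ℝ W'] [NormedAddCommGroup W''] [NormedSpace ℝ W'']

theorem Tensors.ext {γ δ : Tensors r s W} (h : ∀ i w α, γ i w α = δ i w α) : γ = δ := by
  funext i
  ext w α
  exact h i w α

theorem pull_equiv_apply (e : W ≃L[ℝ] W') (γ : Tensors r s W') (i : ι) (w : Fin (r i) → W)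
    (α : Fin (s i) → Module.Dual ℝ W) :
    pull (e : W →L[ℝ] W') γ i w α =
      γ i (fun k => e (w k)) (fun k => (α k).comp (e.symm : W' →L[ℝ] W).toLinearMap) := by
  rw [pull_apply, ContinuousLinearMap.inverse_equiv]
  rfl

theorem pull_comp_equiv (L : W' →L[ℝ] W'') (e : W ≃L[ℝ] W') (γ : Tensors r s W'') :
    pull (L ∘L (e : W →L[ℝ] W')) γ = pull (e : W →L[ℝ] W') (pull L γ) := by
  refine Tensors.ext fun i w α => ?_
  rw [pull_apply, pull_apply, pull_apply,
    ContinuousLinearMap.IsInvertible.inverse_comp_of_right ⟨e, rfl⟩]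
  rfl

theorem pull_equiv_comp (e : W' ≃L[ℝ] W'') (L : W →L[ℝ] W') (γ : Tensors r s W'') :
    pull ((e : W' →L[ℝ] W'') ∘L L) γ = pull L (pull (e : W' →L[ℝ] W'') γ) := by
  refine Tensors.ext fun i w α => ?_
  rw [pull_apply, pull_apply, pull_apply,
    ContinuousLinearMap.IsInvertible.inverse_comp_of_left ⟨e, rfl⟩]
  rfl

theorem pull_id (γ : Tensors r s W) : pull (ContinuousLinearMap.id ℝ W) γ = γ := by
  refine Tensors.ext fun i w α => ?_
  rw [pull_apply, ContinuousLinearMap.inverse_id]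
  rfl

theorem pull_refl (γ : Tensors r s W) :
    pull (ContinuousLinearEquiv.refl ℝ W : W →L[ℝ] W) γ = γ := pull_id γ

theorem pull_symm_pull (e : W ≃L[ℝ] W') (γ : Tensors r s W') :
    pull (e.symm : W' →L[ℝ] W) (pull (e : W →L[ℝ] W') γ) = γ := by
  rw [← pull_comp_equiv, ContinuousLinearEquiv.coe_comp_coe_symm, pull_id]

theorem pull_pull_symm (e : W ≃L[ℝ] W') (γ : Tensors r s W) :
    pull (e : W →L[ℝ] W') (pull (e.symm : W' →L[ℝ] W) γ) = γ := pull_symm_pull e.symm γ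

/-- `A ↦ θ(A)γ` as a linear map. -/
def thetaHom (γ : Tensors r s W) : (W →L[ℝ] W) →ₗ[ℝ] Tensors r s W where
  toFun A := theta A.toLinearMap γ
  map_add' A B := by
    refine Tensors.ext fun i w α => ?_
    have h1 : ∀ k, γ i (Function.update w k ((A + B) (w k))) α =
        γ i (Function.update w k (A (w k))) α + γ i (Function.update w k (B (w k))) α := by
      intro k
      rw [add_apply, MultilinearMap.map_update_add]
      rfl
    have h2 : ∀ k, γ i w (Function.update α k ((α k).comp (A + B).toLinearMap)) =
        γ i w (Function.update α k ((α k).comp A.toLinearMap)) +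
          γ i w (Function.update α k ((α k).comp B.toLinearMap)) := by
      intro k
      rw [ContinuousLinearMap.toLinearMap_add, LinearMap.comp_add, MultilinearMap.map_update_add]
    simp only [theta_apply, Pi.add_apply, add_apply, ContinuousLinearMap.coe_coe] at h1 h2 ⊢
    simp only [h1, h2, Finset.sum_add_distrib]
    ring
  map_smul' c A := by
    refine Tensors.ext fun i w α => ?_
    have h1 : ∀ k, γ i (Function.update w k ((c • A) (w k))) α =
        c * γ i (Function.update w k (A (w k))) α := by
      intro k
      rw [smul_apply, MultilinearMap.map_update_smul]
      rfl
    have h2 : ∀ k, γ i w (Function.update α k ((α k).comp (c • A).toLinearMap)) =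
        c * γ i w (Function.update α k ((α k).comp A.toLinearMap)) := by
      intro k
      rw [ContinuousLinearMap.toLinearMap_smul, LinearMap.comp_smul,
        MultilinearMap.map_update_smul]
      rfl
    simp only [theta_apply, Pi.smul_apply, smul_apply, smul_eq_mul, RingHom.id_apply,
      ContinuousLinearMap.coe_coe] at h1 h2 ⊢
    simp only [h1, h2, ← Finset.mul_sum]
    ring

theorem thetaHom_apply (γ : Tensors r s W) (A : W →L[ℝ] W) :
    thetaHom γ A = theta A.toLinearMap γ := rfl

/-- Equivariance of the representation of `gl` on tensors. -/
theorem pull_thetaHom (e : W ≃L[ℝ] W') (A : W' →L[ℝ] W') (γ : Tensors r s W') :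
    pull (e : W →L[ℝ] W') (thetaHom γ A) =
      thetaHom (pull (e : W →L[ℝ] W') γ)
        ((e.symm : W' →L[ℝ] W) ∘L A ∘L (e : W →L[ℝ] W')) := by
  refine Tensors.ext fun i w α => ?_
  rw [pull_equiv_apply, thetaHom_apply, thetaHom_apply, theta_apply, theta_apply]
  congr 1
  · refine congrArg Neg.neg (Finset.sum_congr rfl fun k _ => ?_)
    rw [pull_equiv_apply]
    congr 2
    funext j
    by_cases hj : j = k
    · subst hj
      simp
    · simp [Function.update_of_ne hj]
  · refine Finset.sum_congr rfl fun k _ => ?_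
    rw [pull_equiv_apply]
    congr 1
    funext j
    by_cases hj : j = k
    · subst hj
      refine LinearMap.ext fun x => ?_
      simp
    · simp [Function.update_of_ne hj]

theorem pull_zero (L : W →L[ℝ] W') : pull L (0 : Tensors r s W') = 0 := by
  refine Tensors.ext fun i w α => ?_
  rw [pull_apply]
  rfl

end TensorAlgebra

/-! ### Derivatives of curves of tensors -/

section TensorDerivative

/-- The product rule for the pairing of curves in `V` and in its dual, where curves are
differentiated weakly. -/
theorem hasDerivAt_dual_apply {V : Type*} [AddCommGroup V] [Module ℝ V] [FiniteDimensional ℝ V]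
    {ℓ : ℝ → Module.Dual ℝ V} {ℓ' : Module.Dual ℝ V} {v : ℝ → V} {v' : V} {t : ℝ}
    (hℓ : ∀ x, HasDerivAt (fun τ => ℓ τ x) (ℓ' x) t)
    (hv : ∀ β : Module.Dual ℝ V, HasDerivAt (fun τ => β (v τ)) (β v') t) :
    HasDerivAt (fun τ => ℓ τ (v τ)) (ℓ' (v t) + ℓ t v') t := by
  let b := Module.finBasis ℝ V
  have hexp : ∀ (β : Module.Dual ℝ V) (x : V), β x = ∑ j, b.coord j x * β (b j) := by
    intro β x
    conv_lhs => rw [← b.sum_repr x, map_sum]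
    refine Finset.sum_congr rfl fun j _ => ?_
    rw [map_smul, smul_eq_mul, Module.Basis.coord_apply]
  have h1 : (fun τ => ℓ τ (v τ)) = fun τ => ∑ j, b.coord j (v τ) * ℓ τ (b j) := by
    funext τ
    exact hexp _ _
  rw [h1]
  refine (HasDerivAt.fun_sum fun j _ => (hv (b.coord j)).mul (hℓ (b j))).congr_deriv ?_
  rw [hexp ℓ' (v t), hexp (ℓ t) v', Finset.sum_add_distrib, add_comm]

/-- The product rule for a curve of multilinear maps evaluated on curves. -/
theorem hasDerivAt_multilinear_apply {V : Type*} [AddCommGroup V] [Module ℝ V]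
    [FiniteDimensional ℝ V] {n : ℕ} {f : ℝ → MultilinearMap ℝ (fun _ : Fin n => V) ℝ}
    {f' : MultilinearMap ℝ (fun _ : Fin n => V) ℝ} {v : ℝ → Fin n → V} {v' : Fin n → V} {t : ℝ}
    (hf : ∀ x, HasDerivAt (fun τ => f τ x) (f' x) t)
    (hv : ∀ (k : Fin n) (β : Module.Dual ℝ V), HasDerivAt (fun τ => β (v τ k)) (β (v' k)) t) :
    HasDerivAt (fun τ => f τ (v τ)) (f' (v t) + ∑ k, f t (Function.update (v t) k (v' k))) t := by
  induction n with
  | zero =>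
    have h1 : ∀ τ, v τ = v t := fun τ => Subsingleton.elim _ _
    simp only [h1, Finset.univ_eq_empty, Finset.sum_empty, add_zero]
    exact hf (v t)
  | succ n ih =>
    let ev : (Fin n → V) → MultilinearMap ℝ (fun _ : Fin n => V) ℝ →ₗ[ℝ] ℝ := fun m =>
      { toFun := fun g => g m
        map_add' := fun _ _ => rfl
        map_smul' := fun _ _ => rfl }
    have hcons : ∀ τ, v τ = Fin.cons (v τ 0) (Fin.tail (v τ)) := fun τ =>
      (Fin.cons_self_tail (v τ)).symm
    have h1 : ∀ m, HasDerivAt (fun τ => (f τ).curryLeft (v τ 0) m)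
        ((f'.curryLeft (v t 0) + (f t).curryLeft (v' 0)) m) t := fun m => by
      have h2 := hasDerivAt_dual_apply (ℓ := fun τ => ev m ∘ₗ (f τ).curryLeft)
        (ℓ' := ev m ∘ₗ f'.curryLeft) (v := fun τ => v τ 0) (v' := v' 0) (t := t)
        (fun x => hf (Fin.cons x m)) (hv 0)
      exact h2
    have h3 := ih (f := fun τ => (f τ).curryLeft (v τ 0)) (v := fun τ => Fin.tail (v τ))
      (v' := Fin.tail v') h1 (fun k => hv k.succ)
    have h4 : (fun τ => (f τ).curryLeft (v τ 0) (Fin.tail (v τ))) = fun τ => f τ (v τ) := by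
      funext τ
      rw [MultilinearMap.curryLeft_apply, ← hcons]
    rw [h4] at h3
    refine h3.congr_deriv ?_
    rw [Fin.sum_univ_succ, add_apply, MultilinearMap.curryLeft_apply,
      MultilinearMap.curryLeft_apply, ← hcons, add_assoc]
    congr 2
    · congr 1
      conv_rhs => rw [hcons t]
      rw [Fin.update_cons_zero]
    · refine Finset.sum_congr rfl fun k _ => ?_
      rw [MultilinearMap.curryLeft_apply]
      congr 1
      conv_rhs => rw [hcons t]
      rw [← Fin.cons_update]
      rfl

variable {ι : Type} {r s : ι → ℕ} {W : Type*} [NormedAddCommGroup W] [NormedSpace ℝ W]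
  [FiniteDimensional ℝ W]

/-- The derivative of the curve `h(t)^* γ(t)`. -/
theorem hasDerivAt_pull {h : ℝ → W ≃L[ℝ] W} {h' : W →L[ℝ] W} {γ : ℝ → Tensors r s W}
    {γ' : Tensors r s W} {t : ℝ} (hh : HasDerivAt (fun τ => (h τ : W →L[ℝ] W)) h' t)
    (hγ : ∀ i w α, HasDerivAt (fun τ => γ τ i w α) (γ' i w α) t)
    (i : ι) (w : Fin (r i) → W) (α : Fin (s i) → Module.Dual ℝ W) :
    HasDerivAt (fun τ => pull (h τ : W →L[ℝ] W) (γ τ) i w α)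
      (pull (h t : W →L[ℝ] W)
        (γ' - thetaHom (γ t) (h' ∘L ((h t).symm : W →L[ℝ] W))) i w α) t := by
  have : CompleteSpace W := FiniteDimensional.complete ℝ W
  have hsymm := hasDerivAt_symm hh
  have hx : ∀ (x : W) (β : Module.Dual ℝ W), HasDerivAt (fun τ => β (h τ x)) (β (h' x)) t := by
    intro x β
    have h1 := hh.clm_apply (hasDerivAt_const t x)
    have h2 : HasDerivAt (fun τ => β (h τ x)) _ t :=
      (LinearMap.toContinuousLinearMap β).hasFDerivAt.comp_hasDerivAt t h1
    exact h2.congr_deriv (by simp)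
  have ha : ∀ (a : Module.Dual ℝ W) (β : Module.Dual ℝ (Module.Dual ℝ W)),
      HasDerivAt (fun τ => β (a.comp ((h τ).symm : W →L[ℝ] W).toLinearMap))
        (β (a.comp (-(((h t).symm : W →L[ℝ] W) ∘L h' ∘L
          ((h t).symm : W →L[ℝ] W))).toLinearMap)) t := by
    intro a β
    obtain ⟨x, rfl⟩ := (Module.evalEquiv ℝ W).surjective β
    have h1 := hsymm.clm_apply (hasDerivAt_const t x)
    have h2 : HasDerivAt (fun τ => a ((h τ).symm x)) _ t :=
      (LinearMap.toContinuousLinearMap a).hasFDerivAt.comp_hasDerivAt t h1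
    exact h2.congr_deriv (by simp)
  let A := h' ∘L ((h t).symm : W →L[ℝ] W)
  -- first the covariant arguments, then the contravariant ones
  let ev : (Fin (s i) → Module.Dual ℝ W) →
      MultilinearMap ℝ (fun _ : Fin (s i) => Module.Dual ℝ W) ℝ →ₗ[ℝ] ℝ := fun m =>
    { toFun := fun g => g m
      map_add' := fun _ _ => rfl
      map_smul' := fun _ _ => rfl }
  have h1 : ∀ α, HasDerivAt (fun τ => γ τ i (fun k => h τ (w k)) α)
      ((γ' i (fun k => h t (w k)) + ∑ k, γ t i (Function.update (fun k => h t (w k)) k (h' (w k)))) α)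
      t := fun α => by
    have h2 := hasDerivAt_multilinear_apply (f := fun τ => (ev α).compMultilinearMap (γ τ i))
      (f' := (ev α).compMultilinearMap (γ' i)) (v := fun τ k => h τ (w k))
      (v' := fun k => h' (w k)) (t := t) (fun x => hγ i x α) (fun k β => hx (w k) β)
    refine h2.congr_deriv ?_
    rw [add_apply, sum_apply]
    rfl
  have h3 := hasDerivAt_multilinear_apply (f := fun τ => γ τ i (fun k => h τ (w k)))
    (v := fun τ k => (α k).comp ((h τ).symm : W →L[ℝ] W).toLinearMap)
    (v' := fun k => (α k).comp (-(((h t).symm : W →L[ℝ] W) ∘L h' ∘L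
          ((h t).symm : W →L[ℝ] W))).toLinearMap) (t := t) h1 (fun k β => ha (α k) β)
  have h5 : (fun τ => pull (h τ : W →L[ℝ] W) (γ τ) i w α) = fun τ => γ τ i (fun k => h τ (w k))
      (fun k => (α k).comp ((h τ).symm : W →L[ℝ] W).toLinearMap) := by
    funext τ
    rw [pull_equiv_apply]
  rw [h5]
  refine h3.congr_deriv ?_
  rw [pull_equiv_apply, Pi.sub_apply, sub_apply, sub_apply, thetaHom_apply, theta_apply,
    add_apply, sum_apply, add_assoc, sub_eq_add_neg, neg_add, neg_neg]
  congr 2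
  · refine Finset.sum_congr rfl fun k _ => ?_
    congr 3
    simp
  · rw [← Finset.sum_neg_distrib]
    refine Finset.sum_congr rfl fun k _ => ?_
    rw [← MultilinearMap.map_update_neg]
    congr 2
    ext x
    simp

end TensorDerivative

/-! ### The adjoint representation and the isotropy representation -/

section Adjoint

variable {E : Type*} [NormedAddCommGroup E] [NormedSpace ℝ E]
  {G : Type*} [Group G] [TopologicalSpace G] [ChartedSpace E G] [LieGroup 𝓘(ℝ, E) ∞ G]

/-- The right-invariant fields in the chart at `1`. -/
noncomputable def rframe (E : Type*) [NormedAddCommGroup E] [NormedSpace ℝ E] (G : Type*)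
    [Group G] [TopologicalSpace G] [ChartedSpace E G] (x : E) : E →L[ℝ] E :=
  fderiv ℝ (fun y => mulChart E G (y, x)) (extChartAt 𝓘(ℝ, E) (1 : G) 1)

/-- The adjoint representation in the chart at `1`. -/
noncomputable def adChart (E : Type*) [NormedAddCommGroup E] [NormedSpace ℝ E] (G : Type*)
    [Group G] [TopologicalSpace G] [ChartedSpace E G] (x : E) : E →L[ℝ] E :=
  (rframe E G x).inverse ∘L frame E G x

theorem mder_rightMul (g x : G) :
    MDer (fun x : G => x * g) x (md E E (fun x : G => x * g) x) :=
  mder_of_contMDiffAt (n := ∞) contMDiff_mul_right.contMDiffAt (by simp)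

theorem rframe_eq {x : E} (hx : x ∈ (extChartAt 𝓘(ℝ, E) (1 : G)).target) :
    rframe E G x = md E E (extChartAt 𝓘(ℝ, E) (1 : G)) ((extChartAt 𝓘(ℝ, E) (1 : G)).symm x) ∘L
      md E E (fun y : G => y * (extChartAt 𝓘(ℝ, E) (1 : G)).symm x) 1 := by
  set g := (extChartAt 𝓘(ℝ, E) (1 : G)).symm x with hg
  have hgs : g ∈ (extChartAt 𝓘(ℝ, E) (1 : G)).source := (extChartAt 𝓘(ℝ, E) (1 : G)).map_target hx
  have h1 := mder_rightMul (E := E) g 1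
  have h0 := mder_chart hgs
  rw [← one_mul g] at h0
  have h2 := h0.comp (f := fun x => x * g) h1
  have h3 : (extChartAt 𝓘(ℝ, E) (1 : G)).symm (extChartAt 𝓘(ℝ, E) (1 : G) 1) = 1 :=
    extChartAt_to_inv (1 : G)
  rw [← h3] at h2
  have h4 := h2.comp (mder_chart_symm_self E (1 : G))
  rw [ContinuousLinearMap.comp_id, h3, one_mul] at h4
  exact (mder_iff.1 h4).fderiv

theorem symm_comp_rframe {x : E} (hx : x ∈ (extChartAt 𝓘(ℝ, E) (1 : G)).target) :
    md E E (extChartAt 𝓘(ℝ, E) (1 : G)).symm x ∘L rframe E G x =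
      md E E (fun y : G => y * (extChartAt 𝓘(ℝ, E) (1 : G)).symm x) 1 := by
  rw [rframe_eq hx, ← ContinuousLinearMap.comp_assoc, md_symm_comp_md_chart hx,
    ContinuousLinearMap.id_comp]

theorem frame_one : frame E G (extChartAt 𝓘(ℝ, E) (1 : G) 1) = ContinuousLinearMap.id ℝ E := by
  rw [frame_eq (mem_extChartAt_target (1 : G)), extChartAt_to_inv, leftD_one,
    (mder_chart_self E (1 : G)).md_eq, ContinuousLinearMap.comp_id]

theorem rframe_one : rframe E G (extChartAt 𝓘(ℝ, E) (1 : G) 1) = ContinuousLinearMap.id ℝ E := by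
  rw [rframe_eq (mem_extChartAt_target (1 : G)), extChartAt_to_inv,
    (mder_chart_self E (1 : G)).md_eq, ContinuousLinearMap.id_comp]
  refine MDer.md_eq ((mder_id (1 : G)).congr (Eventually.of_forall fun x => by simp))

/-- The second derivatives of the product are symmetric, so the difference of the derivatives of the
left-invariant and the right-invariant frames at the identity is the bracket. -/
theorem hasFDerivAt_rframe : HasFDerivAt (rframe E G) (fderiv ℝ (frame E G)
    (extChartAt 𝓘(ℝ, E) (1 : G) 1)).flip (extChartAt 𝓘(ℝ, E) (1 : G) 1) := by
  set x₀ := extChartAt 𝓘(ℝ, E) (1 : G) 1 with hx₀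
  have hm : ContDiffAt ℝ ∞ (mulChart E G) (x₀, x₀) := by
    refine contDiffAt_mulChart (mem_extChartAt_target _) (mem_extChartAt_target _) ?_
    rw [extChartAt_to_inv, mul_one]
    exact mem_extChartAt_source _
  have hm2 : ContDiffAt ℝ 2 (mulChart E G) (x₀, x₀) := hm.of_le (WithTop.coe_le_coe.2 le_top)
  have hsym : IsSymmSndFDerivAt ℝ (mulChart E G) (x₀, x₀) :=
    hm2.isSymmSndFDerivAt (by rw [minSmoothness_of_isRCLikeNormedField])
  have hd2 : HasFDerivAt (fderiv ℝ (mulChart E G)) (fderiv ℝ (fderiv ℝ (mulChart E G)) (x₀, x₀))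
      (x₀, x₀) :=
    ((hm2.fderiv_right (m := 1) (by norm_num)).differentiableAt (by simp)).hasFDerivAt
  have hev : ∀ᶠ p in 𝓝 (x₀, x₀), HasFDerivAt (mulChart E G) (fderiv ℝ (mulChart E G) p) p :=
    (hm2.eventually (by simp)).mono fun p hp => (hp.differentiableAt (by simp)).hasFDerivAt
  have hl : ContinuousAt (fun x : E => (x, x₀)) x₀ := by fun_prop
  have hr : ContinuousAt (fun x : E => (x₀, x)) x₀ := by fun_prop
  have hf : frame E G =ᶠ[𝓝 x₀] fun x => fderiv ℝ (mulChart E G) (x, x₀) ∘L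
      ContinuousLinearMap.inr ℝ E E := by
    filter_upwards [hl.eventually hev] with x hx
    exact (hx.comp x₀ (hasFDerivAt_prodMk_right x x₀)).fderiv
  have hrf : rframe E G =ᶠ[𝓝 x₀] fun x => fderiv ℝ (mulChart E G) (x₀, x) ∘L
      ContinuousLinearMap.inl ℝ E E := by
    filter_upwards [hr.eventually hev] with x hx
    exact (hx.comp (f := fun y => (y, x)) x₀ (hasFDerivAt_prodMk_left x₀ x)).fderiv
  have h1 := ((hd2.comp (f := fun y => (y, x₀)) x₀ (hasFDerivAt_prodMk_left x₀ x₀)).clm_comp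
    (hasFDerivAt_const (ContinuousLinearMap.inr ℝ E E) x₀)).congr_of_eventuallyEq hf
  have h2 := ((hd2.comp (f := fun y => (x₀, y)) x₀ (hasFDerivAt_prodMk_right x₀ x₀)).clm_comp
    (hasFDerivAt_const (ContinuousLinearMap.inl ℝ E E) x₀)).congr_of_eventuallyEq hrf
  refine h2.congr_fderiv ?_
  rw [h1.fderiv]
  ext v w
  simpa using hsym (0, v) (w, 0)

theorem eventually_isInvertible_rframe [CompleteSpace E] :
    ∀ᶠ x in 𝓝 (extChartAt 𝓘(ℝ, E) (1 : G) 1), (rframe E G x).IsInvertible := by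
  have h1 : ContinuousAt (rframe E G) (extChartAt 𝓘(ℝ, E) (1 : G) 1) :=
    hasFDerivAt_rframe.continuousAt
  have h2 := ContinuousLinearEquiv.nhds (ContinuousLinearEquiv.refl ℝ E)
  refine h1.eventually (p := fun f : E →L[ℝ] E => f.IsInvertible) ?_
  rw [rframe_one]
  exact h2

/-- The derivative of the adjoint representation is the bracket. -/
theorem hasFDerivAt_adChart [CompleteSpace E] : ∃ D : E →L[ℝ] E →L[ℝ] E,
    HasFDerivAt (adChart E G) D (extChartAt 𝓘(ℝ, E) (1 : G) 1) ∧ ∀ v w, D v w = brk E G v w := by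
  set x₀ := extChartAt 𝓘(ℝ, E) (1 : G) 1 with hx₀
  have hxt : x₀ ∈ (extChartAt 𝓘(ℝ, E) (1 : G)).target := mem_extChartAt_target _
  have hF : HasFDerivAt (frame E G) (fderiv ℝ (frame E G) x₀) x₀ :=
    ((contDiffAt_frame hxt).differentiableAt (by simp)).hasFDerivAt
  have hR := hasFDerivAt_rframe (E := E) (G := G)
  rw [← hx₀] at hR
  have hI : DifferentiableAt ℝ (fun x => (rframe E G x).inverse) x₀ := by
    have h1 : DifferentiableAt ℝ (ContinuousLinearMap.inverse : (E →L[ℝ] E) → E →L[ℝ] E)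
        (rframe E G x₀) := by
      rw [hx₀, rframe_one]
      exact (contDiffAt_map_inverse (n := 1) (ContinuousLinearEquiv.refl ℝ E)).differentiableAt
        (by simp)
    exact h1.comp x₀ hR.differentiableAt
  have hA : HasFDerivAt (adChart E G) (fderiv ℝ (adChart E G) x₀) x₀ :=
    (hI.hasFDerivAt.clm_comp hF).differentiableAt.hasFDerivAt
  have hev : (fun x => rframe E G x ∘L adChart E G x) =ᶠ[𝓝 x₀] frame E G := by
    filter_upwards [eventually_isInvertible_rframe (E := E) (G := G)] with x hx
    obtain ⟨e, he⟩ := hx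
    rw [adChart, ← he, ContinuousLinearMap.inverse_equiv]
    ext v
    simp
  have h1 := (hR.clm_comp hA).unique (hF.congr_of_eventuallyEq hev)
  have hA0 : adChart E G x₀ = ContinuousLinearMap.id ℝ E := by
    rw [adChart, hx₀, rframe_one, frame_one, ContinuousLinearMap.inverse_id,
      ContinuousLinearMap.id_comp]
  refine ⟨_, hA, fun v w => ?_⟩
  have h2 := DFunLike.congr_fun (DFunLike.congr_fun h1 v) w
  have h3 := fderiv_frame_sub hxt v w
  have hR0 : rframe E G x₀ = ContinuousLinearMap.id ℝ E := rframe_one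
  have hF0 : frame E G x₀ = ContinuousLinearMap.id ℝ E := frame_one
  rw [hF0] at h3
  simp [hA0, hR0] at h2 h3
  rw [← h3, ← h2]
  simp

end Adjoint

section Isotropy

variable {𝔨 𝔭 : Type*} [NormedAddCommGroup 𝔨] [NormedSpace ℝ 𝔨] [FiniteDimensional ℝ 𝔨]
  [NormedAddCommGroup 𝔭] [NormedSpace ℝ 𝔭] [FiniteDimensional ℝ 𝔭] {μ : Br 𝔨 𝔭}

/-- The value of a tensor field, on the model space. -/
def TensorField.val {ι : Type} {r s : ι → ℕ} {𝔭 : Type*} [NormedAddCommGroup 𝔭] [NormedSpace ℝ 𝔭]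
    {M : Type*} [TopologicalSpace M] [ChartedSpace 𝔭 M] (δ : TensorField r s 𝔭 M) (x : M) :
    Tensors r s 𝔭 := δ x

namespace HomogeneousSpace

variable (P : HomogeneousSpace.{u} μ)

/-- Modulo `𝔨`, the derivative at the origin of the action of `k ∈ K` is `Ad(k)`. -/
theorem smulD_comp_dproj_eq {x : 𝔨 × 𝔭}
    (hx : x ∈ (extChartAt 𝓘(ℝ, 𝔨 × 𝔭) (1 : P.G)).target)
    (hk : (extChartAt 𝓘(ℝ, 𝔨 × 𝔭) (1 : P.G)).symm x ∈ P.K)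
    (hinv : (rframe (𝔨 × 𝔭) P.G x).IsInvertible) :
    P.smulD ((extChartAt 𝓘(ℝ, 𝔨 × 𝔭) (1 : P.G)).symm x) P.origin ∘L P.dproj 1 =
      P.dproj 1 ∘L adChart (𝔨 × 𝔭) P.G x := by
  set k := (extChartAt 𝓘(ℝ, 𝔨 × 𝔭) (1 : P.G)).symm x with hkx
  have h1 : P.dproj k ∘L md (𝔨 × 𝔭) (𝔨 × 𝔭) (fun y : P.G => y * k) 1 = P.dproj 1 := by
    have h2 := P.mder_proj k
    rw [← one_mul k] at h2
    have h3 := h2.comp (f := fun y => y * k) (mder_rightMul (E := 𝔨 × 𝔭) k 1)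
    rw [one_mul] at h3
    refine h3.unique ((P.mder_proj 1).congr (Eventually.of_forall fun y => ?_))
    rw [Function.comp_apply, proj_eq_iff]
    simpa using hk
  rw [← P.dproj_comp_leftD, ← symm_comp_frame hx]
  rw [← symm_comp_rframe hx] at h1
  obtain ⟨e, he⟩ := hinv
  rw [← h1, adChart, ← he, ContinuousLinearMap.inverse_equiv]
  ext v
  all_goals simp

theorem smulD_one (x : P.space) : P.smulD 1 x = ContinuousLinearMap.id ℝ 𝔭 :=
  MDer.md_eq ((mder_id x).congr (Eventually.of_forall fun y => by simp))

variable {ι : Type} {r s : ι → ℕ}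

theorem pull_smulD_val {δ : TensorField r s 𝔭 P.space} (hδ : P.IsInvariant δ) (g : P.G)
    (x : P.space) : pull (P.smulD g x) (δ.val (g • x)) = δ.val x := congrFun (hδ g) x

theorem atOrigin_eq (δ : TensorField r s 𝔭 P.space) :
    P.atOrigin δ = pull (P.tisoE : 𝔭 →L[ℝ] 𝔭) (δ.val P.origin) := rfl

/-- The values at the origin of invariant tensor fields are invariant under `ad 𝔨`. -/
theorem thetaHom_adp_eq_zero {δ : TensorField r s 𝔭 P.space} (hδ : P.IsInvariant δ) (Z : 𝔨) :
    thetaHom (P.atOrigin δ) (μ.adp Z) = 0 := by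
  have : CompleteSpace (𝔨 × 𝔭) := FiniteDimensional.complete ℝ _
  obtain ⟨κ, p, hκ0, hκ', hκd, hκK, -⟩ := P.exists_param_K
  let z : (P.dproj 1).ker := ⟨P.iso (Z, 0), (P.dproj_iso_eq_zero _).2 rfl⟩
  set x₀ := extChartAt 𝓘(ℝ, 𝔨 × 𝔭) (1 : P.G) 1 with hx₀
  obtain ⟨D, hD, hDb⟩ := hasFDerivAt_adChart (E := 𝔨 × 𝔭) (G := P.G)
  -- the curve `k τ` in `K` with tangent `Z`
  let k : ℝ → P.G := fun τ => κ (τ • z)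
  have hk0 : k 0 = 1 := by simp [k, hκ0]
  have hline : HasDerivAt (fun τ : ℝ => τ • z) z 0 := by
    simpa using (hasDerivAt_id (0 : ℝ)).smul_const z
  have htend : Tendsto (fun τ : ℝ => τ • z) (𝓝 0) (𝓝 0) := by
    have := hline.continuousAt.tendsto
    simpa using this
  have hx' : HasDerivAt (fun τ => extChartAt 𝓘(ℝ, 𝔨 × 𝔭) (1 : P.G) (k τ)) (P.iso (Z, 0)) 0 := by
    have h0 := mder_chart_self (𝔨 × 𝔭) (1 : P.G)
    have h1 : ∀ y : P.G, y = 1 →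
        MDer (extChartAt 𝓘(ℝ, 𝔨 × 𝔭) (1 : P.G)) y (ContinuousLinearMap.id ℝ (𝔨 × 𝔭)) := by
      rintro _ rfl
      exact h0
    have h2 := mder_iff.1 ((h1 _ hκ0).comp hκ')
    rw [← zero_smul ℝ z] at h2
    have h3 := h2.comp_hasDerivAt (0 : ℝ) hline
    exact h3
  have hxc := hx'.continuousAt
  have hx0 : extChartAt 𝓘(ℝ, 𝔨 × 𝔭) (1 : P.G) (k 0) = x₀ := by rw [hk0]
  have hAd : HasDerivAt (fun τ => adChart (𝔨 × 𝔭) P.G (extChartAt 𝓘(ℝ, 𝔨 × 𝔭) (1 : P.G) (k τ)))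
      (D (P.iso (Z, 0))) 0 := by
    have h1 := hD
    rw [← hx₀, ← hx0] at h1
    exact h1.comp_hasDerivAt (0 : ℝ) hx'
  -- the action of `k τ` on `𝔭`; its derivative at `0` is `ad Z`, and it fixes the value of `δ` at the
  -- origin
  let h : ℝ → 𝔭 ≃L[ℝ] 𝔭 := fun τ => (P.tisoE.trans (P.smulE (k τ) P.origin)).trans P.tisoE.symm
  have hkc : ContinuousAt k 0 := by
    have h1 : ContinuousAt κ 0 := hκ'.mdifferentiableAt.continuousAt
    rw [← zero_smul ℝ z] at h1
    exact ContinuousAt.comp (f := fun τ : ℝ => τ • z) h1 hline.continuousAt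
  have hks : ∀ᶠ τ in 𝓝 0, k τ ∈ (extChartAt 𝓘(ℝ, 𝔨 × 𝔭) (1 : P.G)).source := by
    refine hkc.eventually_mem ?_
    rw [hk0]
    exact (isOpen_extChartAt_source _).mem_nhds (mem_extChartAt_source _)
  have hxi := eventually_isInvertible_rframe (E := 𝔨 × 𝔭) (G := P.G)
  rw [← hx₀, ← hx0] at hxi
  have hkK : ∀ᶠ τ in 𝓝 0, k τ ∈ P.K := htend.eventually hκK
  have hh : (fun τ => (h τ : 𝔭 →L[ℝ] 𝔭)) =ᶠ[𝓝 0] fun τ => (P.tisoE.symm : 𝔭 →L[ℝ] 𝔭) ∘L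
      P.dproj 1 ∘L (adChart (𝔨 × 𝔭) P.G (extChartAt 𝓘(ℝ, 𝔨 × 𝔭) (1 : P.G) (k τ)) ∘L
        ((P.iso : (𝔨 × 𝔭) →L[ℝ] (𝔨 × 𝔭)) ∘L ContinuousLinearMap.inr ℝ 𝔨 𝔭)) := by
    filter_upwards [hks, hxc.eventually hxi, hkK] with τ h1 h2 h3
    have h4 := (extChartAt 𝓘(ℝ, 𝔨 × 𝔭) (1 : P.G)).left_inv h1
    have h5 := P.smulD_comp_dproj_eq ((extChartAt 𝓘(ℝ, 𝔨 × 𝔭) (1 : P.G)).map_source h1)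
      (by rwa [h4]) h2
    rw [h4] at h5
    rw [← ContinuousLinearMap.comp_assoc (P.dproj 1), ← h5]
    rfl
  have hd : HasDerivAt (fun τ => (h τ : 𝔭 →L[ℝ] 𝔭)) (μ.adp Z) 0 := by
    have h1 := hAd.clm_comp (hasDerivAt_const (0 : ℝ)
      ((P.iso : (𝔨 × 𝔭) →L[ℝ] (𝔨 × 𝔭)) ∘L ContinuousLinearMap.inr ℝ 𝔨 𝔭))
    have h2 := (hasDerivAt_const (0 : ℝ) ((P.tisoE.symm : 𝔭 →L[ℝ] 𝔭) ∘L P.dproj 1)).clm_comp h1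
    refine (h2.congr_of_eventuallyEq hh).congr_deriv ?_
    ext X
    have h3 : D (P.iso (Z, 0)) (P.iso (0, X)) = P.iso (μ (Z, 0) (0, X)) := by
      rw [hDb, iso_bracket]
    have h4 : P.tisoE.symm (P.dproj 1 (P.iso (μ (Z, 0) (0, X)))) = (μ (Z, 0) (0, X)).2 := by
      rw [dproj_iso, ← tisoE_apply, ContinuousLinearEquiv.symm_apply_apply]
    simp [h3, h4, Br.adp]
  have hh0 : h 0 = ContinuousLinearEquiv.refl ℝ 𝔭 := by
    ext X
    have h1 : P.smulE 1 P.origin (P.tisoE X) = P.tisoE X :=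
      DFunLike.congr_fun (P.smulD_one P.origin) (P.tisoE X)
    simp [h, hk0, h1]
  have hconst : ∀ᶠ τ in 𝓝 0, pull (h τ : 𝔭 →L[ℝ] 𝔭) (P.atOrigin δ) = P.atOrigin δ := by
    filter_upwards [hkK] with τ hτ
    have h1 := P.pull_smulD_val hδ (k τ) P.origin
    rw [P.smul_origin_eq hτ, ← coe_smulE] at h1
    have h2 : (h τ : 𝔭 →L[ℝ] 𝔭) = ((P.tisoE.symm : 𝔭 →L[ℝ] 𝔭) ∘L
      (P.smulE (k τ) P.origin : 𝔭 →L[ℝ] 𝔭)) ∘L (P.tisoE : 𝔭 →L[ℝ] 𝔭) := rfl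
    rw [h2, pull_comp_equiv, pull_comp_equiv, atOrigin_eq, pull_symm_pull, h1]
  refine Tensors.ext fun i w α => ?_
  have h1 := hasDerivAt_pull hd (γ := fun _ => P.atOrigin δ) (γ' := 0)
    (fun i w α => hasDerivAt_const _ _) i w α
  have h2 := h1.unique ((hasDerivAt_const (0 : ℝ) (P.atOrigin δ i w α)).congr_of_eventuallyEq
    (hconst.mono fun τ hτ => by simp only [hτ]))
  rw [hh0, pull_refl] at h2
  have h3 : (0 : ℝ) - thetaHom (P.atOrigin δ) (μ.adp Z) i w α = 0 := h2
  rw [zero_sub, neg_eq_zero] at h3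
  exact h3

end HomogeneousSpace

end Isotropy

/-! ### The operators in the complements `q_δ` -/

section Complement

variable {ι : Type} {r s : ι → ℕ} {W : Type*} [NormedAddCommGroup W] [NormedSpace ℝ W]
  {γ : Tensors r s W} {qγ : Submodule ℝ (W →L[ℝ] W)}

theorem IsInvariantComplement.isCompl (hq : IsInvariantComplement γ qγ) :
    IsCompl qγ (LinearMap.ker (thetaHom γ)) := by
  constructor
  · rw [Submodule.disjoint_def]
    intro A hA hA'
    obtain ⟨B, -, hB⟩ := hq.existsUnique_add A
    have h1 := hB (A, 0) ⟨hA', qγ.zero_mem, by simp⟩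
    have h2 := hB (0, A) ⟨(LinearMap.ker (thetaHom γ)).zero_mem, hA, by simp⟩
    have h3 := congrArg Prod.fst (h1.trans h2.symm)
    exact h3
  · rw [codisjoint_iff, eq_top_iff]
    intro A _
    obtain ⟨B, ⟨h1, h2, h3⟩, -⟩ := hq.existsUnique_add A
    rw [h3, add_comm]
    exact Submodule.add_mem_sup h2 h1

theorem thetaHom_sub_eq_zero_iff {A B : W →L[ℝ] W} :
    thetaHom γ (A - B) = 0 ↔ thetaHom γ A = thetaHom γ B := by
  constructor
  · intro h
    rw [← sub_add_cancel A B, map_add, h, zero_add]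
  · intro h
    rw [sub_eq_add_neg, ← neg_one_smul ℝ B, map_add, map_smul, h]
    have h1 := add_smul (1 : ℝ) (-1) (thetaHom γ B)
    rw [add_neg_cancel, zero_smul, one_smul] at h1
    exact h1.symm

theorem thetaHom_pull (e : W ≃L[ℝ] W) (A : W →L[ℝ] W) :
    thetaHom (pull (e : W →L[ℝ] W) γ) A = pull (e : W →L[ℝ] W)
      (thetaHom γ ((e : W →L[ℝ] W) ∘L A ∘L (e.symm : W →L[ℝ] W))) := by
  rw [pull_thetaHom]
  congr 1
  ext x
  simp

theorem thetaHom_pull_eq_zero (e : W ≃L[ℝ] W) (A : W →L[ℝ] W) :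
    thetaHom (pull (e : W →L[ℝ] W) γ) A = 0 ↔
      thetaHom γ ((e : W →L[ℝ] W) ∘L A ∘L (e.symm : W →L[ℝ] W)) = 0 := by
  rw [thetaHom_pull]
  constructor
  · intro h
    rw [← pull_symm_pull e (thetaHom γ _), h, pull_zero]
  · intro h
    rw [h, pull_zero]

/-- The operator in `q_δ` with a given image under `A ↦ θ(A)δ` is unique. -/
theorem IsInvariantComplement.complementAt_unique (hq : IsInvariantComplement γ qγ)
    {δ : Tensors r s W} {Q₁ Q₂ : W →L[ℝ] W} (h₁ : Q₁ ∈ complementAt γ qγ δ)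
    (h₂ : Q₂ ∈ complementAt γ qγ δ) (h : thetaHom δ Q₁ = thetaHom δ Q₂) : Q₁ = Q₂ := by
  obtain ⟨k₁, hk₁, hQ₁⟩ := h₁
  obtain ⟨k₂, hk₂, hQ₂⟩ := h₂
  have hg : act (k₂.trans k₁.symm) γ = γ := by
    have h3 : ((k₂.trans k₁.symm).symm : W →L[ℝ] W) =
        (k₂.symm : W →L[ℝ] W) ∘L (k₁ : W →L[ℝ] W) := rfl
    rw [act, h3, pull_comp_equiv]
    have h4 : pull (k₂.symm : W →L[ℝ] W) γ = pull (k₁.symm : W →L[ℝ] W) γ := hk₂.symm.trans hk₁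
    rw [h4, pull_pull_symm]
  have hc := hq.conj_mem _ hg _ hQ₂
  have hd := qγ.sub_mem hQ₁ hc
  have hz : thetaHom γ ((k₁.symm : W →L[ℝ] W) ∘L (Q₁ - Q₂) ∘L (k₁ : W →L[ℝ] W)) = 0 := by
    have h5 := thetaHom_pull_eq_zero (γ := γ) k₁.symm (Q₁ - Q₂)
    refine h5.1 ?_
    have h6 : pull (k₁.symm : W →L[ℝ] W) γ = δ := hk₁.symm
    rw [h6, thetaHom_sub_eq_zero_iff, h]
  have he : (k₁.symm : W →L[ℝ] W) ∘L Q₁ ∘L (k₁ : W →L[ℝ] W) -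
      ((k₂.trans k₁.symm : W ≃L[ℝ] W) : W →L[ℝ] W) ∘L ((k₂.symm : W →L[ℝ] W) ∘L Q₂ ∘L
        (k₂ : W →L[ℝ] W)) ∘L ((k₂.trans k₁.symm).symm : W →L[ℝ] W) =
      (k₁.symm : W →L[ℝ] W) ∘L (Q₁ - Q₂) ∘L (k₁ : W →L[ℝ] W) := by
    ext x
    simp
  rw [he] at hd
  have h0 := Submodule.disjoint_def.1 hq.isCompl.disjoint _ hd hz
  ext x
  have h7 := DFunLike.congr_fun h0 (k₁.symm x)
  have h8 : k₁.symm (Q₁ x - Q₂ x) = 0 := by simpa using h7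
  rw [map_eq_zero_iff _ k₁.symm.injective, sub_eq_zero] at h8
  exact h8

/-- The projection onto `q_δ` along the stabilizer algebra, for `δ = k^* γ`. -/
theorem IsInvariantComplement.conj_projection_mem (hq : IsInvariantComplement γ qγ)
    (k : W ≃L[ℝ] W) (A : W →L[ℝ] W) :
    (k.symm : W →L[ℝ] W) ∘L (qγ.projection _ hq.isCompl
        ((k : W →L[ℝ] W) ∘L A ∘L (k.symm : W →L[ℝ] W))) ∘L (k : W →L[ℝ] W) ∈
      complementAt γ qγ (pull (k : W →L[ℝ] W) γ) ∧
    thetaHom (pull (k : W →L[ℝ] W) γ) ((k.symm : W →L[ℝ] W) ∘L (qγ.projection _ hq.isCompl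
        ((k : W →L[ℝ] W) ∘L A ∘L (k.symm : W →L[ℝ] W))) ∘L (k : W →L[ℝ] W)) =
      thetaHom (pull (k : W →L[ℝ] W) γ) A := by
  constructor
  · refine ⟨k.symm, rfl, ?_⟩
    have h1 := Submodule.projection_apply_mem hq.isCompl
      ((k : W →L[ℝ] W) ∘L A ∘L (k.symm : W →L[ℝ] W))
    convert h1 using 1
    ext x
    simp
  · rw [← thetaHom_sub_eq_zero_iff, thetaHom_pull_eq_zero]
    have h1 := Submodule.sub_projection_mem hq.isCompl
      ((k : W →L[ℝ] W) ∘L A ∘L (k.symm : W →L[ℝ] W))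
    have h2 := (LinearMap.ker (thetaHom γ)).neg_mem h1
    rw [LinearMap.mem_ker] at h2
    rw [← h2]
    congr 1
    ext x
    simp

end Complement

section Continuity

variable {ι : Type} {r s : ι → ℕ} {W : Type*} [NormedAddCommGroup W]
  [NormedSpace ℝ W] [FiniteDimensional ℝ W]

/-- The evaluations of tensors. -/
def Tensors.eval (i : ι) (w : Fin (r i) → W) (α : Fin (s i) → Module.Dual ℝ W) :
    Module.Dual ℝ (Tensors r s W) where
  toFun γ := γ i w α
  map_add' _ _ := rfl
  map_smul' _ _ := rfl

/-- A curve of tensors with continuous coefficients is continuous for every linear map to a normed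
space. -/
theorem continuousOn_linearMap_comp_tensors [Finite ι] {J : Set ℝ} {x : ℝ → Tensors r s W}
    (hx : ∀ i w α, ContinuousOn (fun t => x t i w α) J) {C : Type*} [NormedAddCommGroup C]
    [NormedSpace ℝ C] (L : Tensors r s W →ₗ[ℝ] C) : ContinuousOn (fun t => L (x t)) J := by
  -- `Tensors r s W` carries an additive monoid structure; this is a group structure that extends it
  let _ : AddCommGroup (Tensors r s W) := Module.addCommMonoidToAddCommGroup ℝ
  let S : Submodule ℝ (Module.Dual ℝ (Tensors r s W)) :=
    Submodule.span ℝ {ℓ | ∃ i w α, ℓ = Tensors.eval i w α}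
  -- the evaluations separate the tensors, so they span the dual of this finite-dimensional space
  have hS : S = ⊤ := by
    have h1 : S.dualCoannihilator = ⊥ := by
      rw [eq_bot_iff]
      intro γ hγ
      rw [Submodule.mem_dualCoannihilator] at hγ
      exact Tensors.ext fun i w α => hγ _ (Submodule.subset_span ⟨i, w, α, rfl⟩)
    have h2 := Subspace.dualCoannihilator_dualAnnihilator_eq (W := S)
    rw [h1, Submodule.dualAnnihilator_bot] at h2
    exact h2.symm
  have hℓ : ∀ ℓ : Module.Dual ℝ (Tensors r s W), ContinuousOn (fun t => ℓ (x t)) J := by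
    intro ℓ
    have hm : ℓ ∈ S := by
      rw [hS]
      trivial
    induction hm using Submodule.span_induction with
    | mem ℓ h =>
      obtain ⟨i, w, α, rfl⟩ := h
      exact hx i w α
    | zero => exact continuousOn_const
    | add a b _ _ ha hb => exact ha.add hb
    | smul c a _ ha => exact ha.const_smul c
  let b := Module.finBasis ℝ (Tensors r s W)
  have h3 : (fun t => L (x t)) = fun t => ∑ j, b.coord j (x t) • L (b j) := by
    funext t
    conv_lhs => rw [← b.sum_repr (x t), map_sum]
    refine Finset.sum_congr rfl fun j _ => ?_
    rw [map_smul, Module.Basis.coord_apply]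
  rw [h3]
  exact continuousOn_finsetSum _ fun j _ => (hℓ (b.coord j)).smul continuousOn_const

/-- The dimension of the stabilizer algebra is constant along orbits. -/
theorem finrank_ker_thetaHom_pull (k : W ≃L[ℝ] W) (γ : Tensors r s W) :
    Module.finrank ℝ (LinearMap.ker (thetaHom (pull (k : W →L[ℝ] W) γ))) =
      Module.finrank ℝ (LinearMap.ker (thetaHom γ)) := by
  let e : (W →L[ℝ] W) ≃ₗ[ℝ] (W →L[ℝ] W) :=
    { toFun := fun A => (k : W →L[ℝ] W) ∘L A ∘L (k.symm : W →L[ℝ] W)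
      invFun := fun A => (k.symm : W →L[ℝ] W) ∘L A ∘L (k : W →L[ℝ] W)
      map_add' := fun A B => by ext; simp
      map_smul' := fun c A => by ext; simp
      left_inv := fun A => by ext; simp
      right_inv := fun A => by ext; simp }
  have h1 : LinearMap.ker (thetaHom γ) =
      (LinearMap.ker (thetaHom (pull (k : W →L[ℝ] W) γ))).map e.toLinearMap := by
    ext A
    rw [Submodule.mem_map_equiv, LinearMap.mem_ker, LinearMap.mem_ker, thetaHom_pull_eq_zero]
    have h2 : (k : W →L[ℝ] W) ∘L (e.symm A) ∘L (k.symm : W →L[ℝ] W) = A := e.apply_symm_apply A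
    rw [h2]
  rw [h1]
  exact (LinearEquiv.finrank_map_eq e _).symm

theorem continuousOn_thetaHom_apply {J : Set ℝ} {γ : ℝ → Tensors r s W}
    (hγ : ∀ i w α, ContinuousOn (fun t => γ t i w α) J) (A : W →L[ℝ] W) (i : ι)
    (w : Fin (r i) → W) (α : Fin (s i) → Module.Dual ℝ W) :
    ContinuousOn (fun t => thetaHom (γ t) A i w α) J := by
  simp only [thetaHom_apply, theta_apply]
  exact (continuousOn_finsetSum _ fun k _ => hγ _ _ _).neg.add
    (continuousOn_finsetSum _ fun k _ => hγ _ _ _)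

/-- Preimages under a continuous family of linear maps of constant rank can be chosen
continuously. -/
theorem exists_continuousOn_preimage {V T : Type*} [NormedAddCommGroup V] [NormedSpace ℝ V]
    [FiniteDimensional ℝ V] [AddCommGroup T] [Module ℝ T] {J : Set ℝ} (hJ : IsOpen J)
    {Θ : ℝ → V →ₗ[ℝ] T} {q : ℝ → T}
    (hΘ : ∀ (ℓ : T →ₗ[ℝ] V) (v : V), ContinuousOn (fun t => ℓ (Θ t v)) J)
    (hq : ∀ ℓ : T →ₗ[ℝ] V, ContinuousOn (fun t => ℓ (q t)) J) {d : ℕ}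
    (hd : ∀ t ∈ J, Module.finrank ℝ (LinearMap.ker (Θ t)) = d)
    (hqΘ : ∀ t ∈ J, ∃ v, Θ t v = q t) {t₀ : ℝ} (ht₀ : t₀ ∈ J) :
    ∃ (A : ℝ → V) (ε : ℝ), 0 < ε ∧ ball t₀ ε ⊆ J ∧ ContinuousOn A (ball t₀ ε) ∧
      ∀ t ∈ ball t₀ ε, Θ t (A t) = q t := by
  have : CompleteSpace V := FiniteDimensional.complete ℝ V
  -- the preimages are taken in a complement `C` of the kernel at `t₀`
  obtain ⟨C, hC⟩ := Submodule.exists_isCompl (LinearMap.ker (Θ t₀))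
  have hinj : LinearMap.ker ((Θ t₀).domRestrict C) = ⊥ := by
    rw [eq_bot_iff]
    intro c hc
    have h1 := Submodule.disjoint_def.1 hC.disjoint (c : V) hc c.2
    exact Subtype.ext h1
  obtain ⟨L', hL'⟩ := LinearMap.exists_leftInverse_of_injective _ hinj
  let L : T →ₗ[ℝ] V := C.subtype ∘ₗ L'
  have hL : ∀ c ∈ C, L (Θ t₀ c) = c := fun c hc =>
    congrArg Subtype.val (DFunLike.congr_fun hL' (⟨c, hc⟩ : C))
  let π : V →ₗ[ℝ] V := (LinearMap.ker (Θ t₀)).projection C hC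
  have hπC : ∀ c ∈ C, π c = 0 := fun c hc =>
    (Submodule.projection_apply_eq_zero_iff hC).2 hc
  have hπK : ∀ v ∈ LinearMap.ker (Θ t₀), π v = v := fun v hv =>
    Submodule.projection_apply_left hC ⟨v, hv⟩
  -- `Ψ t` maps `c ∈ C` to `L (Θ t c)`, and it is the identity at `t₀`
  let Ψ : ℝ → V →L[ℝ] V := fun t => LinearMap.toContinuousLinearMap (L ∘ₗ Θ t + π)
  have hΨ : ∀ t v, Ψ t v = L (Θ t v) + π v := fun t v => rfl
  have hΨc : ContinuousOn Ψ J := by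
    rw [continuousOn_clm_apply]
    intro v
    exact (hΘ L v).add continuousOn_const
  have hΨ₀ : Ψ t₀ = ContinuousLinearEquiv.refl ℝ V := by
    ext v
    obtain ⟨a, ha, c, hc, rfl⟩ := Submodule.mem_sup.1
      ((codisjoint_iff.1 hC.codisjoint).symm ▸ Submodule.mem_top :
        v ∈ LinearMap.ker (Θ t₀) ⊔ C)
    rw [hΨ, map_add, map_add, map_add, hL c hc, hπC c hc, hπK a ha, LinearMap.mem_ker.1 ha,
      map_zero]
    simp [add_comm]
  have hev : ∀ᶠ t in 𝓝 t₀, t ∈ J ∧ (Ψ t).IsInvertible := by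
    have h1 : ContinuousAt Ψ t₀ := hΨc.continuousAt (hJ.mem_nhds ht₀)
    have h2 : range ((↑) : (V ≃L[ℝ] V) → V →L[ℝ] V) ∈ 𝓝 (Ψ t₀) := by
      rw [hΨ₀]
      exact ContinuousLinearEquiv.nhds (ContinuousLinearEquiv.refl ℝ V)
    exact Filter.Eventually.and (hJ.mem_nhds ht₀) (h1 h2)
  obtain ⟨ε, hε, hb⟩ := Metric.eventually_nhds_iff_ball.1 hev
  refine ⟨fun t => (Ψ t).inverse (L (q t)), ε, hε, fun t ht => (hb t ht).1, ?_, ?_⟩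
  · have h1 : ContinuousOn (fun t => (Ψ t).inverse) (ball t₀ ε) := by
      intro t ht
      obtain ⟨e, he⟩ := (hb t ht).2
      have h2 : ContinuousAt (ContinuousLinearMap.inverse : (V →L[ℝ] V) → V →L[ℝ] V) (Ψ t) := by
        rw [← he]
        exact (contDiffAt_map_inverse (n := 0) e).continuousAt
      exact ContinuousAt.comp_continuousWithinAt (g := ContinuousLinearMap.inverse) h2
        ((hΨc t (hb t ht).1).mono fun t ht => (hb t ht).1)
    exact h1.clm_apply ((hq L).mono fun t ht => (hb t ht).1)
  · intro t ht
    obtain ⟨htJ, e, he⟩ := hb t ht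
    -- by the constancy of the rank, `Θ t` maps `C` onto its range
    have hr : LinearMap.range ((Θ t).domRestrict C) = LinearMap.range (Θ t) := by
      refine Submodule.eq_of_le_of_finrank_eq (LinearMap.range_domRestrict_le_range _ _) ?_
      have hi : Function.Injective ((Θ t).domRestrict C) := by
        intro a b hab
        have h0 : Θ t a = Θ t b := hab
        have h1 : Ψ t a = Ψ t b := by
          rw [hΨ, hΨ, h0, hπC _ a.2, hπC _ b.2]
        rw [← he] at h1
        exact Subtype.ext (e.injective h1)
      have h1 := LinearMap.finrank_range_of_inj hi
      have h2 := LinearMap.finrank_range_add_finrank_ker (Θ t)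
      have h3 := Submodule.finrank_add_eq_of_isCompl hC
      have h4 := hd t htJ
      have h5 := hd t₀ ht₀
      omega
    obtain ⟨A, hA⟩ := hqΘ t htJ
    have h5 : q t ∈ LinearMap.range ((Θ t).domRestrict C) := by
      rw [hr]
      exact ⟨A, hA⟩
    obtain ⟨c, hc⟩ := h5
    have hc' : Θ t c = q t := hc
    have h6 : L (q t) = Ψ t c := by
      rw [hΨ, hπC _ c.2, hc', add_zero]
    have h7 : (Ψ t).inverse (L (q t)) = c := by
      rw [h6, ← he, ContinuousLinearMap.inverse_equiv]
      simp
    exact (congrArg (Θ t) h7).trans hc'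

/-- If `h' = -hA` and `γ' = θ(A)γ`, then `h · γ` is constant. -/
theorem pull_symm_eq_of_hasDerivAt {J : Set ℝ} (hJ : IsOpen J) (hJ' : J.OrdConnected)
    {h : ℝ → W ≃L[ℝ] W} {A : ℝ → W →L[ℝ] W} {γ : ℝ → Tensors r s W}
    (hh : ∀ t ∈ J, HasDerivAt (fun τ => (h τ : W →L[ℝ] W)) (-((h t : W →L[ℝ] W) ∘L A t)) t)
    (hγ : ∀ t ∈ J, ∀ i w α, HasDerivAt (fun τ => γ τ i w α) (thetaHom (γ t) (A t) i w α) t)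
    {t₀ t : ℝ} (ht₀ : t₀ ∈ J) (ht : t ∈ J) :
    pull ((h t).symm : W →L[ℝ] W) (γ t) = pull ((h t₀).symm : W →L[ℝ] W) (γ t₀) := by
  have : CompleteSpace W := FiniteDimensional.complete ℝ W
  have hd : ∀ t ∈ J, ∀ i w α, HasDerivAt
      (fun τ => pull ((h τ).symm : W →L[ℝ] W) (γ τ) i w α) 0 t := by
    intro t ht i w α
    have h1 : HasDerivAt (fun τ => ((h τ).symm : W →L[ℝ] W))
        (A t ∘L ((h t).symm : W →L[ℝ] W)) t := by
      refine (hasDerivAt_symm (hh t ht)).congr_deriv ?_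
      ext x
      simp
    refine (hasDerivAt_pull (h := fun τ => (h τ).symm) h1 (hγ t ht) i w α).congr_deriv ?_
    have h3 : (A t ∘L ((h t).symm : W →L[ℝ] W)) ∘L ((h t).symm.symm : W →L[ℝ] W) = A t := by
      ext x
      simp
    rw [h3, pull_apply]
    exact sub_self _
  exact Tensors.ext fun i w α => eq_of_hasDerivAt_zero hJ hJ' (fun τ hτ => hd τ hτ i w α) ht ht₀

/-- The operators `Q(t) ∈ q_{γ(t)}` with `θ(Q(t))γ(t) = γ'(t)` depend continuously on `t`. -/
theorem IsInvariantComplement.exists_continuousOn_operator [Finite ι] {γ₀ : Tensors r s W}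
    {qγ : Submodule ℝ (W →L[ℝ] W)} (hqγ : IsInvariantComplement γ₀ qγ) {J : Set ℝ} (hJ : IsOpen J)
    {γ q : ℝ → Tensors r s W} (horb : ∀ t ∈ J, ∃ k : W ≃L[ℝ] W, γ t = pull (k : W →L[ℝ] W) γ₀)
    (hγ : ∀ t ∈ J, ∀ i w α, HasDerivAt (fun τ => γ τ i w α) (q t i w α) t)
    (hq : ∀ i w α, ContinuousOn (fun t => q t i w α) J)
    (hqθ : ∀ t ∈ J, ∃ A, thetaHom (γ t) A = q t) :
    ∃ Q : ℝ → W →L[ℝ] W, ContinuousOn Q J ∧ ∀ t ∈ J, Q t ∈ complementAt γ₀ qγ (γ t) ∧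
      thetaHom (γ t) (Q t) = q t := by
  have : CompleteSpace W := FiniteDimensional.complete ℝ W
  have hex : ∀ t, ∃ Q : W →L[ℝ] W, t ∈ J → Q ∈ complementAt γ₀ qγ (γ t) ∧ thetaHom (γ t) Q = q t := by
    intro t
    by_cases ht : t ∈ J
    · obtain ⟨k, hk⟩ := horb t ht
      obtain ⟨A, hA⟩ := hqθ t ht
      obtain ⟨h1, h2⟩ := hqγ.conj_projection_mem k A
      rw [← hk] at h1 h2
      exact ⟨_, fun _ => ⟨h1, h2.trans hA⟩⟩
    · exact ⟨0, fun h => absurd h ht⟩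
  choose Q hQ using hex
  refine ⟨Q, fun t₀ ht₀ => ContinuousAt.continuousWithinAt ?_, hQ⟩
  have hγc : ∀ i w α, ContinuousOn (fun t => γ t i w α) J := fun i w α t ht =>
    (hγ t ht i w α).continuousAt.continuousWithinAt
  -- a continuous choice of operators `A(t)` with `θ(A(t))γ(t) = q(t)`, not yet in `q_{γ(t)}`
  have hrank : ∀ t ∈ J, Module.finrank ℝ (LinearMap.ker (thetaHom (γ t))) =
      Module.finrank ℝ (LinearMap.ker (thetaHom γ₀)) := by
    intro t ht
    obtain ⟨k, hk⟩ := horb t ht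
    rw [hk, finrank_ker_thetaHom_pull]
  obtain ⟨A, ε, hε, hbJ, hAc, hA⟩ : ∃ (A : ℝ → W →L[ℝ] W) (ε : ℝ), 0 < ε ∧ ball t₀ ε ⊆ J ∧
      ContinuousOn A (ball t₀ ε) ∧ ∀ t ∈ ball t₀ ε, thetaHom (γ t) (A t) = q t := by
    let _ : AddCommGroup (Tensors r s W) := Module.addCommMonoidToAddCommGroup ℝ
    exact exists_continuousOn_preimage (V := W →L[ℝ] W) (T := Tensors r s W) hJ
      (Θ := fun t => thetaHom (γ t))
      (fun ℓ v => continuousOn_linearMap_comp_tensors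
        (fun i w α => continuousOn_thetaHom_apply hγc v i w α) ℓ)
      (fun ℓ => continuousOn_linearMap_comp_tensors hq ℓ) hrank hqθ ht₀
  -- `γ(t) = k(t)^* γ(t₀)`, where `k` solves `k' = -kA`
  have hshift : ∀ τ ∈ ball (0 : ℝ) ε, τ + t₀ ∈ ball t₀ ε := fun τ hτ => by
    simpa [dist_eq_norm] using hτ
  obtain ⟨k, hk0, hk⟩ := exists_linear_solution_GL (V := W) (J := ball (0 : ℝ) ε) isOpen_ball
    (convex_ball _ _).ordConnected (mem_ball_self hε) (fun τ => A (τ + t₀))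
    (hAc.comp (by fun_prop) hshift)
  have hkγ : ∀ τ ∈ ball (0 : ℝ) ε, γ (τ + t₀) = pull (k τ : W →L[ℝ] W) (γ t₀) := by
    intro τ hτ
    have h2 : ∀ τ ∈ ball (0 : ℝ) ε, ∀ i w α, HasDerivAt (fun τ => γ (τ + t₀) i w α)
        (thetaHom (γ (τ + t₀)) (A (τ + t₀)) i w α) τ := fun τ hτ i w α => by
      rw [hA _ (hshift τ hτ)]
      exact (hγ _ (hbJ (hshift τ hτ)) i w α).comp_add_const τ t₀
    have h4 : pull ((k τ).symm : W →L[ℝ] W) (γ (τ + t₀)) = γ t₀ := by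
      rw [pull_symm_eq_of_hasDerivAt isOpen_ball (convex_ball (0 : ℝ) ε).ordConnected hk h2
        (mem_ball_self hε) hτ, hk0, zero_add]
      exact pull_refl (γ t₀)
    rw [← h4, pull_pull_symm]
  obtain ⟨k₀, hk₀⟩ := horb t₀ ht₀
  let K : ℝ → W ≃L[ℝ] W := fun t => (k (t - t₀)).trans k₀
  have hm : ∀ t ∈ ball t₀ ε, t - t₀ ∈ ball (0 : ℝ) ε := fun t ht => by
    simpa [dist_eq_norm] using ht
  have hKγ : ∀ t ∈ ball t₀ ε, γ t = pull (K t : W →L[ℝ] W) γ₀ := by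
    intro t ht
    have h1 := hkγ _ (hm t ht)
    rw [sub_add_cancel] at h1
    have h2 : (K t : W →L[ℝ] W) = (k₀ : W →L[ℝ] W) ∘L (k (t - t₀) : W →L[ℝ] W) := rfl
    rw [h1, h2, pull_comp_equiv, hk₀]
  -- `Q(t)` is the projection of `A(t)` to `q_{γ(t)}`, and conjugation by `K(t)` turns this projection
  -- into the fixed projection to `q_γ`
  have hQK : ∀ t ∈ ball t₀ ε, Q t = ((K t).symm : W →L[ℝ] W) ∘L (qγ.projection _ hqγ.isCompl
      ((K t : W →L[ℝ] W) ∘L A t ∘L ((K t).symm : W →L[ℝ] W))) ∘L (K t : W →L[ℝ] W) := by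
    intro t ht
    obtain ⟨h1, h2⟩ := hqγ.conj_projection_mem (K t) (A t)
    rw [← hKγ t ht] at h1 h2
    obtain ⟨h3, h4⟩ := hQ t (hbJ ht)
    exact hqγ.complementAt_unique h3 h1 (by rw [h2, h4, hA t ht])
  obtain ⟨D, hKd⟩ : ∃ D, HasDerivAt (fun t => (K t : W →L[ℝ] W)) D t₀ := by
    have h1 := hk (t₀ - t₀) (hm t₀ (mem_ball_self hε))
    exact ⟨_, (hasDerivAt_const t₀ (k₀ : W →L[ℝ] W)).clm_comp (h1.comp_sub_const t₀ t₀)⟩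
  have hKs := (hasDerivAt_symm hKd).continuousAt
  have hKc := hKd.continuousAt
  have hAt : ContinuousAt A t₀ := hAc.continuousAt (ball_mem_nhds _ hε)
  have hP : Continuous (qγ.projection _ hqγ.isCompl) := LinearMap.continuous_of_finiteDimensional _
  have h1 : ContinuousAt (fun t => (K t : W →L[ℝ] W) ∘L A t ∘L ((K t).symm : W →L[ℝ] W)) t₀ :=
    hKc.clm_comp (hAt.clm_comp hKs)
  refine ContinuousAt.congr (hKs.clm_comp ((hP.continuousAt.comp h1).clm_comp hKc)) ?_
  filter_upwards [ball_mem_nhds t₀ hε] with t ht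
  exact (hQK t ht).symm

end Continuity

/-! ### Invariant structures on homogeneous spaces -/

section InvariantFields

variable {𝔨 𝔭 : Type*} [NormedAddCommGroup 𝔨] [NormedSpace ℝ 𝔨] [FiniteDimensional ℝ 𝔨]
  [NormedAddCommGroup 𝔭] [NormedSpace ℝ 𝔭] [FiniteDimensional ℝ 𝔭] {μ μ₁ μ₂ : Br 𝔨 𝔭}
  {ι : Type} {r s : ι → ℕ}

namespace HomogeneousSpace

variable (P : HomogeneousSpace.{u} μ)

/-- An invariant tensor field is determined by its value at the origin. -/
theorem val_proj {δ : TensorField r s 𝔭 P.space} (hδ : P.IsInvariant δ) (g : P.G) :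
    δ.val (P.proj g) =
      pull ((P.tisoE.trans (P.smulE g P.origin)).symm : 𝔭 →L[ℝ] 𝔭) (P.atOrigin δ) := by
  have h1 := P.pull_smulD_val hδ g P.origin
  rw [smul_proj, mul_one, ← coe_smulE] at h1
  have h2 : ((P.tisoE.trans (P.smulE g P.origin) : 𝔭 ≃L[ℝ] 𝔭) : 𝔭 →L[ℝ] 𝔭) =
      (P.smulE g P.origin : 𝔭 →L[ℝ] 𝔭) ∘L (P.tisoE : 𝔭 →L[ℝ] 𝔭) := rfl
  have h3 : P.atOrigin δ = pull ((P.tisoE.trans (P.smulE g P.origin) : 𝔭 ≃L[ℝ] 𝔭) : 𝔭 →L[ℝ] 𝔭)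
      (δ.val (P.proj g)) := by
    rw [atOrigin_eq, h2, pull_comp_equiv, h1]
  rw [h3, pull_symm_pull]

theorem IsInvariant.eq_of_atOrigin {P : HomogeneousSpace.{u} μ}
    {δ₁ δ₂ : TensorField r s 𝔭 P.space} (h₁ : P.IsInvariant δ₁)
    (h₂ : P.IsInvariant δ₂) (h : P.atOrigin δ₁ = P.atOrigin δ₂) : δ₁ = δ₂ := by
  funext x
  obtain ⟨g, rfl⟩ := P.exists_proj_eq x
  have h3 := P.val_proj h₁ g
  rw [h, ← P.val_proj h₂ g] at h3
  exact h3

/-- The action of `g` as a diffeomorphism. -/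
noncomputable def smulDiffeo (g : P.G) : P.space ≃ₘ^∞⟮𝓘(ℝ, 𝔭), 𝓘(ℝ, 𝔭)⟯ P.space where
  toFun x := g • x
  invFun x := g⁻¹ • x
  left_inv x := inv_smul_smul g x
  right_inv x := smul_inv_smul g x
  contMDiff_toFun := P.contMDiff_smul g
  contMDiff_invFun := P.contMDiff_smul g⁻¹

variable {γ : Tensors r s 𝔭}

/-- If `δ` is invariant, then so is `q(δ)`, as the group acts by diffeomorphisms. -/
theorem IsInvariant.flow {P : HomogeneousSpace.{u} μ} (F : GeometricFlow.{u} γ)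
    {δ : TensorField r s 𝔭 P.space}
    (hδ : P.IsInvariant δ) (hd : δ ∈ F.dom P.space) : P.IsInvariant (F.q P.space δ) := by
  intro g
  have h1 := F.q_pullback P.space P.space (P.smulDiffeo g) δ hd
  have h2 : TensorField.pullback (P.smulDiffeo g) δ = δ := hδ g
  rw [h2] at h1
  exact h1.symm

theorem exists_atOrigin_eq_pull (F : GeometricFlow.{u} γ) {δ : TensorField r s 𝔭 P.space}
    (hd : δ ∈ F.dom P.space) : ∃ k : 𝔭 ≃L[ℝ] 𝔭, P.atOrigin δ = pull (k : 𝔭 →L[ℝ] 𝔭) γ := by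
  obtain ⟨L, hL⟩ := F.nondegenerate P.space δ hd P.origin
  let L' : 𝔭 ≃L[ℝ] 𝔭 := L
  have hL' : pull (L' : 𝔭 →L[ℝ] 𝔭) (δ.val P.origin) = γ := hL
  refine ⟨P.tisoE.trans L'.symm, ?_⟩
  have h2 : ((P.tisoE.trans L'.symm : 𝔭 ≃L[ℝ] 𝔭) : 𝔭 →L[ℝ] 𝔭) =
      (L'.symm : 𝔭 →L[ℝ] 𝔭) ∘L (P.tisoE : 𝔭 →L[ℝ] 𝔭) := rfl
  rw [h2, pull_comp_equiv, ← hL', pull_symm_pull, atOrigin_eq]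

theorem exists_thetaHom_eq_atOrigin (F : GeometricFlow.{u} γ) {δ : TensorField r s 𝔭 P.space}
    (hd : δ ∈ F.dom P.space) :
    ∃ A : 𝔭 →L[ℝ] 𝔭, thetaHom (P.atOrigin δ) A = P.atOrigin (F.q P.space δ) := by
  obtain ⟨A, hA⟩ := F.same_type P.space δ hd P.origin
  let A' : 𝔭 →ₗ[ℝ] 𝔭 := A
  have hA' : (F.q P.space δ).val P.origin =
      thetaHom (δ.val P.origin) (LinearMap.toContinuousLinearMap A') := hA
  exact ⟨_, by rw [atOrigin_eq, atOrigin_eq, hA', pull_thetaHom]⟩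

end HomogeneousSpace

variable {P : HomogeneousSpace.{u} μ₁} {R : HomogeneousSpace.{u} μ₂} {h : 𝔭 ≃L[ℝ] 𝔭}
  {φ : P.space ≃ₘ^∞⟮𝓘(ℝ, 𝔭), 𝓘(ℝ, 𝔭)⟯ R.space}

theorem IsEquivariantDiffeo.isInvariant_pullback (hφ : IsEquivariantDiffeo P R h φ)
    {δ : TensorField r s 𝔭 R.space} (hδ : R.IsInvariant δ) :
    P.IsInvariant (TensorField.pullback φ δ) := by
  obtain ⟨⟨ψ, -, -, -, -, -, hψ⟩, -⟩ := hφ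
  have hφd : ∀ x, MDer φ x (md 𝔭 𝔭 φ x) := fun x =>
    mder_of_contMDiffAt φ.contMDiff.contMDiffAt (by simp)
  intro g
  funext x
  have h1 : md 𝔭 𝔭 φ (g • x) ∘L P.smulD g x = R.smulD (ψ g) (φ x) ∘L md 𝔭 𝔭 φ x := by
    refine ((hφd (g • x)).comp (f := fun y => g • y) (P.mder_smul g x)).unique ?_
    exact ((R.mder_smul (ψ g) (φ x)).comp (hφd x)).congr (Eventually.of_forall fun y => hψ g y)
  have h2 : pull (P.smulD g x) (pull (md 𝔭 𝔭 φ (g • x)) (δ.val (φ (g • x)))) =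
      pull (md 𝔭 𝔭 φ x) (δ.val (φ x)) := by
    rw [← P.coe_smulE, ← pull_comp_equiv, P.coe_smulE, h1, ← R.coe_smulE, pull_equiv_comp,
      hψ g x, R.coe_smulE, R.pull_smulD_val hδ]
  exact h2

theorem IsEquivariantDiffeo.atOrigin_pullback (hφ : IsEquivariantDiffeo P R h φ)
    (δ : TensorField r s 𝔭 R.space) :
    P.atOrigin (TensorField.pullback φ δ) = pull (h : 𝔭 →L[ℝ] 𝔭) (R.atOrigin δ) := by
  have h1 : P.atOrigin (TensorField.pullback φ δ) =
      pull (P.tisoE : 𝔭 →L[ℝ] 𝔭) (pull (md 𝔭 𝔭 φ P.origin) (δ.val (φ P.origin))) := rfl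
  have h2 := hφ.md_comp_tiso
  rw [h1, ← pull_comp_equiv, hφ.map_origin, R.atOrigin_eq, ← pull_comp_equiv]
  exact congrArg (fun L => pull L (δ.val R.origin)) h2

end InvariantFields

/-! ### The operators `Q_μ` -/

section Operators

variable {𝔨 𝔭 : Type*} [NormedAddCommGroup 𝔨] [NormedSpace ℝ 𝔨] [FiniteDimensional ℝ 𝔨]
  [NormedAddCommGroup 𝔭] [NormedSpace ℝ 𝔭] [FiniteDimensional ℝ 𝔭] {μ : Br 𝔨 𝔭}
  {ι : Type} {r s : ι → ℕ} {γ : Tensors r s 𝔭} {qγ : Submodule ℝ (𝔭 →L[ℝ] 𝔭)}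

theorem Br.act_tilde_symm (h : 𝔭 ≃L[ℝ] 𝔭) (μ : Br 𝔨 𝔭) :
    Br.act (tilde 𝔨 h.symm) (Br.act (tilde 𝔨 h) μ) = μ := by
  refine ContinuousLinearMap.ext fun X => ContinuousLinearMap.ext fun Y => ?_
  have h1 : ∀ X : 𝔨 × 𝔭, (tilde 𝔨 h.symm) (tilde 𝔨 h X) = X := fun X => by
    simp [tilde]
  have h2 : ∀ X : 𝔨 × 𝔭, (tilde 𝔨 h).symm ((tilde 𝔨 h.symm).symm X) = X := fun X => by
    simp [tilde]
  rw [Br.act_apply, Br.act_apply, h1, h2, h2]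

theorem Br.act_tilde_refl (μ : Br 𝔨 𝔭) :
    Br.act (tilde 𝔨 (ContinuousLinearEquiv.refl ℝ 𝔭)) μ = μ := by
  exact ContinuousLinearMap.ext fun X => ContinuousLinearMap.ext fun Y => rfl

/-- The complement at `h^* γ` may be computed by means of `h`, as any other choice differs from it by
an element of the stabilizer of `γ`. -/
theorem mem_complementAt_pull_iff (hqγ : IsInvariantComplement γ qγ) (h : 𝔭 ≃L[ℝ] 𝔭)
    (Q : 𝔭 →L[ℝ] 𝔭) : Q ∈ complementAt γ qγ (pull (h : 𝔭 →L[ℝ] 𝔭) γ) ↔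
      (h : 𝔭 →L[ℝ] 𝔭) ∘L Q ∘L (h.symm : 𝔭 →L[ℝ] 𝔭) ∈ qγ := by
  constructor
  · rintro ⟨k, hk, hQ⟩
    have hg : act (k.trans h) γ = γ := by
      have h3 : ((k.trans h).symm : 𝔭 →L[ℝ] 𝔭) =
          (k.symm : 𝔭 →L[ℝ] 𝔭) ∘L (h.symm : 𝔭 →L[ℝ] 𝔭) := rfl
      have h4 : pull (h : 𝔭 →L[ℝ] 𝔭) γ = pull (k.symm : 𝔭 →L[ℝ] 𝔭) γ := hk
      rw [act, h3, pull_comp_equiv, ← h4, pull_symm_pull]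
    have h5 := hqγ.conj_mem _ hg _ hQ
    convert h5 using 1
    ext x
    simp
  · intro hQ
    exact ⟨h.symm, rfl, hQ⟩

namespace GeometricFlow

variable (F : GeometricFlow.{u} γ)

/-- The equation of `Q_μ` has to be verified only on one homogeneous space presented by `μ`, since
any two are related by an equivariant diffeomorphism. -/
theorem isBracketOperator_iff {R : HomogeneousSpace.{u} μ} {δ : TensorField r s 𝔭 R.space}
    (hd : δ ∈ F.dom R.space) (hδ : R.IsInvariantExtension γ δ) (Q : 𝔭 →L[ℝ] 𝔭) :
    F.IsBracketOperator qγ μ Q ↔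
      Q ∈ qγ ∧ thetaHom γ Q = R.atOrigin (F.q R.space δ) := by
  refine and_congr_right fun _ => ⟨fun h => h R δ hδ, fun h R' δ' hδ' => ?_⟩
  obtain ⟨φ, hφ⟩ := HomogeneousSpace.exists_isEquivariantDiffeo R' R
    (ContinuousLinearEquiv.refl ℝ 𝔭) (Br.act_tilde_refl μ).symm
  have h1 : δ' = TensorField.pullback φ δ := by
    refine hδ'.1.eq_of_atOrigin (hφ.isInvariant_pullback hδ.1) ?_
    rw [hφ.atOrigin_pullback, pull_refl, hδ.2, hδ'.2]
  rw [h1, F.q_pullback _ _ φ δ hd, hφ.atOrigin_pullback, pull_refl]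
  exact h

theorem IsBracketOperator.unique {F : GeometricFlow.{u} γ} (hqγ : IsInvariantComplement γ qγ)
    (hμ : F.Admissible μ)
    {Q₁ Q₂ : 𝔭 →L[ℝ] 𝔭} (h₁ : F.IsBracketOperator qγ μ Q₁) (h₂ : F.IsBracketOperator qγ μ Q₂) :
    Q₁ = Q₂ := by
  obtain ⟨R⟩ := hμ.closed
  obtain ⟨δ, -, hδ⟩ := hμ.mem_dom R
  have h3 : thetaHom γ Q₁ = thetaHom γ Q₂ := (h₁.2 R δ hδ).trans (h₂.2 R δ hδ).symm
  exact sub_eq_zero.1 (Submodule.disjoint_def.1 hqγ.isCompl.disjoint _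
    (qγ.sub_mem h₁.1 h₂.1) (thetaHom_sub_eq_zero_iff.2 h3))

theorem atOrigin_pullback_flow (F : GeometricFlow.{u} γ) {μ₁ μ₂ : Br 𝔨 𝔭}
    {P : HomogeneousSpace.{u} μ₁} {R : HomogeneousSpace.{u} μ₂} {h : 𝔭 ≃L[ℝ] 𝔭}
    {φ : P.space ≃ₘ^∞⟮𝓘(ℝ, 𝔭), 𝓘(ℝ, 𝔭)⟯ R.space} (hφ : IsEquivariantDiffeo P R h φ)
    {δ : TensorField r s 𝔭 R.space} (hd : δ ∈ F.dom R.space) :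
    P.atOrigin (F.q P.space (TensorField.pullback φ δ)) =
      pull (h : 𝔭 →L[ℝ] 𝔭) (R.atOrigin (F.q R.space δ)) := by
  rw [F.q_pullback _ _ φ δ hd, hφ.atOrigin_pullback]

end GeometricFlow

/-- The homogeneous space `G/K`, presented by the bracket `h̃ · μ`. -/
noncomputable def HomogeneousSpace.transport (P : HomogeneousSpace.{u} μ) (h : 𝔭 ≃L[ℝ] 𝔭) :
    HomogeneousSpace.{u} (Br.act (tilde 𝔨 h) μ) where
  G := P.G
  K := P.K
  isClosed_K := P.isClosed_K
  isConnected_K := P.isConnected_K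
  contMDiff_mk := P.contMDiff_mk
  surjective_mfderiv_mk := P.surjective_mfderiv_mk
  lieIso := (tilde 𝔨 h).symm.trans P.lieIso
  lieIso_bracket X Y := by
    rw [ContinuousLinearEquiv.trans_apply, Br.act_apply, ContinuousLinearEquiv.symm_apply_apply,
      P.lieIso_bracket]
    rfl
  lie_K X := by
    rw [ContinuousLinearEquiv.trans_apply, P.lie_K]
    exact map_eq_zero_iff h.symm h.symm.injective

namespace GeometricFlow

variable {F : GeometricFlow.{u} γ} {P : HomogeneousSpace.{u} μ} {δ : TensorField r s 𝔭 P.space}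
  {h : 𝔭 ≃L[ℝ] 𝔭}

/-- A structure on `G/K` with value `h^* γ` at the origin corresponds to the structure with value
`γ` on the homogeneous spaces presented by `h̃ · μ`. -/
theorem exists_isInvariantExtension (hd : δ ∈ F.dom P.space)
    (hδ : P.IsInvariant δ) (hγ : P.atOrigin δ = pull (h : 𝔭 →L[ℝ] 𝔭) γ)
    (R : HomogeneousSpace.{u} (Br.act (tilde 𝔨 h) μ)) :
    ∃ ε ∈ F.dom R.space, R.IsInvariantExtension γ ε ∧
      R.atOrigin (F.q R.space ε) = pull (h.symm : 𝔭 →L[ℝ] 𝔭) (P.atOrigin (F.q P.space δ)) := by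
  obtain ⟨φ, hφ⟩ := HomogeneousSpace.exists_isEquivariantDiffeo R P h.symm
    (Br.act_tilde_symm h μ).symm
  refine ⟨TensorField.pullback φ δ, F.pullback_mem _ _ φ δ hd,
    ⟨hφ.isInvariant_pullback hδ, ?_⟩, F.atOrigin_pullback_flow hφ hd⟩
  rw [hφ.atOrigin_pullback, hγ, pull_symm_pull]

/-- If the structure `δ` on `G/K` has value `h^* γ` at the origin, then `Q_μ = h Q h⁻¹` for
`μ = h̃ · [·,·]`, where `Q ∈ q_{h^* γ}` is the operator of `δ`. -/
theorem isBracketOperator_act_iff (hqγ : IsInvariantComplement γ qγ) (hd : δ ∈ F.dom P.space)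
    (hδ : P.IsInvariant δ) (hγ : P.atOrigin δ = pull (h : 𝔭 →L[ℝ] 𝔭) γ) (Q : 𝔭 →L[ℝ] 𝔭) :
    F.IsBracketOperator qγ (Br.act (tilde 𝔨 h) μ)
        ((h : 𝔭 →L[ℝ] 𝔭) ∘L Q ∘L (h.symm : 𝔭 →L[ℝ] 𝔭)) ↔
      Q ∈ complementAt γ qγ (P.atOrigin δ) ∧
        thetaHom (P.atOrigin δ) Q = P.atOrigin (F.q P.space δ) := by
  obtain ⟨ε, hε, hεγ, hεq⟩ := exists_isInvariantExtension hd hδ hγ (P.transport h)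
  rw [F.isBracketOperator_iff hε hεγ, hεq, hγ, mem_complementAt_pull_iff hqγ, thetaHom_pull]
  refine and_congr_right fun _ => ⟨fun h1 => ?_, fun h1 => ?_⟩
  · rw [h1, pull_pull_symm]
  · rw [← h1, pull_symm_pull]

/-- If `h^* γ` determines an invariant structure of the class on `G/K`, then `h̃ · [·,·]` is in
`H(γ)`. -/
theorem Admissible.act (hμ : F.Admissible μ) (hd : δ ∈ F.dom P.space)
    (hδ : P.IsInvariant δ) (hγ : P.atOrigin δ = pull (h : 𝔭 →L[ℝ] 𝔭) γ) :
    F.Admissible (Br.act (tilde 𝔨 h) μ) where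
  skew X Y := by rw [Br.act_apply, hμ.skew, map_neg, Br.act_apply]
  jacobi X Y Z := by
    simp only [Br.act_apply, ContinuousLinearEquiv.symm_apply_apply, ← map_add, hμ.jacobi, map_zero]
  mem_k Z Z' := by
    have h1 : ((tilde 𝔨 h) (μ (Z, h.symm 0) (Z', h.symm 0))).2 = 0 := by
      rw [map_zero]
      change h (μ (Z, 0) (Z', 0)).2 = 0
      rw [hμ.mem_k, map_zero]
    exact h1
  mem_p Z X := by
    have h1 : (μ (Z, h.symm 0) (0, h.symm X)).1 = 0 := by
      rw [map_zero]
      exact hμ.mem_p Z _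
    exact h1
  closed := ⟨P.transport h⟩
  effective Z hZ := by
    refine hμ.effective Z fun X => ?_
    have h1 : (tilde 𝔨 h) (μ (Z, h.symm 0) (0, h.symm (h X))) = 0 := hZ (h X)
    rw [map_zero, h.symm_apply_apply] at h1
    exact (map_eq_zero_iff _ (tilde 𝔨 h).injective).1 h1
  invariant Z := by
    have h1 := P.thetaHom_adp_eq_zero hδ Z
    rw [hγ, thetaHom_pull_eq_zero] at h1
    have h2 : (Br.act (tilde 𝔨 h) μ).adp Z =
        (h : 𝔭 →L[ℝ] 𝔭) ∘L μ.adp Z ∘L (h.symm : 𝔭 →L[ℝ] 𝔭) := by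
      ext X
      have h3 : h (μ (Z, h.symm 0) (0, h.symm X)).2 = h (μ (Z, 0) (0, h.symm X)).2 := by
        rw [map_zero]
      exact h3
    rw [← h2] at h1
    exact h1
  mem_dom R := by
    obtain ⟨ε, hε, hεγ, -⟩ := exists_isInvariantExtension hd hδ hγ R
    exact ⟨ε, hε, hεγ⟩

end GeometricFlow

end Operators

/-! ### Differential equations for brackets -/

section Uniqueness

/-- Grönwall's inequality in both directions of time. -/
theorem eq_zero_of_norm_deriv_le {E : Type*} [NormedAddCommGroup E] [NormedSpace ℝ E]
    {f f' : ℝ → E} {K ε t₀ : ℝ} (hf : ∀ t ∈ ball t₀ ε, HasDerivAt f (f' t) t) (h0 : f t₀ = 0)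
    (hK : ∀ t ∈ ball t₀ ε, ‖f' t‖ ≤ K * ‖f t‖) {t : ℝ} (ht : t ∈ ball t₀ ε) : f t = 0 := by
  have ht₀ : t₀ ∈ ball t₀ ε := mem_ball_self (pos_of_mem_ball ht)
  have hc : (ball t₀ ε).OrdConnected := (convex_ball t₀ ε).ordConnected
  rcases le_total t₀ t with h | h
  · have hs : Icc t₀ t ⊆ ball t₀ ε := hc.out ht₀ ht
    exact eq_zero_of_abs_deriv_le_mul_abs_self_of_eq_zero_right
      (fun s hs' => (hf s (hs hs')).continuousAt.continuousWithinAt)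
      (fun s hs' => (hf s (hs (Ico_subset_Icc_self hs'))).hasDerivWithinAt) h0
      (fun s hs' => hK s (hs (Ico_subset_Icc_self hs'))) t (right_mem_Icc.2 h)
  · have hs : ∀ s ∈ Icc (-t₀) (-t), -s ∈ ball t₀ ε := fun s hs =>
      hc.out ht ht₀ ⟨by linarith [hs.2], by linarith [hs.1]⟩
    have hd : ∀ s ∈ Icc (-t₀) (-t), HasDerivAt (fun s => f (-s)) (-f' (-s)) s := fun s hs' => by
      have h1 := (hf (-s) (hs s hs')).scomp s (hasDerivAt_neg s)
      rw [neg_one_smul] at h1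
      exact h1
    have h1 := eq_zero_of_abs_deriv_le_mul_abs_self_of_eq_zero_right (f := fun s => f (-s))
      (fun s hs' => (hd s hs').continuousAt.continuousWithinAt)
      (fun s hs' => (hd s (Ico_subset_Icc_self hs')).hasDerivWithinAt) (by simpa using h0)
      (fun s hs' => by simpa using hK (-s) (hs s (Ico_subset_Icc_self hs'))) (-t)
      (right_mem_Icc.2 (by linarith))
    simpa using h1

/-- Two curves that agree near each point where they are equal agree on an interval, if they are
equal at one point of it: the set of equality is open and closed. -/
theorem eqOn_of_eventuallyEq {E : Type*} [TopologicalSpace E] [T2Space E] {J : Set ℝ}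
    (hJ : J.OrdConnected) {f g : ℝ → E} (hf : ∀ t ∈ J, ContinuousAt f t)
    (hg : ∀ t ∈ J, ContinuousAt g t) {t₀ : ℝ} (ht₀ : t₀ ∈ J) (h0 : f t₀ = g t₀)
    (hloc : ∀ t ∈ J, f t = g t → f =ᶠ[𝓝 t] g) : ∀ t ∈ J, f t = g t := by
  have hu : IsOpen {t | f =ᶠ[𝓝 t] g} := isOpen_setOfPred_eventually_nhds
  have h1 : J ⊆ {t | f =ᶠ[𝓝 t] g} := by
    refine hJ.isPreconnected.subset_of_closure_inter_subset hu ⟨t₀, ht₀, hloc t₀ ht₀ h0⟩ ?_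
    rintro t ⟨ht, htJ⟩
    refine hloc t htJ ?_
    have h2 : (𝓝[{t | f =ᶠ[𝓝 t] g}] t).NeBot := mem_closure_iff_nhdsWithin_neBot.1 ht
    refine tendsto_nhds_unique_of_eventuallyEq (l := 𝓝[{t | f =ᶠ[𝓝 t] g}] t) ((hf t htJ).tendsto.mono_left nhdsWithin_le_nhds)
      ((hg t htJ).tendsto.mono_left nhdsWithin_le_nhds) ?_
    filter_upwards [self_mem_nhdsWithin] with s hs
    exact hs.self_of_nhds
  exact fun t ht => (h1 ht).self_of_nhds

end Uniqueness

section BracketCalculus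

variable {𝔨 𝔭 : Type*} [NormedAddCommGroup 𝔨] [NormedSpace ℝ 𝔨]
  [NormedAddCommGroup 𝔭] [NormedSpace ℝ 𝔭]

theorem Br.delta_sub_delta (μ₁ μ₂ : Br 𝔨 𝔭) (A₁ A₂ : (𝔨 × 𝔭) →L[ℝ] (𝔨 × 𝔭)) :
    μ₁.delta A₁ - μ₂.delta A₂ = (μ₁ - μ₂).delta A₁ + μ₂.delta (A₁ - A₂) := by
  refine ContinuousLinearMap.ext fun X => ContinuousLinearMap.ext fun Y => ?_
  simp only [sub_apply, add_apply, Br.delta_apply, map_sub]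
  abel

theorem Br.norm_delta_le (μ : Br 𝔨 𝔭) (A : (𝔨 × 𝔭) →L[ℝ] (𝔨 × 𝔭)) :
    ‖μ.delta A‖ ≤ 3 * ‖μ‖ * ‖A‖ := by
  refine ContinuousLinearMap.opNorm_le_bound₂ _ (by positivity) fun X Y => ?_
  rw [Br.delta_apply]
  have h1 : ‖μ (A X) Y‖ ≤ ‖μ‖ * (‖A‖ * ‖X‖) * ‖Y‖ := (μ.le_opNorm₂ _ _).trans (by
    gcongr
    exact A.le_opNorm X)
  have h2 : ‖μ X (A Y)‖ ≤ ‖μ‖ * ‖X‖ * (‖A‖ * ‖Y‖) := (μ.le_opNorm₂ _ _).trans (by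
    gcongr
    exact A.le_opNorm Y)
  have h3 : ‖A (μ X Y)‖ ≤ ‖A‖ * (‖μ‖ * ‖X‖ * ‖Y‖) := (A.le_opNorm _).trans (by
    gcongr
    exact μ.le_opNorm₂ _ _)
  calc ‖μ (A X) Y + μ X (A Y) - A (μ X Y)‖ ≤ ‖μ (A X) Y‖ + ‖μ X (A Y)‖ + ‖A (μ X Y)‖ :=
        (norm_sub_le _ _).trans (by gcongr; exact norm_add_le _ _)
    _ ≤ ‖μ‖ * (‖A‖ * ‖X‖) * ‖Y‖ + ‖μ‖ * ‖X‖ * (‖A‖ * ‖Y‖) + ‖A‖ * (‖μ‖ * ‖X‖ * ‖Y‖) := by gcongr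
    _ = 3 * ‖μ‖ * ‖A‖ * ‖X‖ * ‖Y‖ := by ring

theorem diagZero_sub (Q₁ Q₂ : 𝔭 →L[ℝ] 𝔭) :
    diagZero 𝔨 Q₁ - diagZero 𝔨 Q₂ = diagZero 𝔨 (Q₁ - Q₂) := by
  ext X <;> simp [diagZero]

theorem norm_diagZero_le (Q : 𝔭 →L[ℝ] 𝔭) : ‖diagZero 𝔨 Q‖ ≤ ‖Q‖ := by
  refine ContinuousLinearMap.opNorm_le_bound _ (norm_nonneg _) fun X => ?_
  have h1 : diagZero 𝔨 Q X = (0, Q X.2) := rfl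
  rw [h1, Prod.norm_mk, norm_zero]
  refine max_le (by positivity) ((Q.le_opNorm _).trans ?_)
  gcongr
  exact norm_snd_le X

/-- On a finite-dimensional space, curves of linear maps may be differentiated pointwise. -/
theorem hasDerivAt_clm_of_apply {E F : Type*} [NormedAddCommGroup E] [NormedSpace ℝ E]
    [FiniteDimensional ℝ E] [NormedAddCommGroup F] [NormedSpace ℝ F] {c : ℝ → E →L[ℝ] F}
    {c' : E →L[ℝ] F} {t : ℝ} (h : ∀ x, HasDerivAt (fun τ => c τ x) (c' x) t) :
    HasDerivAt c c' t := by
  let b := Module.finBasis ℝ E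
  have h1 : ∀ L : E →L[ℝ] F, L = ∑ j, ContinuousLinearMap.smulRightL ℝ E F
      (LinearMap.toContinuousLinearMap (b.coord j)) (L (b j)) := by
    intro L
    ext x
    conv_lhs => rw [← b.sum_repr x, map_sum]
    rw [sum_apply]
    refine Finset.sum_congr rfl fun j _ => ?_
    rw [map_smul]
    rfl
  have h2 : c = fun τ => ∑ j, ContinuousLinearMap.smulRightL ℝ E F
      (LinearMap.toContinuousLinearMap (b.coord j)) (c τ (b j)) := funext fun τ => h1 (c τ)
  rw [h2, h1 c']
  exact HasDerivAt.fun_sum fun j _ =>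
    (ContinuousLinearMap.hasFDerivAt _).comp_hasDerivAt t (h (b j))

variable [FiniteDimensional ℝ 𝔨] [FiniteDimensional ℝ 𝔭]

/-- The derivative of the curve `h̃(t) · μ(t)` if `h' = -A h`. -/
theorem hasDerivAt_act {h : ℝ → 𝔭 ≃L[ℝ] 𝔭} {A : 𝔭 →L[ℝ] 𝔭} {μ : ℝ → Br 𝔨 𝔭} {μ' : Br 𝔨 𝔭} {t : ℝ}
    (hh : HasDerivAt (fun τ => (h τ : 𝔭 →L[ℝ] 𝔭)) (-(A ∘L (h t : 𝔭 →L[ℝ] 𝔭))) t)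
    (hμ : HasDerivAt μ μ' t) :
    HasDerivAt (fun τ => Br.act (tilde 𝔨 (h τ)) (μ τ))
      (Br.act (tilde 𝔨 (h t)) μ' + (Br.act (tilde 𝔨 (h t)) (μ t)).delta (diagZero 𝔨 A)) t := by
  have : CompleteSpace (𝔨 × 𝔭) := FiniteDimensional.complete ℝ _
  have h1 : HasDerivAt (fun τ => (tilde 𝔨 (h τ) : (𝔨 × 𝔭) →L[ℝ] (𝔨 × 𝔭)))
      (-(diagZero 𝔨 A ∘L (tilde 𝔨 (h t) : (𝔨 × 𝔭) →L[ℝ] (𝔨 × 𝔭)))) t := by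
    refine hasDerivAt_clm_of_apply fun X => ?_
    have h2 := (hasDerivAt_const t X.1).prodMk (hh.clm_apply (hasDerivAt_const t X.2))
    refine h2.congr_deriv ?_
    rw [map_zero, add_zero]
    exact Prod.ext neg_zero.symm rfl
  have h2 : HasDerivAt (fun τ => ((tilde 𝔨 (h τ)).symm : (𝔨 × 𝔭) →L[ℝ] (𝔨 × 𝔭)))
      (((tilde 𝔨 (h t)).symm : (𝔨 × 𝔭) →L[ℝ] (𝔨 × 𝔭)) ∘L diagZero 𝔨 A) t := by
    refine (hasDerivAt_symm h1).congr_deriv ?_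
    refine ContinuousLinearMap.ext fun X => ?_
    simp
  refine hasDerivAt_clm_of_apply fun X => hasDerivAt_clm_of_apply fun Y => ?_
  have h3 := fun X => h2.clm_apply (hasDerivAt_const t X)
  have h4 := HasDerivAt.clm_apply (F := 𝔨 × 𝔭) (G := (𝔨 × 𝔭) →L[ℝ] (𝔨 × 𝔭)) hμ (h3 X)
  refine (h1.clm_apply (h4.clm_apply (h3 Y))).congr_deriv ?_
  simp only [add_apply, Br.delta_apply, Br.act_apply, map_add, neg_apply,
    ContinuousLinearMap.comp_apply, ContinuousLinearEquiv.coe_coe, map_zero, add_zero]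
  abel

/-- A curve of brackets with `μ' = δ_μ(diag(0, Q))` is `h̃(t) · μ(0)` if `h' = -Q h`. -/
theorem act_tilde_eq_of_hasDerivAt {J : Set ℝ} (hJ : IsOpen J) (hJ' : J.OrdConnected)
    (h0 : (0 : ℝ) ∈ J) {Q : ℝ → 𝔭 →L[ℝ] 𝔭} {h : ℝ → 𝔭 ≃L[ℝ] 𝔭} {μ : ℝ → Br 𝔨 𝔭}
    (hh0 : h 0 = ContinuousLinearEquiv.refl ℝ 𝔭)
    (hh : ∀ t ∈ J, HasDerivAt (fun τ => (h τ : 𝔭 →L[ℝ] 𝔭)) (-(Q t ∘L (h t : 𝔭 →L[ℝ] 𝔭))) t)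
    (hμ : ∀ t ∈ J, HasDerivAt μ ((μ t).delta (diagZero 𝔨 (Q t))) t) {t : ℝ} (ht : t ∈ J) :
    μ t = Br.act (tilde 𝔨 (h t)) (μ 0) := by
  have : CompleteSpace 𝔭 := FiniteDimensional.complete ℝ _
  -- `h̃(t)⁻¹ · μ(t)` is constant
  have hd : ∀ t ∈ J, HasDerivAt (fun τ => Br.act (tilde 𝔨 (h τ).symm) (μ τ)) 0 t := by
    intro t ht
    have h1 : HasDerivAt (fun τ => ((h τ).symm : 𝔭 →L[ℝ] 𝔭))
        (-((-(((h t).symm : 𝔭 →L[ℝ] 𝔭) ∘L Q t ∘L (h t : 𝔭 →L[ℝ] 𝔭))) ∘L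
          ((h t).symm : 𝔭 →L[ℝ] 𝔭))) t := by
      refine (hasDerivAt_symm (hh t ht)).congr_deriv ?_
      ext x
      simp
    have h4 := hasDerivAt_act h1 (hμ t ht)
    have h2 : ∀ X, (tilde 𝔨 (h t).symm).symm
        (diagZero 𝔨 (-(((h t).symm : 𝔭 →L[ℝ] 𝔭) ∘L Q t ∘L (h t : 𝔭 →L[ℝ] 𝔭))) X) =
        - diagZero 𝔨 (Q t) ((tilde 𝔨 (h t).symm).symm X) := fun X => by
      simp [diagZero, tilde]
    have h3 : ∀ X, diagZero 𝔨 (-(((h t).symm : 𝔭 →L[ℝ] 𝔭) ∘L Q t ∘L (h t : 𝔭 →L[ℝ] 𝔭)))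
        (tilde 𝔨 (h t).symm X) = - tilde 𝔨 (h t).symm (diagZero 𝔨 (Q t) X) := fun X => by
      simp [diagZero, tilde]
    have h5 : Br.act (tilde 𝔨 (h t).symm) ((μ t).delta (diagZero 𝔨 (Q t))) +
        (Br.act (tilde 𝔨 (h t).symm) (μ t)).delta (diagZero 𝔨
          (-(((h t).symm : 𝔭 →L[ℝ] 𝔭) ∘L Q t ∘L (h t : 𝔭 →L[ℝ] 𝔭)))) = 0 := by
      refine ContinuousLinearMap.ext fun X => ContinuousLinearMap.ext fun Y => ?_
      simp only [add_apply, Br.delta_apply, Br.act_apply, h2, h3, map_add, map_sub, map_neg,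
        neg_apply, zero_apply]
      abel
    rw [h5] at h4
    exact h4
  have h1 := eq_of_hasDerivAt_zero (W := Br 𝔨 𝔭) hJ hJ' hd ht h0
  rw [hh0] at h1
  have h2 : Br.act (tilde 𝔨 (h t).symm) (μ t) = μ 0 := h1.trans (Br.act_tilde_refl (μ 0))
  have h3 := Br.act_tilde_symm (h t).symm (μ t)
  rw [h2] at h3
  exact h3.symm

end BracketCalculus

section BracketFlowUniqueness

variable {𝔨 𝔭 : Type*} [NormedAddCommGroup 𝔨] [NormedSpace ℝ 𝔨] [FiniteDimensional ℝ 𝔨]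
  [NormedAddCommGroup 𝔭] [NormedSpace ℝ 𝔭] [FiniteDimensional ℝ 𝔭]
  {ι : Type} {r s : ι → ℕ} {γ : Tensors r s 𝔭} {qγ : Submodule ℝ (𝔭 →L[ℝ] 𝔭)}

namespace GeometricFlow

variable {F : GeometricFlow.{u} γ}

/-- Solutions of the bracket flow are unique. -/
theorem IsBracketFlow.eqOn (hF : F.LocallyLipschitz 𝔨 qγ) {μ₀ : Br 𝔨 𝔭} {J : Set ℝ}
    (hJ : IsOpen J) (hJ' : J.OrdConnected) (h0 : (0 : ℝ) ∈ J) {μ ν : ℝ → Br 𝔨 𝔭}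
    (hμ : F.IsBracketFlow qγ μ₀ J μ) (hν : F.IsBracketFlow qγ μ₀ J ν) :
    ∀ t ∈ J, μ t = ν t := by
  have hμc : ∀ t ∈ J, ContinuousAt μ t := fun t ht => by
    obtain ⟨-, Q, -, h⟩ := hμ.2 t ht
    exact HasDerivAt.continuousAt (F := Br 𝔨 𝔭) h
  have hνc : ∀ t ∈ J, ContinuousAt ν t := fun t ht => by
    obtain ⟨-, Q, -, h⟩ := hν.2 t ht
    exact HasDerivAt.continuousAt (F := Br 𝔨 𝔭) h
  refine eqOn_of_eventuallyEq hJ' hμc hνc h0 (hμ.1.trans hν.1.symm) fun t₀ ht₀ he => ?_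
  obtain ⟨hadm, Q₀, hQ₀, -⟩ := hμ.2 t₀ ht₀
  obtain ⟨C, U, hU, hL⟩ := hF (μ t₀) hadm
  have hev : ∀ᶠ t in 𝓝 t₀, t ∈ J ∧ μ t ∈ U ∧ ν t ∈ U ∧ μ t ∈ ball (μ t₀) 1 ∧ ν t ∈ ball (μ t₀) 1 := by
    have h1 := hμc t₀ ht₀
    have h2 := hνc t₀ ht₀
    rw [ContinuousAt, ← he] at h2
    have hb := ball_mem_nhds (μ t₀) one_pos
    filter_upwards [hJ.mem_nhds ht₀, h1 hU, h2 hU, h1 hb, h2 hb] with t h3 h4 h5 h6 h7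
    exact ⟨h3, h4, h5, h6, h7⟩
  obtain ⟨ε, hε, hb⟩ := Metric.eventually_nhds_iff_ball.1 hev
  have hex : ∀ t, ∃ Q Q' : 𝔭 →L[ℝ] 𝔭, t ∈ J → F.IsBracketOperator qγ (μ t) Q ∧
      F.IsBracketOperator qγ (ν t) Q' ∧ HasDerivAt μ ((μ t).delta (diagZero 𝔨 Q)) t ∧
      HasDerivAt ν ((ν t).delta (diagZero 𝔨 Q')) t := by
    intro t
    by_cases ht : t ∈ J
    · obtain ⟨-, Q, h1, h2⟩ := hμ.2 t ht
      obtain ⟨-, Q', h3, h4⟩ := hν.2 t ht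
      exact ⟨Q, Q', fun _ => ⟨h1, h3, h2, h4⟩⟩
    · exact ⟨0, 0, fun h => absurd h ht⟩
  choose Q Q' hQ using hex
  -- `K` comes from `‖Q_{μ(t)}‖ ≤ ‖Q₀‖ + |C|`, `‖ν(t)‖ ≤ ‖μ(t₀)‖ + 1` and the Lipschitz constant
  -- `|C|` of the operators
  have hzero : ∀ t ∈ ball t₀ ε, (fun t => μ t - ν t) t = 0 := fun t ht => by
    refine eq_zero_of_norm_deriv_le (E := Br 𝔨 𝔭) (f := fun t => μ t - ν t)
      (f' := fun t => (μ t).delta (diagZero 𝔨 (Q t)) - (ν t).delta (diagZero 𝔨 (Q' t)))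
      (K := 3 * (‖Q₀‖ + |C|) + 3 * (‖μ t₀‖ + 1) * |C|)
      (fun t ht => HasDerivAt.sub (F := Br 𝔨 𝔭) (hQ t (hb t ht).1).2.2.1
        (hQ t (hb t ht).1).2.2.2) (sub_eq_zero.2 he) ?_ ht
    intro t ht
    obtain ⟨htJ, h1, h2, h3, h4⟩ := hb t ht
    obtain ⟨hQ1, hQ2, -, -⟩ := hQ t htJ
    have h5 : ‖Q t - Q₀‖ ≤ |C| := by
      refine (hL _ h1 _ (mem_of_mem_nhds hU) (hμ.2 t htJ).1 hadm _ _ hQ1 hQ₀).trans ?_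
      have h9 : ‖μ t - μ t₀‖ < 1 := (mem_ball_iff_norm (E := Br 𝔨 𝔭)).1 h3
      exact (mul_le_mul (le_abs_self C) h9.le (norm_nonneg (E := Br 𝔨 𝔭) _) (abs_nonneg C)).trans
        (mul_one _).le
    have h6 : ‖Q t‖ ≤ ‖Q₀‖ + |C| := by
      have h9 := norm_le_norm_add_norm_sub' (Q t) Q₀
      linarith
    have h7 : ‖Q t - Q' t‖ ≤ |C| * ‖μ t - ν t‖ :=
      (hL _ h1 _ h2 (hμ.2 t htJ).1 (hν.2 t htJ).1 _ _ hQ1 hQ2).trans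
        (mul_le_mul_of_nonneg_right (le_abs_self C) (norm_nonneg (E := Br 𝔨 𝔭) _))
    have h8 : ‖ν t‖ ≤ ‖μ t₀‖ + 1 := by
      have h9 : ‖ν t - μ t₀‖ < 1 := (mem_ball_iff_norm (E := Br 𝔨 𝔭)).1 h4
      have h10 : ‖ν t‖ ≤ ‖μ t₀‖ + ‖ν t - μ t₀‖ := norm_le_norm_add_norm_sub' (E := Br 𝔨 𝔭) _ _
      linarith
    rw [Br.delta_sub_delta, diagZero_sub]
    calc ‖(μ t - ν t).delta (diagZero 𝔨 (Q t)) + (ν t).delta (diagZero 𝔨 (Q t - Q' t))‖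
        ≤ 3 * ‖μ t - ν t‖ * ‖diagZero 𝔨 (Q t)‖ + 3 * ‖ν t‖ * ‖diagZero 𝔨 (Q t - Q' t)‖ :=
          (norm_add_le (E := Br 𝔨 𝔭) _ _).trans (add_le_add (Br.norm_delta_le _ _) (Br.norm_delta_le _ _))
      _ ≤ 3 * ‖μ t - ν t‖ * (‖Q₀‖ + |C|) + 3 * (‖μ t₀‖ + 1) * (|C| * ‖μ t - ν t‖) := by
          gcongr
          · exact (norm_diagZero_le _).trans h6
          · exact (norm_diagZero_le _).trans h7
      _ = (3 * (‖Q₀‖ + |C|) + 3 * (‖μ t₀‖ + 1) * |C|) * ‖μ t - ν t‖ := by ring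
  filter_upwards [ball_mem_nhds t₀ hε] with t ht
  exact sub_eq_zero.1 (hzero t ht)

/-- The operators `Q_{μ(t)}` are continuous along a solution of the bracket flow. -/
theorem IsBracketFlow.continuousOn_operator (hF : F.LocallyLipschitz 𝔨 qγ) {μ₀ : Br 𝔨 𝔭}
    {J : Set ℝ} {μ : ℝ → Br 𝔨 𝔭} (hμ : F.IsBracketFlow qγ μ₀ J μ) {Q : ℝ → 𝔭 →L[ℝ] 𝔭}
    (hQ : ∀ t ∈ J, F.IsBracketOperator qγ (μ t) (Q t)) : ContinuousOn Q J := by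
  intro t₀ ht₀
  obtain ⟨hadm, Q₀, -, hd⟩ := hμ.2 t₀ ht₀
  obtain ⟨C, U, hU, hL⟩ := hF (μ t₀) hadm
  have hd' : ContinuousAt μ t₀ := HasDerivAt.continuousAt (F := Br 𝔨 𝔭) hd
  have hc : ContinuousWithinAt μ J t₀ := hd'.continuousWithinAt
  rw [ContinuousWithinAt, tendsto_iff_norm_sub_tendsto_zero]
  have h1 := ((tendsto_iff_norm_sub_tendsto_zero (E := Br 𝔨 𝔭)).1 hc).const_mul C
  rw [mul_zero] at h1
  refine squeeze_zero' (Eventually.of_forall fun t => norm_nonneg _) ?_ h1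
  have h2 : ∀ᶠ t in 𝓝[J] t₀, μ t ∈ U := hd'.continuousWithinAt hU
  filter_upwards [h2, self_mem_nhdsWithin] with t ht htJ
  exact hL _ ht _ (mem_of_mem_nhds hU) (hμ.2 t htJ).1 hadm _ _ (hQ t htJ) (hQ t₀ ht₀)

end GeometricFlow

end BracketFlowUniqueness

/-! ### Invariant solutions and bracket flow solutions -/

section Solutions

variable {𝔨 𝔭 : Type*} [NormedAddCommGroup 𝔨] [NormedSpace ℝ 𝔨] [FiniteDimensional ℝ 𝔨]
  [NormedAddCommGroup 𝔭] [NormedSpace ℝ 𝔭] [FiniteDimensional ℝ 𝔭]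
  {ι : Type} {r s : ι → ℕ} {γ : Tensors r s 𝔭} {qγ : Submodule ℝ (𝔭 →L[ℝ] 𝔭)}
  {F : GeometricFlow.{u} γ} {lie : Br 𝔨 𝔭} {P : HomogeneousSpace.{u} lie} {J : Set ℝ}

namespace GeometricFlow

theorem IsInvariantSolution.hasDerivAt_atOrigin {Γ : ℝ → TensorField r s 𝔭 P.space}
    (hΓ : F.IsInvariantSolution P J Γ) {t : ℝ} (ht : t ∈ J) (i : ι) (w : Fin (r i) → 𝔭)
    (α : Fin (s i) → Module.Dual ℝ 𝔭) :
    HasDerivAt (fun τ => P.atOrigin (Γ τ) i w α) (P.atOrigin (F.q P.space (Γ t)) i w α) t :=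
  hΓ.hasDerivAt t ht P.origin i _ _

theorem IsInvariantSolution.continuousOn_atOrigin {Γ : ℝ → TensorField r s 𝔭 P.space}
    (hΓ : F.IsInvariantSolution P J Γ) (i : ι) (w : Fin (r i) → 𝔭)
    (α : Fin (s i) → Module.Dual ℝ 𝔭) :
    ContinuousOn (fun τ => P.atOrigin (F.q P.space (Γ τ)) i w α) J :=
  hΓ.continuousOn P.origin i _ _

/-- For an invariant solution, the equation `h' = -hQ(t)` is solvable on all of `J`, because it is
linear with continuous coefficients. -/
theorem IsInvariantSolution.exists_solvesI [Finite ι] (hqγ : IsInvariantComplement γ qγ)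
    (hJ : IsOpen J) (hJ' : J.OrdConnected) (h0 : (0 : ℝ) ∈ J) {Γ : ℝ → TensorField r s 𝔭 P.space}
    (hΓ : F.IsInvariantSolution P J Γ) : ∃ h : ℝ → 𝔭 ≃L[ℝ] 𝔭, F.SolvesI qγ P J Γ h := by
  obtain ⟨Q, hQc, hQ⟩ := hqγ.exists_continuousOn_operator hJ (γ := fun t => P.atOrigin (Γ t))
    (q := fun t => P.atOrigin (F.q P.space (Γ t)))
    (fun t ht => P.exists_atOrigin_eq_pull F (hΓ.mem_dom t ht))
    (fun t ht i w α => hΓ.hasDerivAt_atOrigin ht i w α) hΓ.continuousOn_atOrigin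
    (fun t ht => P.exists_thetaHom_eq_atOrigin F (hΓ.mem_dom t ht))
  obtain ⟨h, hh0, hh⟩ := exists_linear_solution_GL hJ hJ' h0 Q hQc
  exact ⟨h, hh0, fun t ht => ⟨Q t, (hQ t ht).1, (hQ t ht).2, hh t ht⟩⟩

/-- If `h` solves `h' = -hQ(t)`, then `γ(t) = h(t)^* γ`. -/
theorem SolvesI.atOrigin_eq (hJ : IsOpen J) (hJ' : J.OrdConnected) (h0 : (0 : ℝ) ∈ J)
    {Γ : ℝ → TensorField r s 𝔭 P.space} (hΓ : F.IsInvariantSolution P J Γ)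
    {h : ℝ → 𝔭 ≃L[ℝ] 𝔭} (hh : F.SolvesI qγ P J Γ h) {t : ℝ} (ht : t ∈ J) :
    P.atOrigin (Γ t) = pull (h t : 𝔭 →L[ℝ] 𝔭) γ := by
  have hex : ∀ t, ∃ Q : 𝔭 →L[ℝ] 𝔭, t ∈ J →
      thetaHom (P.atOrigin (Γ t)) Q = P.atOrigin (F.q P.space (Γ t)) ∧
      HasDerivAt (fun τ => (h τ : 𝔭 →L[ℝ] 𝔭)) (-((h t : 𝔭 →L[ℝ] 𝔭) ∘L Q)) t := by
    intro t
    by_cases ht : t ∈ J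
    · obtain ⟨Q, -, h1, h2⟩ := hh.2 t ht
      exact ⟨Q, fun _ => ⟨h1, h2⟩⟩
    · exact ⟨0, fun h => absurd h ht⟩
  choose Q hQ using hex
  have h1 := pull_symm_eq_of_hasDerivAt hJ hJ' (γ := fun t => P.atOrigin (Γ t))
    (fun t ht => (hQ t ht).2)
    (fun t ht i w α => by
      rw [(hQ t ht).1]
      exact hΓ.hasDerivAt_atOrigin ht i w α) h0 ht
  simp only [hΓ.initial, hh.1] at h1
  have h2 : pull ((h t).symm : 𝔭 →L[ℝ] 𝔭) (P.atOrigin (Γ t)) = γ := h1.trans (pull_refl γ)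
  exact (pull_pull_symm (h t) _).symm.trans (congrArg (pull (h t : 𝔭 →L[ℝ] 𝔭)) h2)

/-- If `h` solves `h' = -hQ(t)`, then `h Q(t) h⁻¹` is the operator `Q_μ` of `μ = h̃ · [·,·]`. -/
theorem SolvesI.exists_isBracketOperator (hqγ : IsInvariantComplement γ qγ) (hJ : IsOpen J)
    (hJ' : J.OrdConnected) (h0 : (0 : ℝ) ∈ J) {Γ : ℝ → TensorField r s 𝔭 P.space}
    (hΓ : F.IsInvariantSolution P J Γ) {h : ℝ → 𝔭 ≃L[ℝ] 𝔭} (hh : F.SolvesI qγ P J Γ h) {t : ℝ}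
    (ht : t ∈ J) : ∃ Q : 𝔭 →L[ℝ] 𝔭, F.IsBracketOperator qγ (Br.act (tilde 𝔨 (h t)) lie) Q ∧
      HasDerivAt (fun τ => (h τ : 𝔭 →L[ℝ] 𝔭)) (-(Q ∘L (h t : 𝔭 →L[ℝ] 𝔭))) t := by
  obtain ⟨Q, h1, h2, h3⟩ := hh.2 t ht
  refine ⟨_, (isBracketOperator_act_iff hqγ (hΓ.mem_dom t ht) (hΓ.invariant t ht)
    (hh.atOrigin_eq hJ hJ' h0 hΓ ht) Q).2 ⟨h1, h2⟩, h3.congr_deriv ?_⟩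
  ext x
  simp

/-- If `h` solves `h' = -hQ(t)` for an invariant solution, then `h̃(t) · [·,·]` is a solution of the
bracket flow. -/
theorem SolvesI.isBracketFlow (hqγ : IsInvariantComplement γ qγ) (hlie : F.Admissible lie)
    (hJ : IsOpen J) (hJ' : J.OrdConnected) (h0 : (0 : ℝ) ∈ J)
    {Γ : ℝ → TensorField r s 𝔭 P.space} (hΓ : F.IsInvariantSolution P J Γ)
    {h : ℝ → 𝔭 ≃L[ℝ] 𝔭} (hh : F.SolvesI qγ P J Γ h) :
    F.IsBracketFlow qγ lie J (fun t => Br.act (tilde 𝔨 (h t)) lie) := by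
  refine ⟨?_, fun t ht => ⟨hlie.act (hΓ.mem_dom t ht) (hΓ.invariant t ht)
    (hh.atOrigin_eq hJ hJ' h0 hΓ ht), ?_⟩⟩
  · change Br.act (tilde 𝔨 (h 0)) lie = lie
    rw [hh.1, Br.act_tilde_refl]
  · obtain ⟨Q, hQ, hd⟩ := hh.exists_isBracketOperator hqγ hJ hJ' h0 hΓ ht
    refine ⟨Q, hQ, ?_⟩
    have h1 := hasDerivAt_act (μ := fun _ => lie) hd (hasDerivAt_const t lie)
    have h2 : ∀ ν : Br 𝔨 𝔭, Br.act (tilde 𝔨 (h t)) (0 : Br 𝔨 𝔭) + ν = ν := fun ν =>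
      ContinuousLinearMap.ext fun X => ContinuousLinearMap.ext fun Y =>
        (congrArg (· + ν X Y) (map_zero (tilde 𝔨 (h t)))).trans (zero_add _)
    rw [h2] at h1
    exact h1

/-- For a bracket flow solution, the linear equation `h' = -Q_{μ(t)} h` is solvable on all of
`J`. -/
theorem IsBracketFlow.exists_solvesII (hF : F.LocallyLipschitz 𝔨 qγ) (hJ : IsOpen J)
    (hJ' : J.OrdConnected) (h0 : (0 : ℝ) ∈ J) {μ : ℝ → Br 𝔨 𝔭}
    (hμ : F.IsBracketFlow qγ lie J μ) : ∃ h : ℝ → 𝔭 ≃L[ℝ] 𝔭, F.SolvesII qγ J μ h := by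
  have : CompleteSpace 𝔭 := FiniteDimensional.complete ℝ 𝔭
  have hex : ∀ t, ∃ Q : 𝔭 →L[ℝ] 𝔭, t ∈ J → F.IsBracketOperator qγ (μ t) Q := by
    intro t
    by_cases ht : t ∈ J
    · obtain ⟨-, Q, h1, -⟩ := hμ.2 t ht
      exact ⟨Q, fun _ => h1⟩
    · exact ⟨0, fun h => absurd h ht⟩
  choose Q hQ using hex
  -- the inverse of `h` solves `k' = kQ`
  obtain ⟨k, hk0, hk⟩ := exists_linear_solution_GL hJ hJ' h0 (fun t => -Q t)
    (hμ.continuousOn_operator hF hQ).neg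
  refine ⟨fun t => (k t).symm, congrArg ContinuousLinearEquiv.symm hk0, fun t ht => ⟨Q t, hQ t ht, ?_⟩⟩
  refine (hasDerivAt_symm (hk t ht)).congr_deriv ?_
  ext x
  simp

/-- The operators in the bracket flow equation and in the equation for `h` agree. -/
theorem SolvesII.exists_operator (hqγ : IsInvariantComplement γ qγ) {μ : ℝ → Br 𝔨 𝔭}
    (hμ : F.IsBracketFlow qγ lie J μ) {h : ℝ → 𝔭 ≃L[ℝ] 𝔭} (hh : F.SolvesII qγ J μ h) :
    ∃ Q : ℝ → 𝔭 →L[ℝ] 𝔭, ∀ t ∈ J, F.IsBracketOperator qγ (μ t) (Q t) ∧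
      HasDerivAt (fun τ => (h τ : 𝔭 →L[ℝ] 𝔭)) (-(Q t ∘L (h t : 𝔭 →L[ℝ] 𝔭))) t ∧
      HasDerivAt μ ((μ t).delta (diagZero 𝔨 (Q t))) t := by
  have hex : ∀ t, ∃ Q : 𝔭 →L[ℝ] 𝔭, t ∈ J → F.IsBracketOperator qγ (μ t) Q ∧
      HasDerivAt (fun τ => (h τ : 𝔭 →L[ℝ] 𝔭)) (-(Q ∘L (h t : 𝔭 →L[ℝ] 𝔭))) t ∧
      HasDerivAt μ ((μ t).delta (diagZero 𝔨 Q)) t := by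
    intro t
    by_cases ht : t ∈ J
    · obtain ⟨hadm, Q, h1, h2⟩ := hμ.2 t ht
      obtain ⟨Q', h3, h4⟩ := hh.2 t ht
      rw [h3.unique hqγ hadm h1] at h4
      exact ⟨Q, fun _ => ⟨h1, h4, h2⟩⟩
    · exact ⟨0, fun h => absurd h ht⟩
  choose Q hQ using hex
  exact ⟨Q, hQ⟩

/-- If `h` solves `h' = -Q_{μ(t)} h`, then `μ(t) = h̃(t) · [·,·]`. -/
theorem SolvesII.eq_act (hqγ : IsInvariantComplement γ qγ) (hJ : IsOpen J) (hJ' : J.OrdConnected)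
    (h0 : (0 : ℝ) ∈ J) {μ : ℝ → Br 𝔨 𝔭} (hμ : F.IsBracketFlow qγ lie J μ) {h : ℝ → 𝔭 ≃L[ℝ] 𝔭}
    (hh : F.SolvesII qγ J μ h) {t : ℝ} (ht : t ∈ J) : μ t = Br.act (tilde 𝔨 (h t)) lie := by
  obtain ⟨Q, hQ⟩ := hh.exists_operator hqγ hμ
  rw [← hμ.1]
  exact act_tilde_eq_of_hasDerivAt hJ hJ' h0 hh.1 (fun t ht => (hQ t ht).2.1)
    (fun t ht => (hQ t ht).2.2) ht

/-- The equation `h' = -Q_{μ(t)} h` determines `h` on `J`. -/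
theorem SolvesII.eqOn (hqγ : IsInvariantComplement γ qγ) (hJ : IsOpen J) (hJ' : J.OrdConnected)
    (h0 : (0 : ℝ) ∈ J) {μ : ℝ → Br 𝔨 𝔭} (hμ : F.IsBracketFlow qγ lie J μ)
    {h k : ℝ → 𝔭 ≃L[ℝ] 𝔭} (hh : F.SolvesII qγ J μ h) (hk : F.SolvesII qγ J μ k) {t : ℝ}
    (ht : t ∈ J) : h t = k t := by
  have : CompleteSpace 𝔭 := FiniteDimensional.complete ℝ 𝔭
  obtain ⟨Q, hQ⟩ := hh.exists_operator hqγ hμ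
  obtain ⟨Q', hQ'⟩ := hk.exists_operator hqγ hμ
  -- the inverses solve `l' = lQ`
  have hd : ∀ l : ℝ → 𝔭 ≃L[ℝ] 𝔭, ∀ t, HasDerivAt (fun τ => (l τ : 𝔭 →L[ℝ] 𝔭))
      (-(Q t ∘L (l t : 𝔭 →L[ℝ] 𝔭))) t → HasDerivAt (fun τ => ((l τ).symm : 𝔭 →L[ℝ] 𝔭))
        (-(((l t).symm : 𝔭 →L[ℝ] 𝔭) ∘L (-Q t))) t := fun l t hl => by
    refine (hasDerivAt_symm hl).congr_deriv ?_
    ext x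
    simp
  have h1 := eq_of_deriv_eq_neg_comp hJ hJ' (Q := fun t => -Q t) (h := fun t => (h t).symm)
    (k := fun t => (k t).symm) (fun t ht => hd h t (hQ t ht).2.1)
    (fun t ht => hd k t (by
      rw [(hQ t ht).1.unique hqγ (hμ.2 t ht).1 (hQ' t ht).1]
      exact (hQ' t ht).2.1)) h0 ht (by rw [hh.1, hk.1])
  exact ContinuousLinearEquiv.symm_bijective.injective h1

end GeometricFlow

theorem hasDerivAt_pull_const {h : ℝ → 𝔭 ≃L[ℝ] 𝔭} {h' : 𝔭 →L[ℝ] 𝔭} {t : ℝ}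
    (hh : HasDerivAt (fun τ => (h τ : 𝔭 →L[ℝ] 𝔭)) h' t) (γ : Tensors r s 𝔭) (i : ι)
    (w : Fin (r i) → 𝔭) (α : Fin (s i) → Module.Dual ℝ 𝔭) :
    HasDerivAt (fun τ => pull (h τ : 𝔭 →L[ℝ] 𝔭) γ i w α)
      (-(pull (h t : 𝔭 →L[ℝ] 𝔭) (thetaHom γ (h' ∘L ((h t).symm : 𝔭 →L[ℝ] 𝔭))) i w α)) t := by
  refine (hasDerivAt_pull hh (γ := fun _ => γ) (γ' := 0) (fun i w α => hasDerivAt_const _ _)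
    i w α).congr_deriv ?_
  rw [pull_apply, pull_apply]
  exact zero_sub _

/-- The curve `h(t)^* (θ(Q(t))γ)` has continuous coefficients, as is seen by writing `Q(t)` in a
basis of `gl`. -/
theorem continuousOn_pull_thetaHom {h : ℝ → 𝔭 ≃L[ℝ] 𝔭} {h' Q : ℝ → 𝔭 →L[ℝ] 𝔭}
    (hh : ∀ t ∈ J, HasDerivAt (fun τ => (h τ : 𝔭 →L[ℝ] 𝔭)) (h' t) t) (hQ : ContinuousOn Q J)
    (γ : Tensors r s 𝔭) (i : ι) (w : Fin (r i) → 𝔭) (α : Fin (s i) → Module.Dual ℝ 𝔭) :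
    ContinuousOn (fun t => pull (h t : 𝔭 →L[ℝ] 𝔭) (thetaHom γ (Q t)) i w α) J := by
  let b := Module.finBasis ℝ (𝔭 →L[ℝ] 𝔭)
  have h1 : ∀ t, pull (h t : 𝔭 →L[ℝ] 𝔭) (thetaHom γ (Q t)) i w α =
      ∑ j, b.coord j (Q t) * pull (h t : 𝔭 →L[ℝ] 𝔭) (thetaHom γ (b j)) i w α := by
    intro t
    let ev : (𝔭 →L[ℝ] 𝔭) →ₗ[ℝ] ℝ :=
      { toFun := fun A => pull (h t : 𝔭 →L[ℝ] 𝔭) (thetaHom γ A) i w α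
        map_add' := fun A B => by
          rw [map_add]
          rfl
        map_smul' := fun c A => by
          rw [map_smul]
          rfl }
    change ev (Q t) = ∑ j, b.coord j (Q t) * ev (b j)
    conv_lhs => rw [← b.sum_repr (Q t), map_sum]
    refine Finset.sum_congr rfl fun j _ => ?_
    rw [map_smul, smul_eq_mul, Module.Basis.coord_apply]
  simp only [h1]
  refine continuousOn_finsetSum _ fun j _ => ContinuousOn.mul ?_ fun t ht => ?_
  · exact (LinearMap.continuous_of_finiteDimensional (b.coord j)).comp_continuousOn hQ
  · exact (hasDerivAt_pull_const (hh t ht) _ i w α).continuousAt.continuousWithinAt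

namespace GeometricFlow

/-- If `h` solves `h' = -Q_{μ(t)} h` for a bracket flow solution, then `h(t)^* γ` is an invariant
solution: its structures are the pullbacks of those determined by `γ` on `G_{μ(t)}/K_{μ(t)}`. -/
theorem SolvesII.exists_isInvariantSolution (hqγ : IsInvariantComplement γ qγ)
    (hF : F.LocallyLipschitz 𝔨 qγ) (P : HomogeneousSpace.{u} lie) (hJ : IsOpen J)
    (hJ' : J.OrdConnected) (h0 : (0 : ℝ) ∈ J) {μ : ℝ → Br 𝔨 𝔭}
    (hμ : F.IsBracketFlow qγ lie J μ) {h : ℝ → 𝔭 ≃L[ℝ] 𝔭} (hh : F.SolvesII qγ J μ h) :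
    ∃ Γ : ℝ → TensorField r s 𝔭 P.space, F.IsInvariantSolution P J Γ ∧
      ∀ t ∈ J, P.atOrigin (Γ t) = pull (h t : 𝔭 →L[ℝ] 𝔭) γ := by
  obtain ⟨Q, hQ⟩ := hh.exists_operator hqγ hμ
  -- the pullback of the invariant structure determined by `γ` under `G/K → G_{μ(t)}/K_{μ(t)}`
  have hex : ∀ t, ∃ δ : TensorField r s 𝔭 P.space, t ∈ J → δ ∈ F.dom P.space ∧
      P.IsInvariant δ ∧ P.atOrigin δ = pull (h t : 𝔭 →L[ℝ] 𝔭) γ ∧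
      P.atOrigin (F.q P.space δ) = pull (h t : 𝔭 →L[ℝ] 𝔭) (thetaHom γ (Q t)) := by
    intro t
    by_cases ht : t ∈ J
    · obtain ⟨R⟩ := (hμ.2 t ht).1.closed
      obtain ⟨ε, hε, hεγ⟩ := (hμ.2 t ht).1.mem_dom R
      obtain ⟨φ, hφ⟩ := HomogeneousSpace.exists_isEquivariantDiffeo P R (h t)
        (hh.eq_act hqγ hJ hJ' h0 hμ ht)
      refine ⟨TensorField.pullback φ ε, fun _ => ⟨F.pullback_mem _ _ φ ε hε,
        hφ.isInvariant_pullback hεγ.1, ?_, ?_⟩⟩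
      · rw [hφ.atOrigin_pullback, hεγ.2]
      · rw [F.atOrigin_pullback_flow hφ hε, ((F.isBracketOperator_iff hε hεγ _).1 (hQ t ht).1).2]
    · exact ⟨fun _ => 0, fun h => absurd h ht⟩
  choose Γ hΓ using hex
  -- the values of invariant tensor fields at `gK`, in terms of the values at the origin
  have hval : ∀ (g : P.G) (δ : TensorField r s 𝔭 P.space), P.IsInvariant δ → ∀ (i : ι)
      (w : Fin (r i) → 𝔭) (α : Fin (s i) → Module.Dual ℝ 𝔭), δ.val (P.proj g) i w α =
        P.atOrigin δ i (fun k => (P.tisoE.trans (P.smulE g P.origin)).symm (w k))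
          (fun k => (α k).comp ((P.tisoE.trans (P.smulE g P.origin)).symm.symm :
            𝔭 →L[ℝ] 𝔭).toLinearMap) := by
    intro g δ hδ i w α
    rw [P.val_proj hδ, pull_equiv_apply]
  refine ⟨Γ, ⟨?_, fun t ht => (hΓ t ht).1, fun t ht => (hΓ t ht).2.1, ?_, ?_⟩,
    fun t ht => (hΓ t ht).2.2.1⟩
  · rw [(hΓ 0 h0).2.2.1, hh.1, pull_refl]
  · intro t ht x i w α
    obtain ⟨g, rfl⟩ := P.exists_proj_eq x
    obtain ⟨hd, hinv, hγ, hq⟩ := hΓ t ht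
    suffices ∀ (w : Fin (r i) → 𝔭) (α : Fin (s i) → Module.Dual ℝ 𝔭),
        HasDerivAt (fun τ => (Γ τ).val (P.proj g) i w α)
          ((F.q P.space (Γ t)).val (P.proj g) i w α) t from this w α
    intro w α
    have h1 := hasDerivAt_pull_const (hQ t ht).2.1 γ i
      (fun k => (P.tisoE.trans (P.smulE g P.origin)).symm (w k))
      (fun k => (α k).comp ((P.tisoE.trans (P.smulE g P.origin)).symm.symm :
        𝔭 →L[ℝ] 𝔭).toLinearMap)
    have h2 : (-(Q t ∘L (h t : 𝔭 →L[ℝ] 𝔭))) ∘L ((h t).symm : 𝔭 →L[ℝ] 𝔭) = (-1 : ℝ) • Q t := by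
      ext x
      simp
    have h3 : ∀ i w α, -(pull (h t : 𝔭 →L[ℝ] 𝔭) (thetaHom γ ((-1 : ℝ) • Q t)) i w α) =
        P.atOrigin (F.q P.space (Γ t)) i w α := by
      intro i w α
      rw [map_smul, hq, pull_apply, pull_apply]
      have h4 : ∀ a : ℝ, -((-1 : ℝ) • a) = a := fun a => by simp
      exact h4 _
    rw [h2, h3, ← hval g _ (hinv.flow F hd)] at h1
    refine h1.congr_of_eventuallyEq ?_
    filter_upwards [hJ.mem_nhds ht] with τ hτ
    have h5 := hval g _ (hΓ τ hτ).2.1 i w α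
    rw [(hΓ τ hτ).2.2.1] at h5
    exact h5
  · intro x i w α
    obtain ⟨g, rfl⟩ := P.exists_proj_eq x
    suffices ∀ (w : Fin (r i) → 𝔭) (α : Fin (s i) → Module.Dual ℝ 𝔭),
        ContinuousOn (fun τ => (F.q P.space (Γ τ)).val (P.proj g) i w α) J from this w α
    intro w α
    have h1 := continuousOn_pull_thetaHom (fun t ht => (hQ t ht).2.1)
      (hμ.continuousOn_operator hF fun t ht => (hQ t ht).1) γ i
      (fun k => (P.tisoE.trans (P.smulE g P.origin)).symm (w k))
      (fun k => (α k).comp ((P.tisoE.trans (P.smulE g P.origin)).symm.symm :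
        𝔭 →L[ℝ] 𝔭).toLinearMap)
    refine h1.congr fun t ht => ?_
    have h2 := hval g _ ((hΓ t ht).2.1.flow F (hΓ t ht).1) i w α
    rw [(hΓ t ht).2.2.2] at h2
    exact h2

/-- The curve `h̃(t) · [·,·]` is the given bracket flow solution by uniqueness. -/
theorem SolvesI.solvesII (hqγ : IsInvariantComplement γ qγ) (hF : F.LocallyLipschitz 𝔨 qγ)
    (hlie : F.Admissible lie) (hJ : IsOpen J) (hJ' : J.OrdConnected) (h0 : (0 : ℝ) ∈ J)
    {Γ : ℝ → TensorField r s 𝔭 P.space} {μ : ℝ → Br 𝔨 𝔭} (hΓ : F.IsInvariantSolution P J Γ)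
    (hμ : F.IsBracketFlow qγ lie J μ) {h : ℝ → 𝔭 ≃L[ℝ] 𝔭} (hh : F.SolvesI qγ P J Γ h) :
    F.SolvesII qγ J μ h := by
  refine ⟨hh.1, fun t ht => ?_⟩
  rw [hμ.eqOn hF hJ hJ' h0 (hh.isBracketFlow hqγ hlie hJ hJ' h0 hΓ) t ht]
  exact hh.exists_isBracketOperator hqγ hJ hJ' h0 hΓ ht

theorem SolvesII.solvesI [Finite ι] (hqγ : IsInvariantComplement γ qγ)
    (hF : F.LocallyLipschitz 𝔨 qγ)
    (hlie : F.Admissible lie) (hJ : IsOpen J) (hJ' : J.OrdConnected) (h0 : (0 : ℝ) ∈ J)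
    {Γ : ℝ → TensorField r s 𝔭 P.space} {μ : ℝ → Br 𝔨 𝔭} (hΓ : F.IsInvariantSolution P J Γ)
    (hμ : F.IsBracketFlow qγ lie J μ) {h : ℝ → 𝔭 ≃L[ℝ] 𝔭} (hh : F.SolvesII qγ J μ h) :
    F.SolvesI qγ P J Γ h := by
  -- `h` agrees with a solution `k` of the equation `k' = -kQ(t)`
  obtain ⟨k, hk⟩ := hΓ.exists_solvesI hqγ hJ hJ' h0
  have hkh : ∀ t ∈ J, k t = h t := fun t ht =>
    (hk.solvesII hqγ hF hlie hJ hJ' h0 hΓ hμ).eqOn hqγ hJ hJ' h0 hμ hh ht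
  refine ⟨hh.1, fun t ht => ?_⟩
  obtain ⟨Q, h1, h2, h3⟩ := hk.2 t ht
  rw [hkh t ht] at h3
  refine ⟨Q, h1, h2, h3.congr_of_eventuallyEq ?_⟩
  filter_upwards [hJ.mem_nhds ht] with τ hτ
  rw [hkh τ hτ]

end GeometricFlow

end Solutions

end BracketFlow

theorem mainTheorem1 {𝔨 𝔭 : Type*} [NormedAddCommGroup 𝔨] [NormedSpace ℝ 𝔨]
    [FiniteDimensional ℝ 𝔨] [NormedAddCommGroup 𝔭] [NormedSpace ℝ 𝔭] [FiniteDimensional ℝ 𝔭]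
    {ι : Type} [Finite ι] {r s : ι → ℕ}
    (γ : BracketFlow.Tensors r s 𝔭) (qγ : Submodule ℝ (𝔭 →L[ℝ] 𝔭))
    (hqγ : BracketFlow.IsInvariantComplement γ qγ)
    (F : BracketFlow.GeometricFlow.{u} γ) (hF : F.LocallyLipschitz 𝔨 qγ)
    (lie : BracketFlow.Br 𝔨 𝔭) (P : BracketFlow.HomogeneousSpace.{u} lie)
    (hlie : F.Admissible lie)
    (J : Set ℝ) (hJ : IsOpen J) (hJ' : J.OrdConnected) (h0 : (0 : ℝ) ∈ J) :
    (∀ Γ : ℝ → BracketFlow.TensorField r s 𝔭 P.space, F.IsInvariantSolution P J Γ →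
      (∃ h : ℝ → 𝔭 ≃L[ℝ] 𝔭, F.SolvesI qγ P J Γ h) ∧
      ∀ h : ℝ → 𝔭 ≃L[ℝ] 𝔭, F.SolvesI qγ P J Γ h →
        F.IsBracketFlow qγ lie J (fun t => BracketFlow.Br.act (BracketFlow.tilde 𝔨 (h t)) lie)) ∧
    (∀ μ : ℝ → BracketFlow.Br 𝔨 𝔭, F.IsBracketFlow qγ lie J μ →
      (∃ h : ℝ → 𝔭 ≃L[ℝ] 𝔭, F.SolvesII qγ J μ h) ∧
      ∀ h : ℝ → 𝔭 ≃L[ℝ] 𝔭, F.SolvesII qγ J μ h →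
        ∃ Γ : ℝ → BracketFlow.TensorField r s 𝔭 P.space, F.IsInvariantSolution P J Γ ∧
          ∀ t ∈ J, P.atOrigin (Γ t) = BracketFlow.pull (h t : 𝔭 →L[ℝ] 𝔭) γ) ∧
    (∀ (Γ : ℝ → BracketFlow.TensorField r s 𝔭 P.space) (μ : ℝ → BracketFlow.Br 𝔨 𝔭),
      F.IsInvariantSolution P J Γ → F.IsBracketFlow qγ lie J μ →
      (∃ h : ℝ → 𝔭 ≃L[ℝ] 𝔭, F.SolvesI qγ P J Γ h) ∧
      (∀ h : ℝ → 𝔭 ≃L[ℝ] 𝔭, F.SolvesI qγ P J Γ h ↔ F.SolvesII qγ J μ h) ∧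
      (∀ h : ℝ → 𝔭 ≃L[ℝ] 𝔭, F.SolvesI qγ P J Γ h → ∀ t ∈ J,
        P.atOrigin (Γ t) = BracketFlow.pull (h t : 𝔭 →L[ℝ] 𝔭) γ ∧
        μ t = BracketFlow.Br.act (BracketFlow.tilde 𝔨 (h t)) lie ∧
        ∀ R : BracketFlow.HomogeneousSpace.{u} (μ t),
          ∃ δ : BracketFlow.TensorField r s 𝔭 R.space, R.IsInvariantExtension γ δ ∧
          ∃ φ : Diffeomorph 𝓘(ℝ, 𝔭) 𝓘(ℝ, 𝔭) P.space R.space ∞,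
            BracketFlow.IsEquivariantDiffeo P R (h t) φ ∧
            Γ t = BracketFlow.TensorField.pullback φ δ)) := by
  refine ⟨fun Γ hΓ => ⟨hΓ.exists_solvesI hqγ hJ hJ' h0, fun h hh =>
    hh.isBracketFlow hqγ hlie hJ hJ' h0 hΓ⟩, fun μ hμ => ⟨hμ.exists_solvesII hF hJ hJ' h0,
    fun h hh => hh.exists_isInvariantSolution hqγ hF P hJ hJ' h0 hμ⟩, fun Γ μ hΓ hμ =>
    ⟨hΓ.exists_solvesI hqγ hJ hJ' h0, fun h => ⟨fun hh => hh.solvesII hqγ hF hlie hJ hJ' h0 hΓ hμ,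
      fun hh => hh.solvesI hqγ hF hlie hJ hJ' h0 hΓ hμ⟩, fun h hh t ht => ?_⟩⟩
  have hγ := hh.atOrigin_eq hJ hJ' h0 hΓ ht
  have hμt := (hh.solvesII hqγ hF hlie hJ hJ' h0 hΓ hμ).eq_act hqγ hJ hJ' h0 hμ ht
  refine ⟨hγ, hμt, fun R => ?_⟩
  obtain ⟨δ, -, hδ⟩ := (hμ.2 t ht).1.mem_dom R
  obtain ⟨φ, hφ⟩ := BracketFlow.HomogeneousSpace.exists_isEquivariantDiffeo P R (h t) hμt
  refine ⟨δ, hδ, φ, hφ, (hΓ.invariant t ht).eq_of_atOrigin (hφ.isInvariant_pullback hδ.1) ?_⟩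
  rw [hφ.atOrigin_pullback, hδ.2, hγ]
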